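/- **Conventions.** Let $(N,h)$ be an oriented three-dimensional real-analytic Riemannian manifold; functions, one-forms and vector fields are smooth ($C^\infty$), and functions called $u$ are positive. We write $*$ for the Hodge star, $\nabla$ for the Levi-Civita connection, $\mathcal L$ for the Lie derivative, $\flat,\sharp$ for the musical isomorphisms of $h$, and $\alpha\odot\beta=\frac12(\alpha\otimes\beta+\beta\otimes\alpha)$. For a function $u>0$ and a one-form $A$ on $N$ with $du=*dA$, the Gibbons–Hawking construction gives the Riemannian metric $$g=u\,h+u^{-1}(dt+A)^2\quad\text{on } M=N\times\mathbb R ,$$ where $t$ is the coordinate of $\mathbb R$. A vector field on $M$ is horizontal if it is annihilated by $dt+A$, and the horizontal lift of a vector field $F$ on $N$ is $F-A(F)\frac{\partial}{\partial t}$; a basic vector field is such a lift. A vector field $E$ on $M$ is a soliton flow, with corresponding constant $a\in\mathbb R$, if $S_E:=\mathrm{Ric}^M+a\,g+\frac12\mathcal L_E g=0$. **Theorem 4.5.** (1) Let $a,b\in\mathbb R$ with $b\neq0$, let $u>0$ be a harmonic function on $N$, let $B$ be a one-form on $N$ with $du=*dB$, and let $w$ be a function on $N$ satisfying $$\begin{aligned}(\mathrm{grad}\,w)(u)&=bu^3+aB^\sharp(u),\\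 \nabla_{\mathrm{grad}\,w}du&=-u^{-1}|du|^2(dw-aB)+\tfrac52bu^2du-a[\mathrm{grad}\,u,B^\sharp]^\flat+\tfrac12a(\mathcal L_{B^\sharp}h)(\mathrm{grad}\,u,\cdot),\\ \nabla dw&=\tfrac12a\mathcal L_{B^\sharp}h-\tfrac12bu^2h+2u^{-1}du\odot(dw-aB).\end{aligned}$$ For functions $v,f_0$ on an open set $W\subseteq N$ put $A=B+dv$, let $g$ be the Gibbons–Hawking metric on $W\times\mathbb R$ given by $u$ and $A$, and let $$E=E_{v,f_0}=\bigl(f_0-at+\tfrac14bt^2\bigr)\tfrac{\partial}{\partial t}+t\,F,$$ where $F$ is the horizontal lift of $u^{-2}(\mathrm{grad}\,w-aB^\sharp)$. Then every point of $N$ has a connected open neighbourhood $U$ on which there are functions $v$ and $f_0$ such that $E$ satisfies the soliton equation in the vertical directions, i.e. $S_E(\frac{\partial}{\partial t},\cdot)=0$ on $U\times\mathbb R$. They are unique up to constants: if $W\subseteq U$ is open and connected and functions $v',f_0'$ on $W$ have the same property on $W\times\mathbb R$ (in particular, if $E_{v',f_0'}$ is a soliton flow there), then $v'-v$ and $f_0'-f_0$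 are constant on $W$. Moreover, for these $v$ and $f_0$ and for every open $W\subseteq U$, the following assertions are equivalent: (i) $E$ is a soliton flow on $(W\times\mathbb R,g)$, with corresponding constant $a$; (ii) $\mathrm{Ric}^N+a\,u\,h-u^{-1}A\odot(dw-aB)=0$ on $W$. (2) Let $N$ be connected, let $M=N\times\mathbb R$ carry the Gibbons–Hawking metric $g$ given by a nonconstant function $u>0$ and a one-form $A$ with $du=*dA$, and let $E$ be a soliton flow on $(M,g)$, with corresponding constant $a$, whose horizontal part is $t$ times the horizontal lift of a vector field on $N$ that is not identically zero. Then $E$ arises as in (1): $u$ is harmonic, and there are a constant $b\neq0$, a one-form $B$ with $du=*dB$, a function $w$ satisfying the above system, and functions $v,f_0$ on $N$, such that $A=B+dv$, $E=(f_0-at+\frac14bt^2)\frac{\partial}{\partial t}+tF$ with $F$ the horizontal lift of $u^{-2}(\mathrm{grad}\,w-aB^\sharp)$, and (ii) holds on $N$. -/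

import Mathlib

open Set Bundle Manifold
open scoped ContDiff Topology

noncomputable section

/-! ## Tensor calculus in a coordinate domain

`E` is a finite-dimensional real vector space, `G` a field of symmetric bilinear forms on (an open
subset of) `E`, i.e. a metric written in coordinates. -/

namespace Coord

variable {E : Type*} [NormedAddCommGroup E] [NormedSpace ℝ E]

/-- The trilinear form `(X, Y, Z) ↦ T(Z, X, Y)`. -/
def rotate (T : E →L[ℝ] E →L[ℝ] E →L[ℝ] ℝ) : E →L[ℝ] E →L[ℝ] E →L[ℝ] ℝ :=
  ContinuousLinearMap.comp
    ((ContinuousLinearMap.flipₗᵢ ℝ E E ℝ).toLinearIsometry.toContinuousLinearMap) T.flip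

theorem rotate_apply (T : E →L[ℝ] E →L[ℝ] E →L[ℝ] ℝ) (X Y Z : E) :
    rotate T X Y Z = T Z X Y := rfl

/-- Raising the last index of a trilinear form with the inverse of `G`. -/
def raise (G : E → E →L[ℝ] E →L[ℝ] ℝ) (e : E) (T : E →L[ℝ] E →L[ℝ] E →L[ℝ] ℝ) :
    E →L[ℝ] E →L[ℝ] E :=
  (ContinuousLinearMap.compL ℝ E (E →L[ℝ] ℝ) E (G e).inverse).comp T

/-- Christoffel symbols `Γ(X, Y)` of the Levi-Civita connection of `G`, so that
`∇_X Y = ∂_X Y + Γ(X, Y)`: the vector `Γ(X, Y)` is dual with respect to `G` to the covector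
`Z ↦ ½ (∂_X G(Y, Z) + ∂_Y G(X, Z) - ∂_Z G(X, Y))`. -/
def christoffel (G : E → E →L[ℝ] E →L[ℝ] ℝ) (e : E) : E →L[ℝ] E →L[ℝ] E :=
  (1 / 2 : ℝ) • (raise G e (fderiv ℝ G e :) + raise G e (fderiv ℝ G e).flip
    - raise G e (rotate (fderiv ℝ G e :)))

theorem christoffel_apply (G : E → E →L[ℝ] E →L[ℝ] ℝ) (e X Y : E) :
    christoffel G e X Y = (G e).inverse ((1 / 2 : ℝ) •
      (fderiv ℝ G e X Y + fderiv ℝ G e Y X - ((fderiv ℝ G e).flip X).flip Y)) := by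
  rw [map_smul, map_sub, map_add]
  rfl

/-- The endomorphism `X ↦ R(X, Y) Z`, where `R(X, Y) = [∇_X, ∇_Y] - ∇_[X, Y]`. -/
def curvature (G : E → E →L[ℝ] E →L[ℝ] ℝ) (e Y Z : E) : E →L[ℝ] E :=
  ((fderiv ℝ (christoffel G) e).flip Y).flip Z - (fderiv ℝ (christoffel G) e Y).flip Z
    + (christoffel G e).flip (christoffel G e Y Z)
    - (christoffel G e Y).comp ((christoffel G e).flip Z)

theorem curvature_apply (G : E → E →L[ℝ] E →L[ℝ] ℝ) (e X Y Z : E) :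
    curvature G e Y Z X = fderiv ℝ (christoffel G) e X Y Z - fderiv ℝ (christoffel G) e Y X Z
      + christoffel G e X (christoffel G e Y Z) - christoffel G e Y (christoffel G e X Z) := by
  simp [curvature]

/-- The Ricci tensor `Ric(Y, Z) = tr (X ↦ R(X, Y) Z)`. -/
def ricci (G : E → E →L[ℝ] E →L[ℝ] ℝ) (e Y Z : E) : ℝ :=
  LinearMap.trace ℝ E (curvature G e Y Z : E →ₗ[ℝ] E)

/-- Covariant derivative of a one-form: `(∇_X α)(Y) = ∂_X α(Y) - α(Γ(X, Y))`. -/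
def nabla (G : E → E →L[ℝ] E →L[ℝ] ℝ) (α : E → E →L[ℝ] ℝ) (e X Y : E) : ℝ :=
  fderiv ℝ α e X Y - α e (christoffel G e X Y)

/-- Exterior derivative of a one-form: `dα(X, Y) = ∂_X α(Y) - ∂_Y α(X)`. -/
def extDeriv₁ (α : E → E →L[ℝ] ℝ) (e X Y : E) : ℝ :=
  fderiv ℝ α e X Y - fderiv ℝ α e Y X

/-- Lie derivative of a bilinear form along a vector field:
`(L_V T)(X, Y) = ∂_V T(X, Y) + T(∂_X V, Y) + T(X, ∂_Y V)`. -/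
def lieDeriv (V : E → E) (T : E → E →L[ℝ] E →L[ℝ] ℝ) (e X Y : E) : ℝ :=
  fderiv ℝ T e (V e) X Y + T e (fderiv ℝ V e X) Y + T e X (fderiv ℝ V e Y)

end Coord

/-! ## Tensor calculus on a manifold (without boundary)

Tensor fields are given by their values in the tangent spaces. Each differential operator is
evaluated at a point `x` in the preferred chart at `x`. -/

section Manifold

variable {E : Type*} [NormedAddCommGroup E] [NormedSpace ℝ E]
  {H : Type*} [TopologicalSpace H] (I : ModelWithCorners ℝ E H)
  {M : Type*} [TopologicalSpace M] [ChartedSpace H M]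

/-- A vector field (not necessarily smooth). -/
abbrev VField (M : Type*) [TopologicalSpace M] [ChartedSpace H M] : Type _ :=
  Π x : M, TangentSpace I x

/-- A one-form (not necessarily smooth). -/
abbrev Form1 (M : Type*) [TopologicalSpace M] [ChartedSpace H M] : Type _ :=
  Π x : M, TangentSpace I x →L[ℝ] ℝ

/-- A field of bilinear forms on the tangent spaces (not necessarily smooth). -/
abbrev Bilin (M : Type*) [TopologicalSpace M] [ChartedSpace H M] : Type _ :=
  Π x : M, TangentSpace I x →L[ℝ] TangentSpace I x →L[ℝ] ℝ

variable {I}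

/-- A `C^∞` vector field. -/
def SmoothVField [IsManifold I 1 M] (V : VField I M) : Prop :=
  ContMDiff I I.tangent ∞ (fun x => (⟨x, V x⟩ : TangentBundle I M))

/-- A `C^∞` one-form, i.e. a smooth section of the cotangent bundle. -/
def SmoothForm1 [IsManifold I 1 M] (α : Form1 I M) : Prop :=
  ContMDiff I (I.prod 𝓘(ℝ, E →L[ℝ] ℝ)) ∞
    (fun x => TotalSpace.mk' (E →L[ℝ] ℝ) (E := fun x : M => TangentSpace I x →L[ℝ] ℝ) x (α x))

/-- The differential of the inverse of the preferred chart at `x`, at the coordinate point `e`. -/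
def invChartDeriv (I : ModelWithCorners ℝ E H) (x : M) (e : E) :
    E →L[ℝ] TangentSpace I ((extChartAt I x).symm e) :=
  mfderiv 𝓘(ℝ, E) I (extChartAt I x).symm e

/-- The differential at `x` of the preferred chart at `x`. -/
def chartDeriv (I : ModelWithCorners ℝ E H) (x : M) : TangentSpace I x →L[ℝ] E :=
  mfderiv I 𝓘(ℝ, E) (extChartAt I x) x

/-- The pull-back `(X, Y) ↦ T(LX, LY)` of a bilinear form by a linear map. -/
def pullBilin {V W : Type*} [AddCommGroup V] [Module ℝ V] [TopologicalSpace V]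
    [AddCommGroup W] [Module ℝ W] [TopologicalSpace W]
    (T : W →L[ℝ] W →L[ℝ] ℝ) (L : V →L[ℝ] W) : V →L[ℝ] V →L[ℝ] ℝ :=
  (ContinuousLinearMap.precomp ℝ L).comp (T.comp L)

theorem pullBilin_apply {V W : Type*} [AddCommGroup V] [Module ℝ V] [TopologicalSpace V]
    [AddCommGroup W] [Module ℝ W] [TopologicalSpace W]
    (T : W →L[ℝ] W →L[ℝ] ℝ) (L : V →L[ℝ] W) (X Y : V) : pullBilin T L X Y = T (L X) (L Y) :=
  rfl

/-- The expression of a vector field in the preferred chart at `x`. -/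
def VField.inChart (V : VField I M) (x : M) : E → E :=
  VectorField.mpullback 𝓘(ℝ, E) I (extChartAt I x).symm V

/-- The expression of a one-form in the preferred chart at `x`. -/
def Form1.inChart (α : Form1 I M) (x : M) (e : E) : E →L[ℝ] ℝ :=
  (α ((extChartAt I x).symm e)).comp (invChartDeriv I x e)

/-- The expression of a field of bilinear forms in the preferred chart at `x`. -/
def Bilin.inChart (T : Bilin I M) (x : M) (e : E) : E →L[ℝ] E →L[ℝ] ℝ :=
  pullBilin (T ((extChartAt I x).symm e)) (invChartDeriv I x e)

/-- The Ricci tensor of the metric `g`. -/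
def ricciTensor (g : Bilin I M) (x : M) (X Y : TangentSpace I x) : ℝ :=
  Coord.ricci (g.inChart x) (extChartAt I x x) (chartDeriv I x X) (chartDeriv I x Y)

/-- `(∇_X α)(Y)`, for the Levi-Civita connection of the metric `g` and a one-form `α`. -/
def covDeriv (g : Bilin I M) (α : Form1 I M) (x : M) (X Y : TangentSpace I x) : ℝ :=
  Coord.nabla (g.inChart x) (α.inChart x) (extChartAt I x x) (chartDeriv I x X) (chartDeriv I x Y)

/-- The exterior derivative `dα(X, Y)` of a one-form `α`. -/
def extDerivForm (α : Form1 I M) (x : M) (X Y : TangentSpace I x) : ℝ :=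
  Coord.extDeriv₁ (α.inChart x) (extChartAt I x x) (chartDeriv I x X) (chartDeriv I x Y)

/-- The Lie derivative `(L_V T)(X, Y)` of a field of bilinear forms `T`. -/
def lieDerivative (V : VField I M) (T : Bilin I M) (x : M) (X Y : TangentSpace I x) : ℝ :=
  Coord.lieDeriv (V.inChart x) (T.inChart x) (extChartAt I x x) (chartDeriv I x X)
    (chartDeriv I x Y)

variable (I) in
/-- The differential `du` of a function, as a one-form. -/
def dform (u : M → ℝ) : Form1 I M := fun x => mvfderiv I u x

/-- The vector field `α♯` dual to the one-form `α` with respect to the metric `g`. -/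
def sharp (g : Bilin I M) (α : Form1 I M) : VField I M := fun x => (g x).inverse (α x)

/-- The gradient of a function. -/
def grad (g : Bilin I M) (u : M → ℝ) : VField I M := sharp g (dform I u)

/-- `u` is harmonic: `trace_g (∇ du) = 0`, the trace being computed in `g`-orthonormal bases of
the tangent spaces. -/
def IsHarmonic (g : Bilin I M) (u : M → ℝ) : Prop :=
  ∀ (x : M) (b : Module.Basis (Fin (Module.finrank ℝ E)) ℝ (TangentSpace I x)),
    (∀ i j, g x (b i) (b j) = if i = j then 1 else 0) →
    ∑ i, covDeriv g (dform I u) x (b i) (b i) = 0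

/-- The symmetric product `α ⊙ β = ½ (α ⊗ β + β ⊗ α)` of two covectors. -/
def symProd {V : Type*} [AddCommGroup V] [Module ℝ V] [TopologicalSpace V]
    (α β : V →L[ℝ] ℝ) (X Y : V) : ℝ :=
  1 / 2 * (α X * β Y + α Y * β X)

/-- The soliton tensor `Ric + a g + ½ L_E g`. -/
def solitonTensor (g : Bilin I M) (a : ℝ) (V : VField I M) (x : M) (X Y : TangentSpace I x) : ℝ :=
  ricciTensor g x X Y + a * g x X Y + 1 / 2 * lieDerivative V g x X Y

/-- `V` is a soliton flow on the open set `S` of `(M, g)`, with corresponding constant `a`: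
`Ric + a g + ½ L_V g = 0` on `S`. -/
def IsSolitonFlowOn (g : Bilin I M) (a : ℝ) (V : VField I M) (S : Set M) : Prop :=
  ∀ x ∈ S, ∀ X Y : TangentSpace I x, solitonTensor g a V x X Y = 0

end Manifold

/-! ## Oriented Riemannian three-manifolds and the Gibbons--Hawking construction -/

/-- The model space of three-manifolds. -/
abbrev E3 : Type := EuclideanSpace ℝ (Fin 3)

section Three

variable {N : Type*} [TopologicalSpace N] [ChartedSpace E3 N]

/-- A field of alternating trilinear forms on the tangent spaces (not necessarily smooth). -/
abbrev Form3 (N : Type*) [TopologicalSpace N] [ChartedSpace E3 N] : Type _ :=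
  Π x : N, TangentSpace (𝓡 3) x [⋀^Fin 3]→L[ℝ] ℝ

/-- `vol` is the volume form of an orientation of `(N, h)`: a three-form with smooth coefficients
in the charts and with `vol(X, Y, Z)² = det (Gram matrix of X, Y, Z)`, i.e. `vol = ±1` on
orthonormal frames. The choice of `vol` is the choice of an orientation. -/
structure IsVolumeForm (h : Bilin (𝓡 3) N) (vol : Form3 N) : Prop where
  smooth : ∀ (x : N) (X : Fin 3 → E3), ContDiffOn ℝ ∞
    (fun e => vol ((extChartAt (𝓡 3) x).symm e) (fun i => invChartDeriv (𝓡 3) x e (X i)))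
    (extChartAt (𝓡 3) x).target
  sq_eq : ∀ (x : N) (X : Fin 3 → TangentSpace (𝓡 3) x),
    (vol x X) ^ 2 = (Matrix.of fun i j => h x (X i) (X j)).det

/-- `α = *β`, for a one-form `α` and a two-form `β` on an oriented Riemannian three-manifold:
`α(Z) = β(X, Y)` for every positively oriented orthonormal frame `(X, Y, Z)`. -/
def IsHodgeStar (h : Bilin (𝓡 3) N)
    (vol : Form3 N)
    (α : Form1 (𝓡 3) N) (β : Π x : N, TangentSpace (𝓡 3) x → TangentSpace (𝓡 3) x → ℝ) : Prop :=
  ∀ (x : N) (X Y Z : TangentSpace (𝓡 3) x),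
    h x X X = 1 → h x Y Y = 1 → h x Z Z = 1 → h x X Y = 0 → h x X Z = 0 → h x Y Z = 0 →
    vol x ![X, Y, Z] = 1 → α x Z = β x X Y

/-- The monopole equation `du = *dA`. -/
def IsMonopole (h : Bilin (𝓡 3) N)
    (vol : Form3 N)
    (u : N → ℝ) (A : Form1 (𝓡 3) N) : Prop :=
  IsHodgeStar h vol (dform (𝓡 3) u) (extDerivForm A)

/-- The model with corners of `N × ℝ`. -/
abbrev I4 : ModelWithCorners ℝ (E3 × ℝ) (ModelProd E3 ℝ) := (𝓡 3).prod 𝓘(ℝ, ℝ)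

/-- The differential of the projection `φ : N × ℝ → N`. -/
def dproj (p : N × ℝ) : TangentSpace I4 p →L[ℝ] TangentSpace (𝓡 3) p.1 :=
  mfderiv I4 (𝓡 3) Prod.fst p

/-- The one-form `θ = dt + φ^*A` on `N × ℝ`. -/
def theta (A : Form1 (𝓡 3) N) : Form1 I4 (N × ℝ) := fun p =>
  dform I4 (Prod.snd : N × ℝ → ℝ) p + (A p.1).comp (dproj p)

/-- The Gibbons--Hawking metric `g = u φ^*h + u⁻¹ θ²` on `N × ℝ`, with `θ = dt + φ^*A`. -/
def ghMetric (h : Bilin (𝓡 3) N) (u : N → ℝ) (A : Form1 (𝓡 3) N) : Bilin I4 (N × ℝ) := fun p =>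
  u p.1 • pullBilin (h p.1) (dproj p)
    + (u p.1)⁻¹ • (theta A p).smulRight (theta A p)

/-- The vertical vector field `∂/∂t` on `N × ℝ`. -/
def vertical : VField I4 (N × ℝ) := fun p =>
  ((0, 1) : TangentSpace (𝓡 3) p.1 × TangentSpace 𝓘(ℝ, ℝ) p.2)

/-- The horizontal lift `F - A(F) ∂/∂t` of a vector field `F` on `N`: it projects onto `F` and is
annihilated by `θ`. -/
def horizLift (A : Form1 (𝓡 3) N) (F : VField (𝓡 3) N) : VField I4 (N × ℝ) := fun p =>
  ((F p.1, -(A p.1 (F p.1))) : TangentSpace (𝓡 3) p.1 × TangentSpace 𝓘(ℝ, ℝ) p.2)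

/-- The vector field `f ∂/∂t + t F̃` on `N × ℝ`, with `F̃` the horizontal lift of `F`. -/
def flowField (A : Form1 (𝓡 3) N) (f : N × ℝ → ℝ) (F : VField (𝓡 3) N) : VField I4 (N × ℝ) :=
  fun p => f p • vertical p + p.2 • horizLift A F p

/-- The function `(x, t) ↦ f₀(x) - a t + ¼ b t²`. -/
def vertCoeff (a b : ℝ) (f₀ : N → ℝ) : N × ℝ → ℝ := fun p =>
  f₀ p.1 - a * p.2 + 1 / 4 * b * p.2 ^ 2

/-- The vector field `u⁻² (grad w - a B♯)` on `N`. -/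
def basicField (h : Bilin (𝓡 3) N) (a : ℝ) (u : N → ℝ) (B : Form1 (𝓡 3) N) (w : N → ℝ) :
    VField (𝓡 3) N := fun x =>
  (u x ^ 2)⁻¹ • (grad h w x - a • sharp h B x)

/-- The vector field `(f₀ - a t + ¼ b t²) ∂/∂t + t F` on `N × ℝ`, where `F` is the lift, horizontal
with respect to `A`, of `u⁻² (grad w - a B♯)`. -/
def ansatzField (h : Bilin (𝓡 3) N) (a b : ℝ) (u : N → ℝ) (B A : Form1 (𝓡 3) N)
    (w f₀ : N → ℝ) : VField I4 (N × ℝ) :=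
  flowField A (vertCoeff a b f₀) (basicField h a u B w)

/-- The system of first and second order equations on `w`:
* `(grad w)(u) = b u³ + a B♯(u)`,
* `∇_{grad w} du = -u⁻¹ |du|² (dw - a B) + (5/2) b u² du - a [grad u, B♯]♭
    + ½ a (L_{B♯} h)(grad u, ·)`,
* `∇ dw = ½ a L_{B♯} h - ½ b u² h + 2 u⁻¹ du ⊙ (dw - a B)`. -/
structure SolvesSystem (h : Bilin (𝓡 3) N) (a b : ℝ) (u : N → ℝ) (B : Form1 (𝓡 3) N)
    (w : N → ℝ) : Prop where
  first : ∀ x : N,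
    dform (𝓡 3) u x (grad h w x) = b * u x ^ 3 + a * dform (𝓡 3) u x (sharp h B x)
  second : ∀ (x : N) (X : TangentSpace (𝓡 3) x),
    covDeriv h (dform (𝓡 3) u) x (grad h w x) X =
      -(u x)⁻¹ * dform (𝓡 3) u x (grad h u x) * (dform (𝓡 3) w x X - a * B x X)
      + 5 / 2 * b * u x ^ 2 * dform (𝓡 3) u x X
      - a * h x (VectorField.mlieBracket (𝓡 3) (grad h u) (sharp h B) x) X
      + 1 / 2 * a * lieDerivative (sharp h B) h x (grad h u x) X
  third : ∀ (x : N) (X Y : TangentSpace (𝓡 3) x),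
    covDeriv h (dform (𝓡 3) w) x X Y =
      1 / 2 * a * lieDerivative (sharp h B) h x X Y - 1 / 2 * b * u x ^ 2 * h x X Y
      + 2 * (u x)⁻¹ * symProd (dform (𝓡 3) u x) (dform (𝓡 3) w x - a • B x) X Y

/-- The tensor equation `Ric^N + a u h - u⁻¹ A ⊙ (dw - a B) = 0` on `S ⊆ N`. -/
def RicciConditionOn (h : Bilin (𝓡 3) N) (a : ℝ) (u : N → ℝ) (B A : Form1 (𝓡 3) N)
    (w : N → ℝ) (S : Set N) : Prop :=
  ∀ x ∈ S, ∀ X Y : TangentSpace (𝓡 3) x,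
    ricciTensor h x X Y + a * u x * h x X Y
      - (u x)⁻¹ * symProd (A x) (dform (𝓡 3) w x - a • B x) X Y = 0

/-- The soliton equation for the vector field `V` on `S × ℝ`, restricted to pairs of vectors the
first of which is vertical: `(Ric + a g + ½ L_V g)(∂/∂t, ·) = 0`. -/
def VerticalSolitonOn (g : Bilin I4 (N × ℝ)) (a : ℝ) (V : VField I4 (N × ℝ)) (S : Set N) : Prop :=
  ∀ p : N × ℝ, p.1 ∈ S → ∀ X : TangentSpace I4 p, solitonTensor g a V p (vertical p) X = 0

end Three

end

/-! Write `θ = dt + A` and consider a field `f ∂/∂t + t F̃`, with `F̃` the horizontal lift of `F`.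
Two computations carry the theorem. First, `dA = *du` forces `u` to be harmonic and `dA` to be
coclosed, and then the Ricci tensor of `g` is the pull-back of `Ric^N`
(`GHData.ricci_gh_of_monopole`). Indeed the Levi-Civita connections of `g` and `h` differ by a
tensor in `du` and `dA`; in the trace of the curvature its quadratic terms cancel because `dA =
*du`, and its derivative contributes only the Laplacian of `u` and the divergence of `dA`. Second,
the Lie derivative of `g` along the field is explicit (`GHData.lieDeriv_gh`). By
`solitonTensor_ghMetric` the soliton equation then splits into vertical: `∂f/∂t = -a + (t/2)
F(u)/u`, mixed: `df(ỹ) + u² F♭(y) + t dA(F, y) = 0`, with `ỹ` the horizontal lift of `y`,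
horizontal: `Ric^N + a u h - u A ⊙ F♭ + (t/2) (F(u) h + u L_F h) = 0`.

Part (1). For `F = u⁻² (grad w - a B♯)` the first and third equations of the system become the
scaling laws `F(u) = b u` and `L_F h = -b h`. With `f = f₀ - a t + ¼ b t²` the vertical equation
holds, and the mixed one separates by powers of `t` into `df₀ = -a A - u² F♭` and `i_F dB = (b/2)
A`. The second determines `dv = (2/b) i_F dB - B`. This form is closed: since `F` scales `u` and
`h`, it scales `dB = *du` with weight `b/2` (`GHData.lieDeriv_extDeriv₁`), and Cartan's formula
applies. The first is then solved by `f₀ = -w - a v`. So `v` and `f₀` exist locally and are unique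
up to constants (`exists_vertical_solution`). In the horizontal equation the coefficient of `t`
vanishes, and the remainder is condition (ii), because `u² F♭ = dw - a B`.

Part (2). The vertical equation makes `f` quadratic in `t`. Comparing its coefficients with the
mixed equation shows that `F(u)/u` is a constant `b` and that `i_F dA = (b/2) A`; the horizontal
equation gives `L_F h = -b h`. If `b = 0`, then `F` is Killing and vanishes wherever `du ≠ 0`, so it
vanishes identically by unique continuation (`eq_zero_of_killing_of_extDerivForm_eq_zero`). Hence `b
≠ 0`, and `B = A`, `v = 0`, `w = -f(·, 0)` satisfy the system by `solvesSystem_of_dform_eq`.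

All tensor identities are proved in a coordinate domain. The manifold operators at a point are
defined in the preferred chart there, and naturality of `d` and of the Lie derivative relates
different charts. -/

/-! ### Riemannian metrics in coordinates and their Christoffel symbols. -/

namespace Coord

variable {E : Type*} [NormedAddCommGroup E] [NormedSpace ℝ E]

/-- A smooth Riemannian metric on the open subset `O` of a vector space. -/
structure MetricOn (G : E → E →L[ℝ] E →L[ℝ] ℝ) (O : Set E) : Prop where
  isOpen : IsOpen O
  smooth : ContDiffOn ℝ ∞ G O
  symm : ∀ e ∈ O, ∀ X Y, G e X Y = G e Y X
  pos : ∀ e ∈ O, ∀ X, X ≠ 0 → 0 < G e X X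

theorem MetricOn.mono {G : E → E →L[ℝ] E →L[ℝ] ℝ} {O O' : Set E} (hG : MetricOn G O)
    (hO : IsOpen O') (h : O' ⊆ O) : MetricOn G O' :=
  ⟨hO, hG.smooth.mono h, fun e he => hG.symm e (h he), fun e he => hG.pos e (h he)⟩

theorem isInvertible_of_pos [FiniteDimensional ℝ E] {g : E →L[ℝ] E →L[ℝ] ℝ}
    (hg : ∀ X, X ≠ 0 → 0 < g X X) : g.IsInvertible := by
  have hinj : Function.Injective (g : E →ₗ[ℝ] E →L[ℝ] ℝ) := by
    rw [← LinearMap.ker_eq_bot, LinearMap.ker_eq_bot']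
    intro X hX
    by_contra hne
    have := hg X hne
    have h0 : g X = 0 := hX
    simp [h0] at this
  have hdim : Module.finrank ℝ E = Module.finrank ℝ (E →L[ℝ] ℝ) := by
    rw [← (LinearMap.toContinuousLinearMap (𝕜 := ℝ) (E := E) (F' := ℝ)).finrank_eq]
    exact (Subspace.dual_finrank_eq (K := ℝ) (V := E)).symm
  refine ⟨(LinearEquiv.ofInjectiveOfFinrankEq _ hinj hdim).toContinuousLinearEquiv, ?_⟩
  ext X Y
  rfl

theorem isInvertible_comp_inverse {F : Type*} [NormedAddCommGroup F] [NormedSpace ℝ F]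
    {g : E →L[ℝ] F} (hg : g.IsInvertible) (α : F) : g (g.inverse α) = α := by
  obtain ⟨e, rfl⟩ := hg
  simp

theorem isInvertible_inverse_comp {F : Type*} [NormedAddCommGroup F] [NormedSpace ℝ F]
    {g : E →L[ℝ] F} (hg : g.IsInvertible) (X : E) : g.inverse (g X) = X := by
  obtain ⟨e, rfl⟩ := hg
  simp

section

variable {G : E → E →L[ℝ] E →L[ℝ] ℝ} {O : Set E} {e : E}

theorem MetricOn.isInvertible [FiniteDimensional ℝ E] (hG : MetricOn G O) (he : e ∈ O) : (G e).IsInvertible :=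
  isInvertible_of_pos (hG.pos e he)

theorem MetricOn.apply_inverse [FiniteDimensional ℝ E] (hG : MetricOn G O) (he : e ∈ O) (α : E →L[ℝ] ℝ) :
    G e ((G e).inverse α) = α :=
  isInvertible_comp_inverse (hG.isInvertible he) α

theorem MetricOn.inverse_apply [FiniteDimensional ℝ E] (hG : MetricOn G O) (he : e ∈ O) (X : E) :
    (G e).inverse (G e X) = X :=
  isInvertible_inverse_comp (hG.isInvertible he) X

theorem MetricOn.ext [FiniteDimensional ℝ E] (hG : MetricOn G O) (he : e ∈ O) {X Y : E} (h : ∀ Z, G e X Z = G e Y Z) :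
    X = Y := by
  rw [← hG.inverse_apply he X, ← hG.inverse_apply he Y]
  congr 1
  ext Z
  exact h Z

theorem MetricOn.contDiffAt (hG : MetricOn G O) (he : e ∈ O) : ContDiffAt ℝ ∞ G e :=
  hG.smooth.contDiffAt (hG.isOpen.mem_nhds he)

theorem MetricOn.differentiableAt (hG : MetricOn G O) (he : e ∈ O) : DifferentiableAt ℝ G e :=
  (hG.contDiffAt he).differentiableAt (by simp)

theorem MetricOn.contDiffAt_inverse [FiniteDimensional ℝ E] (hG : MetricOn G O) (he : e ∈ O) :
    ContDiffAt ℝ ∞ (fun e => (G e).inverse) e :=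
  ContDiffAt.comp e ((hG.isInvertible he).contDiffAt_map_inverse) (hG.contDiffAt he)

theorem MetricOn.fderiv_symm (hG : MetricOn G O) (he : e ∈ O) (X Y Z : E) :
    fderiv ℝ G e X Y Z = fderiv ℝ G e X Z Y := by
  have h1 : fderiv ℝ (fun e' => G e' Y Z) e X = fderiv ℝ G e X Y Z := by
    have := ((hG.differentiableAt he).hasFDerivAt.clm_apply (hasFDerivAt_const Y e)).clm_apply
      (hasFDerivAt_const Z e)
    rw [this.fderiv]; simp
  have h2 : fderiv ℝ (fun e' => G e' Z Y) e X = fderiv ℝ G e X Z Y := by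
    have := ((hG.differentiableAt he).hasFDerivAt.clm_apply (hasFDerivAt_const Z e)).clm_apply
      (hasFDerivAt_const Y e)
    rw [this.fderiv]; simp
  rw [← h1, ← h2]
  congr 1
  apply Filter.EventuallyEq.fderiv_eq
  filter_upwards [hG.isOpen.mem_nhds he] with e' he'
  exact hG.symm e' he' Y Z

theorem MetricOn.apply_christoffel [FiniteDimensional ℝ E] (hG : MetricOn G O) (he : e ∈ O) (X Y Z : E) :
    G e (christoffel G e X Y) Z =
      1 / 2 * (fderiv ℝ G e X Y Z + fderiv ℝ G e Y X Z - fderiv ℝ G e Z X Y) := by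
  rw [christoffel_apply, hG.apply_inverse he]
  simp

theorem MetricOn.christoffel_symm [FiniteDimensional ℝ E] (hG : MetricOn G O) (he : e ∈ O) (X Y : E) :
    christoffel G e X Y = christoffel G e Y X := by
  apply hG.ext he
  intro Z
  rw [hG.apply_christoffel he, hG.apply_christoffel he, hG.fderiv_symm he Z X Y]
  ring

/-- Metric compatibility `∇G = 0`. Later computations use it to trade every derivative of `G` for
Christoffel terms, which then cancel. -/
theorem MetricOn.fderiv_apply [FiniteDimensional ℝ E] (hG : MetricOn G O) (he : e ∈ O) (X Y Z : E) :
    fderiv ℝ G e X Y Z = G e (christoffel G e X Y) Z + G e Y (christoffel G e X Z) := by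
  rw [hG.symm e he Y, hG.apply_christoffel he, hG.apply_christoffel he, hG.fderiv_symm he X Z Y,
    hG.fderiv_symm he Y X Z, hG.fderiv_symm he Z X Y]
  ring

theorem MetricOn.fderiv_apply₁ (hG : MetricOn G O) (he : e ∈ O) (Y X : E) :
    fderiv ℝ (fun e' => G e' Y) e X = fderiv ℝ G e X Y := by
  rw [((hG.differentiableAt he).hasFDerivAt.clm_apply (hasFDerivAt_const Y e)).fderiv]
  simp

theorem MetricOn.fderiv_apply₂ (hG : MetricOn G O) (he : e ∈ O) (Y Z X : E) :
    fderiv ℝ (fun e' => G e' Y Z) e X = fderiv ℝ G e X Y Z := by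
  rw [(((hG.differentiableAt he).hasFDerivAt.clm_apply (hasFDerivAt_const Y e)).clm_apply
    (hasFDerivAt_const Z e)).fderiv]
  simp

theorem MetricOn.contDiffOn_christoffel [FiniteDimensional ℝ E] (hG : MetricOn G O) :
    ContDiffOn ℝ ∞ (christoffel G) O := by
  refine contDiffOn_clm_apply.2 fun X => contDiffOn_clm_apply.2 fun Y => ?_
  have h1 : ∀ Y : E, ContDiffOn ℝ ∞ (fun e => G e Y) O := fun Y =>
    hG.smooth.clm_apply contDiffOn_const
  have h2 : ∀ X Y : E, ContDiffOn ℝ ∞ (fun e => fderiv ℝ (fun e' => G e' Y) e X) O := fun X Y =>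
    ((h1 Y).fderiv_of_isOpen hG.isOpen (by simp)).clm_apply contDiffOn_const
  -- The covector `Z ↦ ∂_Z G(X, Y)` is the differential of the function `G(X, Y)`.
  have h3 : ContDiffOn ℝ ∞ (fderiv ℝ (fun e' => G e' X Y)) O :=
    ((h1 X).clm_apply contDiffOn_const).fderiv_of_isOpen hG.isOpen (by simp)
  have hi : ContDiffOn ℝ ∞ (fun e => (G e).inverse) O := fun e he =>
    (hG.contDiffAt_inverse he).contDiffWithinAt
  refine (hi.clm_apply (contDiffOn_const (c := (1 / 2 : ℝ)).smul
    (((h2 X Y).add (h2 Y X)).sub h3))).congr ?_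
  intro e he
  rw [christoffel_apply]
  congr 2
  ext Z
  simp only [sub_apply, add_apply,
    ContinuousLinearMap.flip_apply, hG.fderiv_apply₁ he, hG.fderiv_apply₂ he]

theorem MetricOn.contDiffAt_christoffel [FiniteDimensional ℝ E] (hG : MetricOn G O) (he : e ∈ O) :
    ContDiffAt ℝ ∞ (christoffel G) e :=
  hG.contDiffOn_christoffel.contDiffAt (hG.isOpen.mem_nhds he)

end

theorem trace_eq_sum [FiniteDimensional ℝ E] {ι : Type*} [Fintype ι] [DecidableEq ι]
    (b : Module.Basis ι ℝ E) (L : E →L[ℝ] E) :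
    LinearMap.trace ℝ E (L : E →ₗ[ℝ] E) = ∑ i, b.repr (L (b i)) i := by
  rw [LinearMap.trace_eq_matrix_trace ℝ b, Matrix.trace]
  simp [LinearMap.toMatrix_apply]

end Coord

/-! ### The Gibbons–Hawking metric in coordinates and its Levi-Civita connection. -/

namespace Coord

variable {E : Type*} [NormedAddCommGroup E] [NormedSpace ℝ E]

/-- The connection form `dt + A` on `E × ℝ`. -/
noncomputable def ghForm (A : E → E →L[ℝ] ℝ) (p : E × ℝ) : E × ℝ →L[ℝ] ℝ :=
  ContinuousLinearMap.snd ℝ E ℝ + (A p.1).comp (ContinuousLinearMap.fst ℝ E ℝ)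

/-- The Gibbons--Hawking metric `u G + u⁻¹ (dt + A)²` on `E × ℝ`. -/
noncomputable def gh (G : E → E →L[ℝ] E →L[ℝ] ℝ) (u : E → ℝ) (A : E → E →L[ℝ] ℝ) (p : E × ℝ) :
    E × ℝ →L[ℝ] E × ℝ →L[ℝ] ℝ :=
  u p.1 • pullBilin (G p.1) (ContinuousLinearMap.fst ℝ E ℝ)
    + (u p.1)⁻¹ • (ghForm A p).smulRight (ghForm A p)

theorem ghForm_apply (A : E → E →L[ℝ] ℝ) (p X : E × ℝ) : ghForm A p X = X.2 + A p.1 X.1 := rfl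

theorem gh_apply (G : E → E →L[ℝ] E →L[ℝ] ℝ) (u : E → ℝ) (A : E → E →L[ℝ] ℝ) (p X Y : E × ℝ) :
    gh G u A p X Y = u p.1 * G p.1 X.1 Y.1 + (u p.1)⁻¹ * (ghForm A p X * ghForm A p Y) := rfl

/-- A metric, a positive function and a one-form, all smooth on an open set `O`. -/
structure GHData (G : E → E →L[ℝ] E →L[ℝ] ℝ) (u : E → ℝ) (A : E → E →L[ℝ] ℝ) (O : Set E) :
    Prop where
  metric : MetricOn G O
  smooth_u : ContDiffOn ℝ ∞ u O
  pos_u : ∀ e ∈ O, 0 < u e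
  smooth_A : ContDiffOn ℝ ∞ A O

section

variable {G : E → E →L[ℝ] E →L[ℝ] ℝ} {u : E → ℝ} {A : E → E →L[ℝ] ℝ} {O : Set E} {p : E × ℝ}

theorem GHData.mono {O' : Set E} (h : GHData G u A O) (hO : IsOpen O') (hs : O' ⊆ O) :
    GHData G u A O' :=
  ⟨h.metric.mono hO hs, h.smooth_u.mono hs, fun e he => h.pos_u e (hs he), h.smooth_A.mono hs⟩

/-- Tensor fields are differentiated along one line at a time. Two expressions of the same quantity
along a line are then compared by uniqueness of the derivative at `0`, which leaves only
one-variable product rules. -/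
theorem hasDerivAt_comp_line {E F : Type*} [NormedAddCommGroup E] [NormedSpace ℝ E]
    [NormedAddCommGroup F] [NormedSpace ℝ F] {f : E → F} {e : E}
    (hf : DifferentiableAt ℝ f e) (X : E) :
    HasDerivAt (fun s : ℝ => f (e + s • X)) (fderiv ℝ f e X) 0 := by
  have hf' : HasFDerivAt f (fderiv ℝ f e) (e + (0 : ℝ) • X) := by
    simpa using hf.hasFDerivAt
  have hl : HasDerivAt (fun s : ℝ => e + s • X) X 0 := by
    simpa using! ((hasDerivAt_id (0 : ℝ)).smul_const X).const_add e
  exact hf'.comp_hasDerivAt (0 : ℝ) hl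

theorem GHData.metricOn [FiniteDimensional ℝ E] (h : GHData G u A O) : MetricOn (gh G u A) (O ×ˢ univ) where
  isOpen := h.metric.isOpen.prod isOpen_univ
  smooth := by
    have hfst : ContDiffOn ℝ ∞ (Prod.fst : E × ℝ → E) (O ×ˢ univ) := contDiffOn_fst
    have hm : MapsTo (Prod.fst : E × ℝ → E) (O ×ˢ univ) O := fun p hp => hp.1
    have hu := h.smooth_u.comp hfst hm
    have hA := h.smooth_A.comp hfst hm
    have hG := h.metric.smooth.comp hfst hm
    refine contDiffOn_clm_apply.2 fun X => contDiffOn_clm_apply.2 fun Y => ?_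
    have hθ : ∀ X : E × ℝ, ContDiffOn ℝ ∞ (fun p => ghForm A p X) (O ×ˢ univ) := fun X =>
      contDiffOn_const.add (hA.clm_apply contDiffOn_const)
    exact (hu.mul ((hG.clm_apply contDiffOn_const).clm_apply contDiffOn_const)).add
      ((hu.inv fun p hp => (h.pos_u p.1 hp.1).ne').mul ((hθ X).mul (hθ Y)))
  symm := by
    rintro p ⟨hp, -⟩ X Y
    rw [gh_apply, gh_apply, h.metric.symm p.1 hp X.1]
    ring
  pos := by
    rintro p ⟨hp, -⟩ X hX
    rw [gh_apply]
    have hu := h.pos_u p.1 hp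
    by_cases hx : X.1 = 0
    · have h2 : X.2 ≠ 0 := fun h2 => hX (Prod.ext hx h2)
      simp only [hx, ghForm_apply, map_zero, mul_zero, add_zero, zero_add]
      have : 0 < X.2 * X.2 := mul_self_pos.2 h2
      positivity
    · have := h.metric.pos p.1 hp X.1 hx
      have h3 := mul_self_nonneg (ghForm A p X)
      positivity

theorem GHData.differentiableAt_u (h : GHData G u A O) {e : E} (he : e ∈ O) :
    DifferentiableAt ℝ u e :=
  (h.smooth_u.contDiffAt (h.metric.isOpen.mem_nhds he)).differentiableAt (by simp)

theorem GHData.differentiableAt_A (h : GHData G u A O) {e : E} (he : e ∈ O) :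
    DifferentiableAt ℝ A e :=
  (h.smooth_A.contDiffAt (h.metric.isOpen.mem_nhds he)).differentiableAt (by simp)

theorem GHData.fderiv_ghForm (h : GHData G u A O) (hp : p.1 ∈ O) (X Y : E × ℝ) :
    HasDerivAt (fun s : ℝ => ghForm A (p + s • X) Y) (fderiv ℝ A p.1 X.1 Y.1) 0 := by
  have h1 := ((hasDerivAt_comp_line (h.differentiableAt_A hp) X.1).clm_apply
    (hasDerivAt_const (0 : ℝ) Y.1)).const_add Y.2
  simp only [map_zero, add_zero] at h1
  exact h1

theorem MetricOn.hasDerivAt_line {O : Set E} {G : E → E →L[ℝ] E →L[ℝ] ℝ} {e : E}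
    (hG : MetricOn G O) (he : e ∈ O) (X y z : E) :
    HasDerivAt (fun s : ℝ => G (e + s • X) y z) (fderiv ℝ G e X y z) 0 := by
  have hd : DifferentiableAt ℝ (fun e' => G e' y z) e :=
    ((hG.differentiableAt he).clm_apply (differentiableAt_const y)).clm_apply
      (differentiableAt_const z)
  rw [← hG.fderiv_apply₂ he]
  exact hasDerivAt_comp_line hd X

theorem GHData.fderiv_gh [FiniteDimensional ℝ E] (h : GHData G u A O) (hp : p.1 ∈ O)
    (X Y Z : E × ℝ) :
    fderiv ℝ (gh G u A) p X Y Z =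
      fderiv ℝ u p.1 X.1 * G p.1 Y.1 Z.1 + u p.1 * fderiv ℝ G p.1 X.1 Y.1 Z.1
      - (u p.1)⁻¹ ^ 2 * fderiv ℝ u p.1 X.1 * ghForm A p Y * ghForm A p Z
      + (u p.1)⁻¹ * (fderiv ℝ A p.1 X.1 Y.1 * ghForm A p Z
        + ghForm A p Y * fderiv ℝ A p.1 X.1 Z.1) := by
  have h1 := h.metricOn.hasDerivAt_line (e := p) ⟨hp, trivial⟩ X Y Z
  have hu := hasDerivAt_comp_line (h.differentiableAt_u hp) X.1
  have hu' := hu.inv (by simpa using (h.pos_u _ hp).ne')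
  have h2 := (hu.mul (h.metric.hasDerivAt_line hp X.1 Y.1 Z.1)).add
    (hu'.mul ((h.fderiv_ghForm hp X Y).mul (h.fderiv_ghForm hp X Z)))
  refine (h1.unique h2).trans ?_
  simp only [zero_smul, add_zero, ghForm_apply, Pi.mul_apply, Pi.inv_apply]
  have hne := (h.pos_u _ hp).ne'
  field_simp
  ring

/-- The trilinear form describing the horizontal part of the difference between the connections of
`gh G u A` and of `G`; a vector on `E × ℝ` enters through its projection to `E` and the value on it
of the connection form. -/
noncomputable def ghSlot (G : E → E →L[ℝ] E →L[ℝ] ℝ) (u : E → ℝ) (A : E → E →L[ℝ] ℝ) (e : E)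
    (y : E) (η : ℝ) (z : E) (ζ : ℝ) (w : E) : ℝ :=
  1 / 2 * (u e)⁻¹ * (fderiv ℝ u e y * G e z w + fderiv ℝ u e z * G e y w
      - G e y z * fderiv ℝ u e w)
    + 1 / 2 * (u e)⁻¹ ^ 3 * (η * ζ * fderiv ℝ u e w)
    + 1 / 2 * (u e)⁻¹ ^ 2 * (ζ * extDeriv₁ A e y w + η * extDeriv₁ A e z w)

variable [FiniteDimensional ℝ E]

theorem GHData.apply_christoffel_fst (h : GHData G u A O) (hp : p.1 ∈ O) (X Y : E × ℝ) (w : E) :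
    G p.1 (christoffel (gh G u A) p X Y).1 w = G p.1 (christoffel G p.1 X.1 Y.1) w
      + ghSlot G u A p.1 X.1 (ghForm A p X) Y.1 (ghForm A p Y) w := by
  -- Testing against the horizontal lift of `w`, which `θ` annihilates, isolates the horizontal
  -- component; testing against `∂/∂t` isolates the vertical one in the next lemma.
  have h1 := h.metricOn.apply_christoffel (e := p) ⟨hp, trivial⟩ X Y (w, -A p.1 w)
  have hθ : ghForm A p (w, -A p.1 w) = 0 := by simp [ghForm_apply]
  rw [gh_apply, h.fderiv_gh hp, h.fderiv_gh hp, h.fderiv_gh hp, hθ] at h1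
  have h2 := h.metric.apply_christoffel hp X.1 Y.1 w
  have hne := (h.pos_u _ hp).ne'
  simp only [ghSlot, extDeriv₁]
  rw [h2]
  have h3 : G p.1 (christoffel (gh G u A) p X Y).1 w = (u p.1)⁻¹ * (u p.1 *
    G p.1 (christoffel (gh G u A) p X Y).1 w + (u p.1)⁻¹ *
      (ghForm A p (christoffel (gh G u A) p X Y) * 0)) := by field_simp; ring
  rw [h3, h1]
  field_simp
  ring

set_option synthInstance.maxHeartbeats 200000 in
theorem GHData.ghForm_christoffel (h : GHData G u A O) (hp : p.1 ∈ O) (X Y : E × ℝ) :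
    ghForm A p (christoffel (gh G u A) p X Y) =
      1 / 2 * (fderiv ℝ A p.1 X.1 Y.1 + fderiv ℝ A p.1 Y.1 X.1)
      - 1 / 2 * (u p.1)⁻¹ * (fderiv ℝ u p.1 X.1 * ghForm A p Y
        + fderiv ℝ u p.1 Y.1 * ghForm A p X) := by
  have h1 := h.metricOn.apply_christoffel (e := p) ⟨hp, trivial⟩ X Y (0, 1)
  have hθ : ghForm A p (0, 1) = 1 := by simp [ghForm_apply]
  rw [gh_apply, h.fderiv_gh hp, h.fderiv_gh hp, h.fderiv_gh hp, hθ] at h1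
  have hne := (h.pos_u _ hp).ne'
  simp only [map_zero, zero_apply, mul_zero, zero_mul, zero_add, mul_one, add_zero, sub_zero] at h1
  have h3 : ghForm A p (christoffel (gh G u A) p X Y) = u p.1 * ((u p.1)⁻¹ *
    ghForm A p (christoffel (gh G u A) p X Y)) := by field_simp
  rw [h3, h1]
  field_simp
  ring

end

end Coord

/-! ### Derivative of the difference tensor of the two connections. -/

namespace Coord

variable {E : Type*} [NormedAddCommGroup E] [NormedSpace ℝ E]
  {G : E → E →L[ℝ] E →L[ℝ] ℝ} {u : E → ℝ} {A : E → E →L[ℝ] ℝ} {O : Set E} {p : E × ℝ}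

set_option synthInstance.maxHeartbeats 200000 in
theorem hasDerivAt_line_apply₂ {E F : Type*} [NormedAddCommGroup E] [NormedSpace ℝ E]
    [NormedAddCommGroup F] [NormedSpace ℝ F] {T : E → E →L[ℝ] E →L[ℝ] F} {e : E}
    (hT : DifferentiableAt ℝ T e) (X Y Z : E) :
    HasDerivAt (fun s : ℝ => T (e + s • X) Y Z) (fderiv ℝ T e X Y Z) 0 := by
  have h1 := (hT.hasFDerivAt.clm_apply (hasFDerivAt_const Y e)).clm_apply (hasFDerivAt_const Z e)
  have h2 := hasDerivAt_comp_line h1.differentiableAt X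
  rw [h1.fderiv] at h2
  simpa using h2

theorem hasDerivAt_line_apply {E F : Type*} [NormedAddCommGroup E] [NormedSpace ℝ E]
    [NormedAddCommGroup F] [NormedSpace ℝ F] {T : E → E →L[ℝ] F} {e : E}
    (hT : DifferentiableAt ℝ T e) (X Y : E) :
    HasDerivAt (fun s : ℝ => T (e + s • X) Y) (fderiv ℝ T e X Y) 0 := by
  have h1 := hT.hasFDerivAt.clm_apply (hasFDerivAt_const Y e)
  have h2 := hasDerivAt_comp_line h1.differentiableAt X
  rw [h1.fderiv] at h2
  simpa using h2

theorem eventually_line_mem {E : Type*} [NormedAddCommGroup E] [NormedSpace ℝ E] {O : Set E}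
    (hO : IsOpen O) {e : E} (he : e ∈ O) (X : E) : ∀ᶠ s : ℝ in 𝓝 0, e + s • X ∈ O := by
  have hc : ContinuousAt (fun s : ℝ => e + s • X) 0 := by fun_prop
  exact hc (by simpa using hO.mem_nhds he)

theorem GHData.contDiffOn_fderiv_u (h : GHData G u A O) : ContDiffOn ℝ ∞ (fderiv ℝ u) O :=
  h.smooth_u.fderiv_of_isOpen h.metric.isOpen (by simp)

theorem GHData.differentiableAt_fderiv_u (h : GHData G u A O) {e : E} (he : e ∈ O) :
    DifferentiableAt ℝ (fderiv ℝ u) e :=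
  (h.contDiffOn_fderiv_u.contDiffAt (h.metric.isOpen.mem_nhds he)).differentiableAt (by simp)

theorem contDiffOn_extDeriv₁ (hO : IsOpen O) (hA : ContDiffOn ℝ ∞ A O) (y z : E) :
    ContDiffOn ℝ ∞ (fun e => extDeriv₁ A e y z) O := by
  have h1 : ContDiffOn ℝ ∞ (fderiv ℝ A) O := hA.fderiv_of_isOpen hO (by simp)
  exact ((h1.clm_apply contDiffOn_const).clm_apply contDiffOn_const).sub
    ((h1.clm_apply contDiffOn_const).clm_apply contDiffOn_const)

theorem GHData.differentiableAt_extDeriv₁ (h : GHData G u A O) {e : E} (he : e ∈ O) (y z : E) :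
    DifferentiableAt ℝ (fun e => extDeriv₁ A e y z) e :=
  ((contDiffOn_extDeriv₁ h.metric.isOpen h.smooth_A y z).contDiffAt
    (h.metric.isOpen.mem_nhds he)).differentiableAt (by simp)

/-- Covariant derivative of the two-form `dA`: `(∇_x dA)(y, z)`. -/
noncomputable def nablaExtDeriv (G : E → E →L[ℝ] E →L[ℝ] ℝ) (A : E → E →L[ℝ] ℝ) (e x y z : E) : ℝ :=
  fderiv ℝ (fun e' => extDeriv₁ A e' y z) e x - extDeriv₁ A e (christoffel G e x y) z
    - extDeriv₁ A e y (christoffel G e x z)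

/-- The covariant derivative of `ghSlot`. -/
noncomputable def ghSlotDeriv (G : E → E →L[ℝ] E →L[ℝ] ℝ) (u : E → ℝ) (A : E → E →L[ℝ] ℝ) (e : E)
    (x : E) (y : E) (η : ℝ) (z : E) (ζ : ℝ) (w : E) : ℝ :=
  -(1 / 2 * (u e)⁻¹ ^ 2 * fderiv ℝ u e x * (fderiv ℝ u e y * G e z w + fderiv ℝ u e z * G e y w
      - G e y z * fderiv ℝ u e w))
    + 1 / 2 * (u e)⁻¹ * (nabla G (fderiv ℝ u) e x y * G e z w
      + nabla G (fderiv ℝ u) e x z * G e y w - G e y z * nabla G (fderiv ℝ u) e x w)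
    - 3 / 2 * (u e)⁻¹ ^ 4 * fderiv ℝ u e x * (η * ζ * fderiv ℝ u e w)
    + 1 / 2 * (u e)⁻¹ ^ 3 * ((1 / 2 * extDeriv₁ A e x y * ζ + η * (1 / 2 * extDeriv₁ A e x z))
        * fderiv ℝ u e w + η * ζ * nabla G (fderiv ℝ u) e x w)
    - (u e)⁻¹ ^ 3 * fderiv ℝ u e x * (ζ * extDeriv₁ A e y w + η * extDeriv₁ A e z w)
    + 1 / 2 * (u e)⁻¹ ^ 2 * (1 / 2 * extDeriv₁ A e x z * extDeriv₁ A e y w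
        + 1 / 2 * extDeriv₁ A e x y * extDeriv₁ A e z w
        + ζ * nablaExtDeriv G A e x y w + η * nablaExtDeriv G A e x z w)

/-- The symmetrized derivative of `A`. -/
noncomputable def symDeriv (A : E → E →L[ℝ] ℝ) (e x y : E) : ℝ :=
  1 / 2 * (fderiv ℝ A e x y + fderiv ℝ A e y x)

theorem symDeriv_comm (A : E → E →L[ℝ] ℝ) (e x y : E) : symDeriv A e x y = symDeriv A e y x := by
  simp only [symDeriv, add_comm]

theorem fderiv_eq_symDeriv_add (A : E → E →L[ℝ] ℝ) (e x y : E) :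
    fderiv ℝ A e x y = symDeriv A e x y + 1 / 2 * extDeriv₁ A e x y := by
  simp only [symDeriv, extDeriv₁]; ring

variable [FiniteDimensional ℝ E]

/-- The product rule, with `∂G` eliminated by metric compatibility. The derivative of `A` splits
into `½ dA`, which is tensorial and absorbed in `ghSlotDeriv`, and `symDeriv`, which corrects the
vertical slots just as the Christoffel symbols of `G` correct the horizontal ones. Being symmetric,
these corrections drop out of the curvature. -/
theorem GHData.hasDerivAt_ghSlot (h : GHData G u A O) (hp : p.1 ∈ O) (X Y Z : E × ℝ) (w : E) :
    HasDerivAt (fun s : ℝ => ghSlot G u A (p.1 + s • X.1) Y.1 (ghForm A (p + s • X) Y) Z.1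
        (ghForm A (p + s • X) Z) w)
      (ghSlotDeriv G u A p.1 X.1 Y.1 (ghForm A p Y) Z.1 (ghForm A p Z) w
        + ghSlot G u A p.1 (christoffel G p.1 X.1 Y.1) (symDeriv A p.1 X.1 Y.1) Z.1 (ghForm A p Z) w
        + ghSlot G u A p.1 Y.1 (ghForm A p Y) (christoffel G p.1 X.1 Z.1) (symDeriv A p.1 X.1 Z.1) w
        + ghSlot G u A p.1 Y.1 (ghForm A p Y) Z.1 (ghForm A p Z) (christoffel G p.1 X.1 w)) 0 := by
  have hne := (h.pos_u _ hp).ne'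
  have hu := (hasDerivAt_comp_line (h.differentiableAt_u hp) X.1).inv (by simpa using hne)
  have hdu := fun y => hasDerivAt_line_apply (h.differentiableAt_fderiv_u hp) X.1 y
  have hg := fun y z => h.metric.hasDerivAt_line hp X.1 y z
  have hθ := fun Y => h.fderiv_ghForm hp X Y
  have hω := fun y z => hasDerivAt_comp_line (h.differentiableAt_extDeriv₁ hp y z) X.1
  have hN : ∀ y z, fderiv ℝ (fun e' => extDeriv₁ A e' y z) p.1 X.1 = nablaExtDeriv G A p.1 X.1 y z
      + extDeriv₁ A p.1 (christoffel G p.1 X.1 y) z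
      + extDeriv₁ A p.1 y (christoffel G p.1 X.1 z) := fun y z => by
    simp only [nablaExtDeriv]; ring
  have hH : ∀ y, fderiv ℝ (fderiv ℝ u) p.1 X.1 y = nabla G (fderiv ℝ u) p.1 X.1 y
      + fderiv ℝ u p.1 (christoffel G p.1 X.1 y) := fun y => by
    simp only [nabla]; ring
  have key := ((hu.const_mul (1 / 2)).mul ((((hdu Y.1).mul (hg Z.1 w)).add
      ((hdu Z.1).mul (hg Y.1 w))).sub ((hg Y.1 Z.1).mul (hdu w)))).add
    (((hu.pow 3).const_mul (1 / 2)).mul (((hθ Y).mul (hθ Z)).mul (hdu w))) |>.add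
    (((hu.pow 2).const_mul (1 / 2)).mul (((hθ Z).mul (hω Y.1 w)).add ((hθ Y).mul (hω Z.1 w))))
  refine key.congr_deriv ?_
  simp only [hN, hH, h.metric.fderiv_apply hp, fderiv_eq_symDeriv_add, Pi.mul_apply, Pi.inv_apply,
    Pi.add_apply, Pi.sub_apply, Pi.pow_apply, zero_smul, add_zero, ghSlot, ghSlotDeriv,
    Nat.add_one_sub_one, Nat.cast_ofNat, pow_one]
  field_simp
  ring

end Coord

/-! ### Curvature of the Gibbons–Hawking metric. -/

namespace Coord

variable {E : Type*} [NormedAddCommGroup E] [NormedSpace ℝ E]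
  {G : E → E →L[ℝ] E →L[ℝ] ℝ} {u : E → ℝ} {A : E → E →L[ℝ] ℝ} {O : Set E} {p : E × ℝ}

/-- Horizontal part of the difference of the connections of `gh G u A` and `G`. -/
noncomputable def ghDiff (G : E → E →L[ℝ] E →L[ℝ] ℝ) (u : E → ℝ) (A : E → E →L[ℝ] ℝ) (p Y Z : E × ℝ) :
    E :=
  (christoffel (gh G u A) p Y Z).1 - christoffel G p.1 Y.1 Z.1

/-- Vertical part of the difference of the connections of `gh G u A` and `G`. -/
noncomputable def ghDiffForm (u : E → ℝ) (A : E → E →L[ℝ] ℝ) (p Y Z : E × ℝ) : ℝ :=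
  -(1 / 2 * (u p.1)⁻¹ * (fderiv ℝ u p.1 Y.1 * ghForm A p Z + fderiv ℝ u p.1 Z.1 * ghForm A p Y))

theorem extDeriv₁_add_left (A : E → E →L[ℝ] ℝ) (e x y z : E) :
    extDeriv₁ A e (x + y) z = extDeriv₁ A e x z + extDeriv₁ A e y z := by
  simp only [extDeriv₁, map_add, add_apply]; ring

theorem extDeriv₁_comm (A : E → E →L[ℝ] ℝ) (e x y : E) :
    extDeriv₁ A e x y = -extDeriv₁ A e y x := by
  simp only [extDeriv₁]; ring

theorem extDeriv₁_add_right (A : E → E →L[ℝ] ℝ) (e x y z : E) :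
    extDeriv₁ A e x (y + z) = extDeriv₁ A e x y + extDeriv₁ A e x z := by
  simp only [extDeriv₁, map_add, add_apply]; ring

theorem ghSlot_add_right (G : E → E →L[ℝ] E →L[ℝ] ℝ) (u : E → ℝ) (A : E → E →L[ℝ] ℝ) (e : E)
    (y : E) (η : ℝ) (z z' : E) (ζ ζ' : ℝ) (w : E) :
    ghSlot G u A e y η (z + z') (ζ + ζ') w =
      ghSlot G u A e y η z ζ w + ghSlot G u A e y η z' ζ' w := by
  simp only [ghSlot, map_add, add_apply, extDeriv₁_add_left]; ring

theorem christoffel_fst_eq (p Y Z : E × ℝ) :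
    (christoffel (gh G u A) p Y Z).1 = christoffel G p.1 Y.1 Z.1 + ghDiff G u A p Y Z := by
  simp [ghDiff]

variable [FiniteDimensional ℝ E]

theorem GHData.apply_ghDiff (h : GHData G u A O) (hp : p.1 ∈ O) (Y Z : E × ℝ) (w : E) :
    G p.1 (ghDiff G u A p Y Z) w =
      ghSlot G u A p.1 Y.1 (ghForm A p Y) Z.1 (ghForm A p Z) w := by
  simp only [ghDiff, map_sub, sub_apply, h.apply_christoffel_fst hp]; ring

theorem GHData.ghForm_christoffel' (h : GHData G u A O) (hp : p.1 ∈ O) (Y Z : E × ℝ) :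
    ghForm A p (christoffel (gh G u A) p Y Z) =
      symDeriv A p.1 Y.1 Z.1 + ghDiffForm u A p Y Z := by
  rw [h.ghForm_christoffel hp, symDeriv, ghDiffForm]; ring

-- Obtained by differentiating `GHData.apply_christoffel_fst` along a line; `G` varies along it too,
-- whence the term with `ghDiff`.
set_option synthInstance.maxHeartbeats 200000 in
theorem GHData.apply_fderiv_christoffel_fst (h : GHData G u A O) (hp : p.1 ∈ O) (X Y Z : E × ℝ)
    (w : E) :
    G p.1 (fderiv ℝ (christoffel (gh G u A)) p X Y Z).1 w =
      G p.1 (fderiv ℝ (christoffel G) p.1 X.1 Y.1 Z.1) w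
      - fderiv ℝ G p.1 X.1 (ghDiff G u A p Y Z) w
      + (ghSlotDeriv G u A p.1 X.1 Y.1 (ghForm A p Y) Z.1 (ghForm A p Z) w
        + ghSlot G u A p.1 (christoffel G p.1 X.1 Y.1) (symDeriv A p.1 X.1 Y.1) Z.1 (ghForm A p Z) w
        + ghSlot G u A p.1 Y.1 (ghForm A p Y) (christoffel G p.1 X.1 Z.1) (symDeriv A p.1 X.1 Z.1) w
        + ghSlot G u A p.1 Y.1 (ghForm A p Y) Z.1 (ghForm A p Z) (christoffel G p.1 X.1 w)) := by
  have hp' : p ∈ O ×ˢ (univ : Set ℝ) := ⟨hp, trivial⟩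
  have hG : HasDerivAt (fun s : ℝ => G (p.1 + s • X.1)) (fderiv ℝ G p.1 X.1) 0 :=
    hasDerivAt_comp_line (f := G) (e := p.1) (h.metric.differentiableAt hp) X.1
  have h1 := (hasDerivAt_line_apply₂ ((h.metricOn.contDiffAt_christoffel hp').differentiableAt
    (by simp)) X Y Z)
  have h1' := h1.hasFDerivAt.fst.hasDerivAt
  have h2 := hasDerivAt_line_apply₂ ((h.metric.contDiffAt_christoffel hp).differentiableAt
    (by simp)) X.1 Y.1 Z.1
  have hl := (hG.clm_apply h1').clm_apply (hasDerivAt_const (0 : ℝ) w)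
  have hr := ((hG.clm_apply h2).clm_apply (hasDerivAt_const (0 : ℝ) w)).add
    (h.hasDerivAt_ghSlot hp X Y Z w)
  have heq := hl.unique (hr.congr_of_eventuallyEq ?_)
  · simp only [zero_smul, add_zero, map_zero, add_apply, ContinuousLinearMap.comp_apply] at heq
    simp only [ghDiff, map_sub, sub_apply]
    simp at heq
    linarith
  · filter_upwards [eventually_line_mem h.metricOn.isOpen hp' X] with s hs
    exact h.apply_christoffel_fst hs.1 Y Z w

end Coord

namespace Coord

variable {E : Type*} [NormedAddCommGroup E] [NormedSpace ℝ E]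
  {G : E → E →L[ℝ] E →L[ℝ] ℝ} {u : E → ℝ} {A : E → E →L[ℝ] ℝ} {O : Set E} {p : E × ℝ}
  [FiniteDimensional ℝ E]

theorem GHData.apply_christoffel_christoffel_fst (h : GHData G u A O) (hp : p.1 ∈ O)
    (X Y Z : E × ℝ) (w : E) :
    G p.1 (christoffel (gh G u A) p X (christoffel (gh G u A) p Y Z)).1 w =
      G p.1 (christoffel G p.1 X.1 (christoffel G p.1 Y.1 Z.1)) w
      + G p.1 (christoffel G p.1 X.1 (ghDiff G u A p Y Z)) w
      + ghSlot G u A p.1 X.1 (ghForm A p X) (christoffel G p.1 Y.1 Z.1) (symDeriv A p.1 Y.1 Z.1) w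
      + ghSlot G u A p.1 X.1 (ghForm A p X) (ghDiff G u A p Y Z) (ghDiffForm u A p Y Z) w := by
  rw [h.apply_christoffel_fst hp, h.ghForm_christoffel' hp, christoffel_fst_eq, ghSlot_add_right,
    map_add, map_add, add_apply]
  ring

/-- The usual rule for connections differing by a tensor `D`: the curvature changes by the
antisymmetrized covariant derivative of `D` plus the commutator of `D` with itself. The Christoffel
symbols of `G` and `symDeriv` cancel, by symmetry and `∇G = 0`. -/
theorem GHData.apply_curvature_fst (h : GHData G u A O) (hp : p.1 ∈ O) (X Y Z : E × ℝ) (w : E) :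
    G p.1 (curvature (gh G u A) p Y Z X).1 w = G p.1 (curvature G p.1 Y.1 Z.1 X.1) w
      + ghSlotDeriv G u A p.1 X.1 Y.1 (ghForm A p Y) Z.1 (ghForm A p Z) w
      - ghSlotDeriv G u A p.1 Y.1 X.1 (ghForm A p X) Z.1 (ghForm A p Z) w
      + ghSlot G u A p.1 X.1 (ghForm A p X) (ghDiff G u A p Y Z) (ghDiffForm u A p Y Z) w
      - ghSlot G u A p.1 Y.1 (ghForm A p Y) (ghDiff G u A p X Z) (ghDiffForm u A p X Z) w := by
  rw [curvature_apply, curvature_apply, Prod.fst_sub, Prod.fst_add, Prod.fst_sub]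
  simp only [map_sub, map_add, sub_apply, add_apply, h.apply_fderiv_christoffel_fst hp,
    h.apply_christoffel_christoffel_fst hp, h.metric.fderiv_apply hp, h.apply_ghDiff hp]
  rw [h.metric.christoffel_symm hp Y.1 X.1, symDeriv_comm A p.1 Y.1 X.1]
  ring

theorem GHData.ghForm_fderiv_christoffel (h : GHData G u A O) (hp : p.1 ∈ O) (X Y Z : E × ℝ) :
    HasDerivAt (fun s : ℝ => ghForm A (p + s • X) (christoffel (gh G u A) (p + s • X) Y Z))
      (ghForm A p (fderiv ℝ (christoffel (gh G u A)) p X Y Z)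
        + fderiv ℝ A p.1 X.1 (christoffel (gh G u A) p Y Z).1) 0 := by
  have hp' : p ∈ O ×ˢ (univ : Set ℝ) := ⟨hp, trivial⟩
  have h1 := (hasDerivAt_line_apply₂ ((h.metricOn.contDiffAt_christoffel hp').differentiableAt
    (by simp)) X Y Z)
  have h1' := h1.hasFDerivAt.fst.hasDerivAt
  have h2 := h1.hasFDerivAt.snd.hasDerivAt
  have h3 := (hasDerivAt_comp_line (f := A) (e := p.1) (h.differentiableAt_A hp) X.1)
  refine (h2.add (h3.clm_apply h1')).congr_deriv ?_
  simp [ghForm_apply]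
  ring

/-- The only vertical component of the curvature that the Ricci trace requires. Since nothing
depends on `t`, the derivative along `∂/∂t` contributes nothing. -/
theorem GHData.ghForm_curvature_vertical (h : GHData G u A O) (hp : p.1 ∈ O) (Y Z : E × ℝ) :
    ghForm A p (curvature (gh G u A) p Y Z (0, 1)) =
      1 / 2 * (u p.1)⁻¹ * nabla G (fderiv ℝ u) p.1 Y.1 Z.1
      - 3 / 4 * (u p.1)⁻¹ ^ 2 * fderiv ℝ u p.1 Y.1 * fderiv ℝ u p.1 Z.1
      + 1 / 2 * extDeriv₁ A p.1 Y.1 (ghDiff G u A p (0, 1) Z)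
      - 1 / 2 * (u p.1)⁻¹ * fderiv ℝ u p.1 (ghDiff G u A p Y Z)
      + 1 / 2 * (u p.1)⁻¹ * fderiv ℝ u p.1 (ghDiff G u A p (0, 1) Z) * ghForm A p Y := by
  have hp' : p ∈ O ×ˢ (univ : Set ℝ) := ⟨hp, trivial⟩
  have hθ : ∀ q, ghForm A q ((0 : E), (1 : ℝ)) = 1 := fun q => by simp [ghForm_apply]
  have hfst : ∀ W : E × ℝ, (christoffel (gh G u A) p (0, 1) W).1 = ghDiff G u A p (0, 1) W := by
    intro W
    simp [ghDiff]
  -- derivative in the vertical direction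
  have hV : ghForm A p (fderiv ℝ (christoffel (gh G u A)) p (0, 1) Y Z) = 0 := by
    have h1 := h.ghForm_fderiv_christoffel hp (0, 1) Y Z
    have hz : ∀ W : E × ℝ, HasDerivAt (fun s : ℝ => ghForm A (p + s • ((0 : E), (1 : ℝ))) W) 0 0 := by
      intro W
      simpa using h.fderiv_ghForm hp (0, 1) W
    have h2 : HasDerivAt (fun s : ℝ => ghForm A (p + s • ((0 : E), (1 : ℝ)))
        (christoffel (gh G u A) (p + s • ((0 : E), (1 : ℝ))) Y Z)) 0 0 := by
      have h3 := ((hasDerivAt_const (0 : ℝ) (1 / 2 * (fderiv ℝ A p.1 Y.1 Z.1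
        + fderiv ℝ A p.1 Z.1 Y.1)))).sub ((((hz Z).const_mul (fderiv ℝ u p.1 Y.1)).add
          ((hz Y).const_mul (fderiv ℝ u p.1 Z.1))).const_mul (1 / 2 * (u p.1)⁻¹))
      refine (h3.congr_deriv (by simp)).congr_of_eventuallyEq ?_
      filter_upwards [eventually_line_mem h.metricOn.isOpen hp' (0, 1)] with s hs
      rw [h.ghForm_christoffel hs.1]
      simp
    simpa using h1.unique h2
  -- derivative of the vertical part of the connection
  have hY : ghForm A p (fderiv ℝ (christoffel (gh G u A)) p Y (0, 1) Z)
      + fderiv ℝ A p.1 Y.1 (ghDiff G u A p (0, 1) Z) =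
      1 / 2 * (u p.1)⁻¹ ^ 2 * fderiv ℝ u p.1 Y.1 * fderiv ℝ u p.1 Z.1
      - 1 / 2 * (u p.1)⁻¹ * fderiv ℝ (fderiv ℝ u) p.1 Y.1 Z.1 := by
    have h1 := h.ghForm_fderiv_christoffel hp Y (0, 1) Z
    rw [hfst] at h1
    have hne := (h.pos_u _ hp).ne'
    have hu := (hasDerivAt_comp_line (h.differentiableAt_u hp) Y.1).inv (by simpa using hne)
    have hdu := hasDerivAt_line_apply (h.differentiableAt_fderiv_u hp) Y.1 Z.1
    have h3 := (hu.mul hdu).const_mul (-(1 / 2))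
    refine h1.unique ((h3.congr_deriv ?_).congr_of_eventuallyEq ?_)
    · simp only [zero_smul, add_zero, Pi.inv_apply]
      ring
    · filter_upwards [eventually_line_mem h.metricOn.isOpen hp' Y] with s hs
      rw [h.ghForm_christoffel hs.1, hθ]
      simp
      ring
  have hH : fderiv ℝ (fderiv ℝ u) p.1 Y.1 Z.1 = nabla G (fderiv ℝ u) p.1 Y.1 Z.1
      + fderiv ℝ u p.1 (christoffel G p.1 Y.1 Z.1) := by
    simp only [nabla]; ring
  rw [curvature_apply, map_sub, map_add, map_sub, hV,
    h.ghForm_christoffel hp (0, 1) (christoffel (gh G u A) p Y Z),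
    h.ghForm_christoffel hp Y (christoffel (gh G u A) p (0, 1) Z), hfst, christoffel_fst_eq,
    h.ghForm_christoffel hp (0, 1) Z, hθ]
  rw [hH] at hY
  simp only [map_zero, zero_apply, map_add, extDeriv₁]
  linear_combination -hY

/-- The trace in the frame formed by `∂/∂t` and the horizontal lifts of an orthonormal basis, in
which `θ` reads off the vertical coefficient. Compared with the product basis, the extra terms in `A
(b i)` add up to `A` of the horizontal part of `L (0, 1)` and cancel against `θ`. -/
theorem trace_gh (b : Module.Basis (Fin 3) ℝ E) (g : E →L[ℝ] E →L[ℝ] ℝ)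
    (hb : ∀ i j, g (b i) (b j) = if i = j then 1 else 0) (A : E → E →L[ℝ] ℝ) (p : E × ℝ)
    (L : E × ℝ →L[ℝ] E × ℝ) :
    LinearMap.trace ℝ (E × ℝ) (L : E × ℝ →ₗ[ℝ] E × ℝ) =
      ∑ i, g (L (b i, -A p.1 (b i))).1 (b i) + ghForm A p (L (0, 1)) := by
  have hrepr : ∀ x i, b.repr x i = g x (b i) := by
    intro x i
    conv_rhs => rw [← b.sum_repr x, map_sum, sum_apply]
    simp only [map_smul, smul_apply, hb, smul_eq_mul, mul_ite, mul_one, mul_zero,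
      Finset.sum_ite_eq', Finset.mem_univ, if_true]
  have hsplit : ∀ i, L (b i, -A p.1 (b i)) = L (b i, 0) - A p.1 (b i) • L (0, 1) := by
    intro i
    rw [← map_smul, ← map_sub]
    simp
  have hA : A p.1 (L (0, 1)).1 = ∑ i, g (L (0, 1)).1 (b i) * A p.1 (b i) := by
    conv_lhs => rw [← b.sum_repr (L (0, 1)).1]
    simp [hrepr]
  rw [trace_eq_sum (b.prod (Module.Basis.singleton Unit ℝ)) L, Fintype.sum_sum_type]
  simp only [hsplit, ghForm_apply, hA]
  simp [hrepr, Finset.sum_sub_distrib, mul_comm]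

end Coord

/-! ### Ricci tensor of the Gibbons–Hawking metric. -/

namespace Coord

variable {E : Type*} [NormedAddCommGroup E] [NormedSpace ℝ E]
  {G : E → E →L[ℝ] E →L[ℝ] ℝ} {u : E → ℝ} {A : E → E →L[ℝ] ℝ} {O : Set E} {p : E × ℝ}

theorem extDeriv₁_smul_left (A : E → E →L[ℝ] ℝ) (e x y : E) (c : ℝ) :
    extDeriv₁ A e (c • x) y = c * extDeriv₁ A e x y := by
  simp only [extDeriv₁, map_smul, smul_apply, smul_eq_mul]; ring

theorem extDeriv₁_smul_right (A : E → E →L[ℝ] ℝ) (e x y : E) (c : ℝ) :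
    extDeriv₁ A e x (c • y) = c * extDeriv₁ A e x y := by
  simp only [extDeriv₁, map_smul, smul_apply, smul_eq_mul]; ring

theorem extDeriv₁_self (A : E → E →L[ℝ] ℝ) (e x : E) : extDeriv₁ A e x x = 0 := by
  simp only [extDeriv₁, sub_self]

theorem nablaExtDeriv_self (G : E → E →L[ℝ] E →L[ℝ] ℝ) (A : E → E →L[ℝ] ℝ) (e x y : E) :
    nablaExtDeriv G A e x y y = 0 := by
  have : (fun e' => extDeriv₁ A e' y y) = fun _ => 0 := by
    funext e'; exact extDeriv₁_self A e' y
  rw [nablaExtDeriv, this, extDeriv₁_comm A e y]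
  simp

/-- Coordinates with respect to an orthonormal basis. -/
theorem eq_sum_of_orthonormal {g : E →L[ℝ] E →L[ℝ] ℝ} (b : Module.Basis (Fin 3) ℝ E)
    (hb : ∀ i j, g (b i) (b j) = if i = j then 1 else 0) (x : E) :
    x = g x (b 0) • b 0 + g x (b 1) • b 1 + g x (b 2) • b 2 := by
  have hrepr : ∀ i, b.repr x i = g x (b i) := by
    intro i
    conv_rhs => rw [← b.sum_repr x, map_sum, sum_apply]
    simp only [map_smul, smul_apply, hb, smul_eq_mul, mul_ite, mul_one, mul_zero,
      Finset.sum_ite_eq', Finset.mem_univ, if_true]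
  conv_lhs => rw [← b.sum_repr x]
  simp only [Fin.sum_univ_three, hrepr]

/-- `b` is a `G`-orthonormal basis at `e` in which `dA = *du`. -/
structure IsMonopoleFrame (G : E → E →L[ℝ] E →L[ℝ] ℝ) (u : E → ℝ) (A : E → E →L[ℝ] ℝ) (e : E)
    (b : Module.Basis (Fin 3) ℝ E) : Prop where
  orthonormal : ∀ i j, G e (b i) (b j) = if i = j then 1 else 0
  ext01 : extDeriv₁ A e (b 0) (b 1) = fderiv ℝ u e (b 2)
  ext12 : extDeriv₁ A e (b 1) (b 2) = fderiv ℝ u e (b 0)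
  ext20 : extDeriv₁ A e (b 2) (b 0) = fderiv ℝ u e (b 1)

/-- In the frame `dA(y, z)` is the triple product of `y`, `z` and `grad u`. This turns every
occurrence of `dA` into components of `du`. -/
theorem IsMonopoleFrame.extDeriv₁_eq {e : E} {b : Module.Basis (Fin 3) ℝ E}
    (hb : IsMonopoleFrame G u A e b) (y z : E) :
    extDeriv₁ A e y z =
      (G e y (b 0) * G e z (b 1) - G e y (b 1) * G e z (b 0)) * fderiv ℝ u e (b 2)
      + (G e y (b 1) * G e z (b 2) - G e y (b 2) * G e z (b 1)) * fderiv ℝ u e (b 0)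
      + (G e y (b 2) * G e z (b 0) - G e y (b 0) * G e z (b 2)) * fderiv ℝ u e (b 1) := by
  conv_lhs => rw [eq_sum_of_orthonormal b hb.orthonormal y, eq_sum_of_orthonormal b hb.orthonormal z]
  simp only [extDeriv₁_add_left, extDeriv₁_add_right, extDeriv₁_smul_left, extDeriv₁_smul_right,
    extDeriv₁_self]
  rw [extDeriv₁_comm A e (b 1) (b 0), extDeriv₁_comm A e (b 2) (b 1), extDeriv₁_comm A e (b 0) (b 2),
    hb.ext01, hb.ext12, hb.ext20]
  ring

variable [FiniteDimensional ℝ E]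

set_option maxHeartbeats 1000000 in
/-- The Ricci tensor of a Gibbons--Hawking metric is the pull-back of that of the base. -/
theorem GHData.ricci_gh (h : GHData G u A O) (hp : p.1 ∈ O) (b : Module.Basis (Fin 3) ℝ E)
    (hb : IsMonopoleFrame G u A p.1 b)
    (hlap : ∑ i, nabla G (fderiv ℝ u) p.1 (b i) (b i) = 0)
    (hdiv : ∀ y, ∑ i, nablaExtDeriv G A p.1 (b i) y (b i) = 0) (Y Z : E × ℝ) :
    ricci (gh G u A) p Y Z = ricci G p.1 Y.1 Z.1 := by
  have hsymm := h.metric.symm p.1 hp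
  have hrepr : ∀ x i, b.repr x i = G p.1 x (b i) := by
    intro x i
    conv_rhs => rw [← b.sum_repr x, map_sum, sum_apply]
    simp only [map_smul, smul_apply, hb.orthonormal, smul_eq_mul, mul_ite, mul_one, mul_zero,
      Finset.sum_ite_eq', Finset.mem_univ, if_true]
  have hθ0 : ∀ i, ghForm A p (b i, -A p.1 (b i)) = 0 := fun i => by simp [ghForm_apply]
  have hθ1 : ghForm A p ((0 : E), (1 : ℝ)) = 1 := by simp [ghForm_apply]
  have hH : ∀ y z, nabla G (fderiv ℝ u) p.1 y z = nabla G (fderiv ℝ u) p.1 z y := by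
    intro y z
    have h2 : IsSymmSndFDerivAt ℝ u p.1 :=
      (h.smooth_u.contDiffAt (h.metric.isOpen.mem_nhds hp)).isSymmSndFDerivAt
        (by simpa using! WithTop.coe_le_coe.2 (le_top (a := (2 : ℕ∞))))
    simp only [nabla, h.metric.christoffel_symm hp y z, h2.eq y z]
  rw [ricci, ricci, trace_gh b (G p.1) hb.orthonormal A p, trace_eq_sum b]
  simp only [hrepr, h.apply_curvature_fst hp, h.ghForm_curvature_vertical hp, hθ0]
  have hcb : ∀ w, G p.1 (ghDiff G u A p Y Z) w = _ := h.apply_ghDiff hp Y Z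
  have hc0b : ∀ w, G p.1 (ghDiff G u A p (0, 1) Z) w = _ := h.apply_ghDiff hp (0, 1) Z
  have hd0 : ∀ w, G p.1 (ghDiff G u A p (b 0, -A p.1 (b 0)) Z) w = _ :=
    h.apply_ghDiff hp (b 0, -A p.1 (b 0)) Z
  have hd1 : ∀ w, G p.1 (ghDiff G u A p (b 1, -A p.1 (b 1)) Z) w = _ :=
    h.apply_ghDiff hp (b 1, -A p.1 (b 1)) Z
  have hd2 : ∀ w, G p.1 (ghDiff G u A p (b 2, -A p.1 (b 2)) Z) w = _ :=
    h.apply_ghDiff hp (b 2, -A p.1 (b 2)) Z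
  have hdu : ∀ x, fderiv ℝ u p.1 x = G p.1 x (b 0) * fderiv ℝ u p.1 (b 0)
      + G p.1 x (b 1) * fderiv ℝ u p.1 (b 1) + G p.1 x (b 2) * fderiv ℝ u p.1 (b 2) := by
    intro x
    conv_lhs => rw [eq_sum_of_orthonormal b hb.orthonormal x]
    simp only [map_add, map_smul, smul_eq_mul]
  have hG2 : ∀ x w, G p.1 x w = G p.1 x (b 0) * G p.1 w (b 0) + G p.1 x (b 1) * G p.1 w (b 1)
      + G p.1 x (b 2) * G p.1 w (b 2) := by
    intro x w
    conv_lhs => rw [eq_sum_of_orthonormal b hb.orthonormal w]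
    simp only [map_add, map_smul, smul_eq_mul]
    ring
  have hHb : ∀ y z, G p.1 z (b 0) * nabla G (fderiv ℝ u) p.1 y (b 0)
      + G p.1 z (b 1) * nabla G (fderiv ℝ u) p.1 y (b 1)
      + G p.1 z (b 2) * nabla G (fderiv ℝ u) p.1 y (b 2) = nabla G (fderiv ℝ u) p.1 y z := by
    intro y z
    conv_rhs => rw [eq_sum_of_orthonormal b hb.orthonormal z]
    simp only [nabla, map_add, map_smul, smul_eq_mul]
    ring
  have hω := hb.extDeriv₁_eq
  have r1 := hHb Y.1 Z.1
  have r2 := hHb Z.1 Y.1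
  rw [hH Z.1 Y.1] at r2
  have n1 := hdiv Y.1
  have n2 := hdiv Z.1
  have hYZ := hG2 Y.1 Z.1
  have hYd0 := hG2 Y.1 (ghDiff G u A p (b 0, -A p.1 (b 0)) Z)
  have hYd1 := hG2 Y.1 (ghDiff G u A p (b 1, -A p.1 (b 1)) Z)
  have hYd2 := hG2 Y.1 (ghDiff G u A p (b 2, -A p.1 (b 2)) Z)
  have g00 := hb.orthonormal 0 0
  have g01 := hb.orthonormal 0 1
  have g02 := hb.orthonormal 0 2
  have g10 := hb.orthonormal 1 0
  have g11 := hb.orthonormal 1 1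
  have g12 := hb.orthonormal 1 2
  have g20 := hb.orthonormal 2 0
  have g21 := hb.orthonormal 2 1
  have g22 := hb.orthonormal 2 2
  have hbY : ∀ i, G p.1 (b i) Y.1 = G p.1 Y.1 (b i) := fun i => hsymm _ _
  have hbZ : ∀ i, G p.1 (b i) Z.1 = G p.1 Z.1 (b i) := fun i => hsymm _ _
  have hbc : ∀ i, G p.1 (b i) (ghDiff G u A p Y Z) = G p.1 (ghDiff G u A p Y Z) (b i) :=
    fun i => hsymm _ _
  have hHY : ∀ i, nabla G (fderiv ℝ u) p.1 (b i) Y.1 = nabla G (fderiv ℝ u) p.1 Y.1 (b i) :=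
    fun i => hH _ _
  have hHZ : ∀ i, nabla G (fderiv ℝ u) p.1 (b i) Z.1 = nabla G (fderiv ℝ u) p.1 Z.1 (b i) :=
    fun i => hH _ _
  clear hH hHb hG2 hsymm hrepr hdiv hb
  simp only [Fin.sum_univ_three, ghDiffForm, hθ0, hθ1, Fin.isValue,
    Fin.reduceEq, if_true, if_false] at *
  -- From here on the geometry is forgotten: vectors are replaced by variables and their frame
  -- components by real numbers, so that a polynomial identity remains.
  generalize ghDiff G u A p Y Z = c at *
  generalize ghDiff G u A p (0, 1) Z = c0 at *
  generalize ghDiff G u A p (b 0, -A p.1 (b 0)) Z = d0 at *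
  generalize ghDiff G u A p (b 1, -A p.1 (b 1)) Z = d1 at *
  generalize ghDiff G u A p (b 2, -A p.1 (b 2)) Z = d2 at *
  generalize ghForm A p Y = η at *
  generalize ghForm A p Z = ζ at *
  generalize fderiv ℝ u p.1 (b 0) = m0 at *
  generalize fderiv ℝ u p.1 (b 1) = m1 at *
  generalize fderiv ℝ u p.1 (b 2) = m2 at *
  simp only [ghSlot, ghSlotDeriv, hω, hdu, g00, g01, g02, g10, g11, g12, g20, g21, g22, hbZ,
    hHY, hHZ, hbc, hYd0, hYd1, hYd2, hYZ, nablaExtDeriv_self, mul_zero,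
    zero_mul, one_mul, mul_one, add_zero, zero_add, sub_zero, zero_sub, sub_self]
  simp only [hcb, hc0b, hd0, hd1, hd2]
  simp only [ghSlot, hω, hdu, g00, g01, g02, g10, g11, g12, g20, g21, g22, hbZ, hYZ, map_zero,
    zero_apply, mul_zero, zero_mul, one_mul, mul_one, add_zero, zero_add, sub_zero, zero_sub,
    sub_self]
  clear hcb hc0b hd0 hd1 hd2 hω hdu hYd0 hYd1 hYd2 hYZ hbY hbZ hHY hHZ hbc
  generalize (u p.1)⁻¹ = k at *
  generalize G p.1 Y.1 (b 0) = y0 at *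
  generalize G p.1 Y.1 (b 1) = y1 at *
  generalize G p.1 Y.1 (b 2) = y2 at *
  generalize G p.1 Z.1 (b 0) = z0 at *
  generalize G p.1 Z.1 (b 1) = z1 at *
  generalize G p.1 Z.1 (b 2) = z2 at *
  -- All terms quadratic in `du` and `dA` have cancelled. The difference of the Ricci tensors
  -- consists of Hessian terms that recombine (`r1`, `r2`), the Laplacian of `u` in the vertical and
  -- horizontal parts, and the divergence of `dA` in the mixed part.
  linear_combination 1 / 2 * k * r1 + 1 / 2 * k * r2 + (1 / 2 * k ^ 3 * η * ζ
    - 1 / 2 * k * (y0 * z0 + y1 * z1 + y2 * z2)) * hlap + 1 / 2 * k ^ 2 * ζ * n1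
    + 1 / 2 * k ^ 2 * η * n2

end Coord

/-! ### Lie derivative of the Gibbons–Hawking metric. -/

namespace Coord

variable {E : Type*} [NormedAddCommGroup E] [NormedSpace ℝ E]
  {G : E → E →L[ℝ] E →L[ℝ] ℝ} {u : E → ℝ} {A : E → E →L[ℝ] ℝ} {O : Set E} {p : E × ℝ}

/-- The vector field `f ∂/∂t + t (F - A(F) ∂/∂t)` on `E × ℝ`. -/
def ghField (A : E → E →L[ℝ] ℝ) (f : E × ℝ → ℝ) (F : E → E) (p : E × ℝ) : E × ℝ :=
  (p.2 • F p.1, f p - p.2 * A p.1 (F p.1))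

theorem fderiv_ghField {f : E × ℝ → ℝ} {F : E → E} (hA : DifferentiableAt ℝ A p.1)
    (hf : DifferentiableAt ℝ f p) (hF : DifferentiableAt ℝ F p.1) (X : E × ℝ) :
    fderiv ℝ (ghField A f F) p X = (X.2 • F p.1 + p.2 • fderiv ℝ F p.1 X.1,
      fderiv ℝ f p X - X.2 * A p.1 (F p.1)
        - p.2 * (fderiv ℝ A p.1 X.1 (F p.1) + A p.1 (fderiv ℝ F p.1 X.1))) := by
  have hF' := hF.hasFDerivAt.comp p hasFDerivAt_fst
  have hA' := hA.hasFDerivAt.comp p hasFDerivAt_fst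
  have h1 := (hasFDerivAt_snd (𝕜 := ℝ) (p := p)).smul hF'
  have h2 := hf.hasFDerivAt.sub ((hasFDerivAt_snd (𝕜 := ℝ) (p := p)).mul (hA'.clm_apply hF'))
  have h3 := h1.prodMk h2
  have h4 : fderiv ℝ (ghField A f F) p = _ := h3.fderiv
  rw [h4]
  ext
  · simp [add_comm]
  · simp
    ring

-- The vertical coefficient `f - t A(F)` of the field is chosen so that `θ` of it is `f`. On
-- differentiating, the terms with the derivative of `A` combine into `i_F dA`, and only `df`, the
-- term `dt ⊗ F♭` with its transpose, and `t` times basic quantities survive.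
set_option synthInstance.maxHeartbeats 200000 in
theorem GHData.lieDeriv_gh [FiniteDimensional ℝ E] (h : GHData G u A O) (hp : p.1 ∈ O)
    {f : E × ℝ → ℝ} {F : E → E}
    (hf : DifferentiableAt ℝ f p) (hF : DifferentiableAt ℝ F p.1) (X Y : E × ℝ) :
    lieDeriv (ghField A f F) (gh G u A) p X Y =
      (u p.1)⁻¹ * (fderiv ℝ f p X * ghForm A p Y + fderiv ℝ f p Y * ghForm A p X)
      + u p.1 * (X.2 * G p.1 (F p.1) Y.1 + Y.2 * G p.1 (F p.1) X.1)
      + p.2 * (fderiv ℝ u p.1 (F p.1) * G p.1 X.1 Y.1 + u p.1 * lieDeriv F G p.1 X.1 Y.1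
        - (u p.1)⁻¹ ^ 2 * fderiv ℝ u p.1 (F p.1) * (ghForm A p X * ghForm A p Y)
        + (u p.1)⁻¹ * (ghForm A p X * extDeriv₁ A p.1 (F p.1) Y.1
          + ghForm A p Y * extDeriv₁ A p.1 (F p.1) X.1)) := by
  have hθ : ∀ X, ghForm A p (fderiv ℝ (ghField A f F) p X) =
      fderiv ℝ f p X - p.2 * fderiv ℝ A p.1 X.1 (F p.1) := by
    intro X
    rw [fderiv_ghField (h.differentiableAt_A hp) hf hF, ghForm_apply]
    simp
    ring
  have hfst : ∀ X, (fderiv ℝ (ghField A f F) p X).1 = X.2 • F p.1 + p.2 • fderiv ℝ F p.1 X.1 := by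
    intro X
    rw [fderiv_ghField (h.differentiableAt_A hp) hf hF]
  have hV : (ghField A f F p).1 = p.2 • F p.1 := rfl
  rw [lieDeriv, gh_apply, gh_apply, h.fderiv_gh hp, hθ, hθ, hfst, hfst, hV,
    h.metric.symm _ hp (F p.1) X.1]
  simp only [lieDeriv, extDeriv₁, map_smul, map_add, smul_apply, add_apply, smul_eq_mul]
  ring

end Coord

/-! ### The monopole equation near a point, differentiated. -/

namespace Coord

variable {E : Type*} [NormedAddCommGroup E] [NormedSpace ℝ E]
  {G : E → E →L[ℝ] E →L[ℝ] ℝ} {u : E → ℝ} {A : E → E →L[ℝ] ℝ} {O : Set E} {e : E}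
  {b : Module.Basis (Fin 3) ℝ E} {ν : E → ℝ}

/-- The equation `dA = *du` near `e`, written with the volume `ν` of a basis which is orthonormal
at `e`. -/
structure MonopoleGerm (G : E → E →L[ℝ] E →L[ℝ] ℝ) (u : E → ℝ) (A : E → E →L[ℝ] ℝ) (e : E)
    (b : Module.Basis (Fin 3) ℝ E) (ν : E → ℝ) : Prop where
  orthonormal : ∀ i j, G e (b i) (b j) = if i = j then 1 else 0
  one : ν e = 1
  differentiable : DifferentiableAt ℝ ν e
  sq : ∀ᶠ e' in 𝓝 e, ν e' ^ 2 = (Matrix.of fun i j => G e' (b i) (b j)).det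
  ext : ∀ᶠ e' in 𝓝 e, ∀ y z, extDeriv₁ A e' y z * ν e' =
    (Matrix.of ![fun j => fderiv ℝ u e' (b j), fun j => G e' y (b j), fun j => G e' z (b j)]).det

theorem MonopoleGerm.frame (h : MonopoleGerm G u A e b ν) : IsMonopoleFrame G u A e b := by
  have hM := h.ext.self_of_nhds
  refine ⟨h.orthonormal, ?_, ?_, ?_⟩
  · have := hM (b 0) (b 1)
    simpa [h.one, Matrix.det_fin_three, h.orthonormal] using this
  · have := hM (b 1) (b 2)
    simpa [h.one, Matrix.det_fin_three, h.orthonormal] using this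
  · have := hM (b 2) (b 0)
    simpa [h.one, Matrix.det_fin_three, h.orthonormal] using this

/-- The basis is constant in coordinates and orthonormal at `e` only, so no moving frame is needed.
The price is two corrections in the derivative of `*du`: half the trace of `∂G` from the volume, and
`∂G` itself from lowering the indices of `y` and `z`. -/
theorem GHData.fderiv_extDeriv₁ (hd : GHData G u A O) (he : e ∈ O)
    (h : MonopoleGerm G u A e b ν) (x : E) (i j k : Fin 3)
    (hijk : (i, j, k) = (0, 1, 2) ∨ (i, j, k) = (1, 2, 0) ∨ (i, j, k) = (2, 0, 1)) :
    fderiv ℝ (fun e' => extDeriv₁ A e' (b j) (b k)) e x = fderiv ℝ (fderiv ℝ u) e x (b i)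
      + 1 / 2 * (fderiv ℝ G e x (b 0) (b 0) + fderiv ℝ G e x (b 1) (b 1)
        + fderiv ℝ G e x (b 2) (b 2)) * fderiv ℝ u e (b i)
      - (fderiv ℝ G e x (b i) (b 0) * fderiv ℝ u e (b 0)
        + fderiv ℝ G e x (b i) (b 1) * fderiv ℝ u e (b 1)
        + fderiv ℝ G e x (b i) (b 2) * fderiv ℝ u e (b 2)) := by
  have hg := fun y z => hd.metric.hasDerivAt_line he x y z
  have hν := hasDerivAt_comp_line h.differentiable x
  have hdu := fun y => hasDerivAt_line_apply (hd.differentiableAt_fderiv_u he) x y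
  have hω := fun y z => hasDerivAt_comp_line (hd.differentiableAt_extDeriv₁ he y z) x
  have hline : Filter.Tendsto (fun s : ℝ => e + s • x) (𝓝 0) (𝓝 e) := by
    have : ContinuousAt (fun s : ℝ => e + s • x) 0 := by fun_prop
    simpa [ContinuousAt] using this
  have hsym : ∀ y z, fderiv ℝ G e x y z = fderiv ℝ G e x z y := hd.metric.fderiv_symm he x
  -- Differentiate `ν² = det G`: at an orthonormal basis the derivative of the determinant is the
  -- trace.
  have hvol : 2 * fderiv ℝ ν e x = fderiv ℝ G e x (b 0) (b 0) + fderiv ℝ G e x (b 1) (b 1)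
        + fderiv ℝ G e x (b 2) (b 2) := by
    have h1 := hν.pow 2
    have h2 := ((((((hg (b 0) (b 0)).mul (hg (b 1) (b 1))).mul (hg (b 2) (b 2))).sub
      (((hg (b 0) (b 0)).mul (hg (b 1) (b 2))).mul (hg (b 2) (b 1)))).sub
      (((hg (b 0) (b 1)).mul (hg (b 1) (b 0))).mul (hg (b 2) (b 2)))).add
      (((hg (b 0) (b 1)).mul (hg (b 1) (b 2))).mul (hg (b 2) (b 0)))).add
      (((hg (b 0) (b 2)).mul (hg (b 1) (b 0))).mul (hg (b 2) (b 1))) |>.sub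
      (((hg (b 0) (b 2)).mul (hg (b 1) (b 1))).mul (hg (b 2) (b 0)))
    have h3 := h1.unique (h2.congr_of_eventuallyEq ?_)
    · simpa [h.one, h.orthonormal] using h3
    · filter_upwards [hline.eventually h.sq] with s hs
      simpa [Matrix.det_fin_three] using hs
  have h1 := (hω (b j) (b k)).mul hν
  have h2 := ((((((hdu (b 0)).mul (hg (b j) (b 1))).mul (hg (b k) (b 2))).sub
    (((hdu (b 0)).mul (hg (b j) (b 2))).mul (hg (b k) (b 1)))).sub
    (((hdu (b 1)).mul (hg (b j) (b 0))).mul (hg (b k) (b 2)))).add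
    (((hdu (b 1)).mul (hg (b j) (b 2))).mul (hg (b k) (b 0)))).add
    (((hdu (b 2)).mul (hg (b j) (b 0))).mul (hg (b k) (b 1))) |>.sub
    (((hdu (b 2)).mul (hg (b j) (b 1))).mul (hg (b k) (b 0)))
  have hM := h1.unique (h2.congr_of_eventuallyEq (by
    filter_upwards [hline.eventually h.ext] with s hs
    simpa [Matrix.det_fin_three] using hs (b j) (b k)))
  have f := h.frame
  have s01 := hsym (b 0) (b 1)
  have s02 := hsym (b 0) (b 2)
  have s12 := hsym (b 1) (b 2)
  rcases hijk with hijk | hijk | hijk <;> obtain ⟨rfl, rfl, rfl⟩ := by simpa using hijk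
  · simp [h.one, h.orthonormal, f.ext12] at hM
    linear_combination hM - fderiv ℝ u e (b 0) / 2 * hvol + fderiv ℝ u e (b 1) * s01
      + fderiv ℝ u e (b 2) * s02
  · simp [h.one, h.orthonormal, f.ext20] at hM
    linear_combination hM - fderiv ℝ u e (b 1) / 2 * hvol - fderiv ℝ u e (b 0) * s01
      + fderiv ℝ u e (b 2) * s12
  · simp [h.one, h.orthonormal, f.ext01] at hM
    linear_combination hM - fderiv ℝ u e (b 2) / 2 * hvol - fderiv ℝ u e (b 0) * s02
      - fderiv ℝ u e (b 1) * s12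

end Coord

/-! ### Consequences of the monopole equation: harmonicity, coclosedness, scaling. -/

namespace Coord

variable {E : Type*} [NormedAddCommGroup E] [NormedSpace ℝ E]
  {G : E → E →L[ℝ] E →L[ℝ] ℝ} {u : E → ℝ} {A : E → E →L[ℝ] ℝ} {O : Set E} {e : E}
  {b : Module.Basis (Fin 3) ℝ E} {ν : E → ℝ}

theorem isSymmSndFDerivAt_of_contDiffOn {f : E → ℝ} (hO : IsOpen O) (hf : ContDiffOn ℝ ∞ f O)
    (he : e ∈ O) : IsSymmSndFDerivAt ℝ f e :=
  (hf.contDiffAt (hO.mem_nhds he)).isSymmSndFDerivAt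
    (by simpa using! WithTop.coe_le_coe.2 (le_top (a := (2 : ℕ∞))))

theorem fderiv_apply_of_contDiffOn (hO : IsOpen O) (hA : ContDiffOn ℝ ∞ A O) (he : e ∈ O)
    (y z : E) : fderiv ℝ (fun e' => A e' z) e y = fderiv ℝ A e y z := by
  have hd : DifferentiableAt ℝ A e := (hA.contDiffAt (hO.mem_nhds he)).differentiableAt (by simp)
  rw [(hd.hasFDerivAt.clm_apply (hasFDerivAt_const z e)).fderiv]
  simp

/-- `d(dA) = 0`. -/
theorem fderiv_extDeriv₁_cyclic (hO : IsOpen O) (hA : ContDiffOn ℝ ∞ A O) (he : e ∈ O)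
    (x y z : E) :
    fderiv ℝ (fun e' => extDeriv₁ A e' y z) e x + fderiv ℝ (fun e' => extDeriv₁ A e' z x) e y
      + fderiv ℝ (fun e' => extDeriv₁ A e' x y) e z = 0 := by
  have hs : ∀ z, ContDiffOn ℝ ∞ (fun e' => A e' z) O := fun z => hA.clm_apply contDiffOn_const
  have hd : ∀ z, DifferentiableAt ℝ (fderiv ℝ (fun e' => A e' z)) e := fun z =>
    (((hs z).fderiv_of_isOpen hO (m := ∞) (by simp)).contDiffAt
      (hO.mem_nhds he)).differentiableAt (by simp)
  have key : ∀ x y z, fderiv ℝ (fun e' => extDeriv₁ A e' y z) e x =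
      fderiv ℝ (fderiv ℝ (fun e' => A e' z)) e x y
      - fderiv ℝ (fderiv ℝ (fun e' => A e' y)) e x z := by
    intro x y z
    have h1 := ((hd z).hasFDerivAt.clm_apply (hasFDerivAt_const y e)).sub
      ((hd y).hasFDerivAt.clm_apply (hasFDerivAt_const z e))
    have h2 : (fun e' => extDeriv₁ A e' y z) =ᶠ[𝓝 e] (fun e' => fderiv ℝ (fun e' => A e' z) e' y)
        - (fun e' => fderiv ℝ (fun e' => A e' y) e' z) := by
      filter_upwards [hO.mem_nhds he] with e' he'
      simp only [extDeriv₁, Pi.sub_apply, fderiv_apply_of_contDiffOn hO hA he']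
    rw [h2.fderiv_eq, h1.fderiv]
    simp
  have hsym : ∀ z x y, fderiv ℝ (fderiv ℝ (fun e' => A e' z)) e x y =
      fderiv ℝ (fderiv ℝ (fun e' => A e' z)) e y x := fun z x y =>
    (isSymmSndFDerivAt_of_contDiffOn hO (hs z) he).eq x y
  rw [key, key, key, hsym z x y, hsym y x z, hsym x y z]
  ring

theorem nablaExtDeriv_comm (G : E → E →L[ℝ] E →L[ℝ] ℝ) (A : E → E →L[ℝ] ℝ) (e x y z : E) :
    nablaExtDeriv G A e x y z = -nablaExtDeriv G A e x z y := by
  have : (fun e' => extDeriv₁ A e' y z) = fun e' => -extDeriv₁ A e' z y := by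
    funext e'; exact extDeriv₁_comm A e' y z
  rw [nablaExtDeriv, nablaExtDeriv, this, fderiv_fun_neg, extDeriv₁_comm A e y,
    extDeriv₁_comm A e z]
  simp
  ring

theorem nablaExtDeriv_linear (hO : IsOpen O) (hA : ContDiffOn ℝ ∞ A O) (he : e ∈ O)
    (x z : E) (y y' : E) (c : ℝ) :
    nablaExtDeriv G A e x (c • y + y') z =
      c * nablaExtDeriv G A e x y z + nablaExtDeriv G A e x y' z := by
  have hd : ∀ y, DifferentiableAt ℝ (fun e => extDeriv₁ A e y z) e := fun y =>
    ((contDiffOn_extDeriv₁ hO hA y z).contDiffAt (hO.mem_nhds he)).differentiableAt (by simp)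
  have : (fun e' => extDeriv₁ A e' (c • y + y') z) =
      fun e' => c * extDeriv₁ A e' y z + extDeriv₁ A e' y' z := by
    funext e'; rw [extDeriv₁_add_left, extDeriv₁_smul_left]
  rw [nablaExtDeriv, nablaExtDeriv, nablaExtDeriv, this,
    (((hd y).hasFDerivAt.const_mul c).fun_add (hd y').hasFDerivAt).fderiv]
  simp only [map_add, map_smul, extDeriv₁_add_left, extDeriv₁_smul_left, add_apply, smul_apply,
    smul_eq_mul]
  ring

/-- An alternating bilinear form on a three-dimensional space vanishes if it vanishes on three pairs
of basis vectors. -/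
theorem eq_zero_of_alternating (b : Module.Basis (Fin 3) ℝ E) (Q : E → E → ℝ)
    (hlin : ∀ c y y' z, Q (c • y + y') z = c * Q y z + Q y' z) (hanti : ∀ y z, Q y z = -Q z y)
    (h01 : Q (b 0) (b 1) = 0) (h12 : Q (b 1) (b 2) = 0) (h20 : Q (b 2) (b 0) = 0) (y z : E) :
    Q y z = 0 := by
  have hself : ∀ y, Q y y = 0 := fun y => by linarith [hanti y y]
  have h0 : ∀ z, Q 0 z = 0 := fun z => by simpa using hlin 1 0 0 z
  have hy : ∀ y : E, y = b.repr y 0 • b 0 + (b.repr y 1 • b 1 + (b.repr y 2 • b 2 + 0)) := by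
    intro y
    conv_lhs => rw [← b.sum_repr y]
    rw [Fin.sum_univ_three, add_zero, add_assoc]
  have hb : ∀ i z, Q (b i) z = 0 := by
    intro i z
    rw [hanti, hy z, hlin, hlin, hlin, h0]
    have h10 := hanti (b 1) (b 0)
    have h21 := hanti (b 2) (b 1)
    have h02 := hanti (b 0) (b 2)
    fin_cases i <;> simp [hself, h01, h12, h20, h10, h21, h02]
  rw [hy y, hlin, hlin, hlin, h0]
  simp [hb]

variable [FiniteDimensional ℝ E]

theorem GHData.nabla_symm (hd : GHData G u A O) (he : e ∈ O) (y z : E) :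
    nabla G (fderiv ℝ u) e y z = nabla G (fderiv ℝ u) e z y := by
  simp only [nabla, hd.metric.christoffel_symm he y z,
    (isSymmSndFDerivAt_of_contDiffOn hd.metric.isOpen hd.smooth_u he).eq y z]

/-- The covariant derivative of `dA = *du` is `*(∇ du)`. -/
theorem GHData.nablaExtDeriv_eq (hd : GHData G u A O) (he : e ∈ O)
    (h : MonopoleGerm G u A e b ν) (x : E) (i j k : Fin 3)
    (hijk : (i, j, k) = (0, 1, 2) ∨ (i, j, k) = (1, 2, 0) ∨ (i, j, k) = (2, 0, 1)) :
    nablaExtDeriv G A e x (b j) (b k) = nabla G (fderiv ℝ u) e x (b i) := by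
  have f := h.frame
  have hΓ : ∀ y, fderiv ℝ u e y = G e y (b 0) * fderiv ℝ u e (b 0)
      + G e y (b 1) * fderiv ℝ u e (b 1) + G e y (b 2) * fderiv ℝ u e (b 2) := by
    intro y
    conv_lhs => rw [eq_sum_of_orthonormal b f.orthonormal y]
    simp only [map_add, map_smul, smul_eq_mul]
  have hsym : ∀ i y, G e (b i) (christoffel G e x y) = G e (christoffel G e x y) (b i) :=
    fun i y => hd.metric.symm e he _ _
  rw [nablaExtDeriv, hd.fderiv_extDeriv₁ he h x i j k hijk, f.extDeriv₁_eq, f.extDeriv₁_eq, nabla,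
    hΓ (christoffel G e x (b i))]
  simp only [hd.metric.fderiv_apply he, hsym]
  have g := h.orthonormal
  rcases hijk with hijk | hijk | hijk <;> obtain ⟨rfl, rfl, rfl⟩ := by simpa using hijk
  all_goals simp [g]
  all_goals ring

/-- Since `∇dA = *∇du`, this divergence is an antisymmetrization of the Hessian of `u`, which is
symmetric. -/
theorem GHData.div_eq_zero (hd : GHData G u A O) (he : e ∈ O) (h : MonopoleGerm G u A e b ν)
    (y : E) : ∑ i, nablaExtDeriv G A e (b i) y (b i) = 0 := by
  have lin : ∀ x z, nablaExtDeriv G A e x y z = G e y (b 0) * nablaExtDeriv G A e x (b 0) z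
      + G e y (b 1) * nablaExtDeriv G A e x (b 1) z
      + G e y (b 2) * nablaExtDeriv G A e x (b 2) z := by
    intro x z
    have h0 : nablaExtDeriv G A e x 0 z = 0 := by
      simpa using nablaExtDeriv_linear (G := G) hd.metric.isOpen hd.smooth_A he x z 0 0 1
    conv_lhs => rw [eq_sum_of_orthonormal b h.orthonormal y]
    rw [show G e y (b 0) • b 0 + G e y (b 1) • b 1 + G e y (b 2) • b 2 =
      G e y (b 0) • b 0 + (G e y (b 1) • b 1 + (G e y (b 2) • b 2 + 0)) by abel,
      nablaExtDeriv_linear hd.metric.isOpen hd.smooth_A he,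
      nablaExtDeriv_linear hd.metric.isOpen hd.smooth_A he,
      nablaExtDeriv_linear hd.metric.isOpen hd.smooth_A he, h0]
    ring
  have c := nablaExtDeriv_comm G A e
  have n := hd.nablaExtDeriv_eq he h
  have n0 := fun x => n x 0 1 2 (by simp)
  have n1 := fun x => n x 1 2 0 (by simp)
  have n2 := fun x => n x 2 0 1 (by simp)
  simp only [Fin.sum_univ_three, lin, nablaExtDeriv_self]
  rw [c _ (b 1) (b 0), c _ (b 2) (b 1), c _ (b 0) (b 2), n0, n0, n1, n1, n2, n2,
    hd.nabla_symm he (b 1) (b 0), hd.nabla_symm he (b 2) (b 1), hd.nabla_symm he (b 2) (b 0)]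
  ring

/-- This is `d(dA) = d*du = 0`; in the cyclic sum the Christoffel terms cancel by symmetry. -/
theorem GHData.laplacian_eq_zero (hd : GHData G u A O) (he : e ∈ O)
    (h : MonopoleGerm G u A e b ν) : ∑ i, nabla G (fderiv ℝ u) e (b i) (b i) = 0 := by
  have n := hd.nablaExtDeriv_eq he h
  have n0 := n (b 0) 0 1 2 (by simp)
  have n1 := n (b 1) 1 2 0 (by simp)
  have n2 := n (b 2) 2 0 1 (by simp)
  have cyc := fderiv_extDeriv₁_cyclic hd.metric.isOpen hd.smooth_A he (b 0) (b 1) (b 2)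
  rw [nablaExtDeriv] at n0 n1 n2
  rw [extDeriv₁_comm A e (b 1) (christoffel G e (b 0) (b 2))] at n0
  rw [extDeriv₁_comm A e (b 2), hd.metric.christoffel_symm he (b 1) (b 0)] at n1
  rw [extDeriv₁_comm A e (b 0), hd.metric.christoffel_symm he (b 2) (b 1),
    hd.metric.christoffel_symm he (b 2) (b 0)] at n2
  rw [Fin.sum_univ_three, ← n0, ← n1, ← n2]
  linear_combination cyc

/-- The Ricci tensor of a Gibbons--Hawking metric is the pull-back of that of the base. -/
theorem GHData.ricci_gh_of_monopole {p : E × ℝ} (hd : GHData G u A O) (hp : p.1 ∈ O)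
    (h : MonopoleGerm G u A p.1 b ν) (Y Z : E × ℝ) :
    ricci (gh G u A) p Y Z = ricci G p.1 Y.1 Z.1 :=
  hd.ricci_gh hp b h.frame (hd.laplacian_eq_zero hp h) (hd.div_eq_zero hp h) Y Z

omit [FiniteDimensional ℝ E] in
/-- If `F` scales the metric and `u`, it scales `dA = *du`. -/
theorem GHData.lieDeriv_extDeriv₁ (hd : GHData G u A O) (he : e ∈ O)
    (h : MonopoleGerm G u A e b ν) {F : E → E} (hF : DifferentiableAt ℝ F e) {c : ℝ}
    (hFu : ∀ᶠ e' in 𝓝 e, fderiv ℝ u e' (F e') = c * u e')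
    (hFG : ∀ X Y, lieDeriv F G e X Y = -c * G e X Y) (y z : E) :
    fderiv ℝ (fun e' => extDeriv₁ A e' y z) e (F e) + extDeriv₁ A e (fderiv ℝ F e y) z
      + extDeriv₁ A e y (fderiv ℝ F e z) = c / 2 * extDeriv₁ A e y z := by
  have f := h.frame
  have hΓ : ∀ y, fderiv ℝ u e y = G e y (b 0) * fderiv ℝ u e (b 0)
      + G e y (b 1) * fderiv ℝ u e (b 1) + G e y (b 2) * fderiv ℝ u e (b 2) := by
    intro y
    conv_lhs => rw [eq_sum_of_orthonormal b f.orthonormal y]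
    simp only [map_add, map_smul, smul_eq_mul]
  have hsym : ∀ i y, G e (b i) (fderiv ℝ F e y) = G e (fderiv ℝ F e y) (b i) :=
    fun i y => hd.metric.symm e he _ _
  -- `L_F du = d(F(u)) = c du`. The star from one-forms to two-forms in dimension three is
  -- homogeneous of degree `½` in the metric, so it contributes the weight `-c/2`; together this is
  -- the factor `c/2` of the conclusion.
  have hdu : ∀ y, fderiv ℝ (fderiv ℝ u) e (F e) y = c * fderiv ℝ u e y
      - fderiv ℝ u e (fderiv ℝ F e y) := by
    intro y
    have h1 := (hd.differentiableAt_fderiv_u he).hasFDerivAt.clm_apply hF.hasFDerivAt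
    have h2 := (hd.differentiableAt_u he).hasFDerivAt.const_mul c
    have h3 := DFunLike.congr_fun (h1.unique (h2.congr_of_eventuallyEq hFu)) y
    simp at h3
    rw [(isSymmSndFDerivAt_of_contDiffOn hd.metric.isOpen hd.smooth_u he).eq (F e) y]
    linarith
  have hG : ∀ x y, fderiv ℝ G e (F e) x y = -c * G e x y - G e (fderiv ℝ F e x) y
      - G e x (fderiv ℝ F e y) := by
    intro x y
    rw [← hFG x y, lieDeriv]
    ring
  -- both sides are bilinear, so that it suffices to compare them on the basis
  have hd1 : ∀ y z, DifferentiableAt ℝ (fun e => extDeriv₁ A e y z) e :=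
    hd.differentiableAt_extDeriv₁ he
  have hbasis : ∀ i j k : Fin 3,
      ((i, j, k) = (0, 1, 2) ∨ (i, j, k) = (1, 2, 0) ∨ (i, j, k) = (2, 0, 1)) →
      fderiv ℝ (fun e' => extDeriv₁ A e' (b j) (b k)) e (F e)
        + extDeriv₁ A e (fderiv ℝ F e (b j)) (b k)
        + extDeriv₁ A e (b j) (fderiv ℝ F e (b k)) = c / 2 * extDeriv₁ A e (b j) (b k) := by
    intro i j k hijk
    rw [hd.fderiv_extDeriv₁ he h (F e) i j k hijk]
    simp only [f.extDeriv₁_eq, hdu, hG, hΓ (fderiv ℝ F e _), hsym]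
    have g := h.orthonormal
    rcases hijk with hijk | hijk | hijk <;> obtain ⟨rfl, rfl, rfl⟩ := by simpa using hijk
    all_goals simp [g]
    all_goals ring
  have h0 := hbasis 0 1 2 (by simp)
  have h1 := hbasis 1 2 0 (by simp)
  have h2 := hbasis 2 0 1 (by simp)
  refine sub_eq_zero.1 (eq_zero_of_alternating b (fun y z =>
    fderiv ℝ (fun e' => extDeriv₁ A e' y z) e (F e) + extDeriv₁ A e (fderiv ℝ F e y) z
      + extDeriv₁ A e y (fderiv ℝ F e z) - c / 2 * extDeriv₁ A e y z) ?_ ?_ ?_ ?_ ?_ y z)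
  · intro k y y' z
    have : (fun e' => extDeriv₁ A e' (k • y + y') z) =
        fun e' => k * extDeriv₁ A e' y z + extDeriv₁ A e' y' z := by
      funext e'; rw [extDeriv₁_add_left, extDeriv₁_smul_left]
    rw [this, (((hd1 y z).hasFDerivAt.const_mul k).fun_add (hd1 y' z).hasFDerivAt).fderiv]
    simp only [map_add, map_smul, extDeriv₁_add_left, extDeriv₁_smul_left, add_apply, smul_apply,
      smul_eq_mul]
    ring
  · intro y z
    have : (fun e' => extDeriv₁ A e' y z) = fun e' => -extDeriv₁ A e' z y := by
      funext e'; exact extDeriv₁_comm A e' y z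
    rw [this, fderiv_fun_neg, extDeriv₁_comm A e _ z, extDeriv₁_comm A e y, extDeriv₁_comm A e y]
    simp
    ring
  · simpa [sub_eq_zero] using h2
  · simpa [sub_eq_zero] using h0
  · simpa [sub_eq_zero] using h1

end Coord

/-! ### Fields scaling `u` and the metric: closed forms and the equations of the system. -/

namespace Coord

variable {E : Type*} [NormedAddCommGroup E] [NormedSpace ℝ E]
  {G : E → E →L[ℝ] E →L[ℝ] ℝ} {u : E → ℝ} {A : E → E →L[ℝ] ℝ} {O : Set E} {e : E}
  {b : Module.Basis (Fin 3) ℝ E} {ν : E → ℝ}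

/-- The contraction `i_F dA`. -/
noncomputable def contract (A : E → E →L[ℝ] ℝ) (F : E → E) (e : E) : E →L[ℝ] ℝ :=
  fderiv ℝ A e (F e) - (fderiv ℝ A e).flip (F e)

theorem contract_apply (A : E → E →L[ℝ] ℝ) (F : E → E) (e y : E) :
    contract A F e y = extDeriv₁ A e (F e) y := rfl

set_option synthInstance.maxHeartbeats 200000 in
theorem hasDerivAt_contract (hO : IsOpen O) (hA : ContDiffOn ℝ ∞ A O) (he : e ∈ O) {F : E → E}
    (hF : DifferentiableAt ℝ F e) (x y : E) :
    HasDerivAt (fun s : ℝ => contract A F (e + s • x) y)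
      (fderiv ℝ (fun e' => extDeriv₁ A e' (F e) y) e x + extDeriv₁ A e (fderiv ℝ F e x) y) 0 := by
  have hd : DifferentiableAt ℝ (fderiv ℝ A) e :=
    ((hA.fderiv_of_isOpen hO (m := ∞) (by simp)).contDiffAt (hO.mem_nhds he)).differentiableAt
      (by simp)
  have h1 : HasDerivAt (fun s : ℝ => fderiv ℝ A (e + s • x)) (fderiv ℝ (fderiv ℝ A) e x) 0 :=
    hasDerivAt_comp_line (f := fderiv ℝ A) (e := e) hd x
  have h2 := hasDerivAt_comp_line hF x
  have hl := ((h1.clm_apply h2).clm_apply (hasDerivAt_const (0 : ℝ) y)).sub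
    ((h1.clm_apply (hasDerivAt_const (0 : ℝ) y)).clm_apply h2)
  have hdω : DifferentiableAt ℝ (fun e' => extDeriv₁ A e' (F e) y) e :=
    ((contDiffOn_extDeriv₁ hO hA (F e) y).contDiffAt (hO.mem_nhds he)).differentiableAt (by simp)
  have hr := ((h1.clm_apply (hasDerivAt_const (0 : ℝ) (F e))).clm_apply
    (hasDerivAt_const (0 : ℝ) y)).sub
    ((h1.clm_apply (hasDerivAt_const (0 : ℝ) y)).clm_apply (hasDerivAt_const (0 : ℝ) (F e)))
  have h3 := (hasDerivAt_comp_line hdω x).unique hr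
  refine hl.congr_deriv ?_
  rw [h3]
  simp [extDeriv₁]
  ring

theorem contDiffOn_contract [FiniteDimensional ℝ E] (hO : IsOpen O) (hA : ContDiffOn ℝ ∞ A O)
    {F : E → E} (hF : ContDiffOn ℝ ∞ F O) : ContDiffOn ℝ ∞ (contract A F) O := by
  refine contDiffOn_clm_apply.2 fun y => ?_
  have h1 : ContDiffOn ℝ ∞ (fderiv ℝ A) O := hA.fderiv_of_isOpen hO (by simp)
  exact ((h1.clm_apply hF).clm_apply contDiffOn_const).sub
    ((h1.clm_apply contDiffOn_const).clm_apply hF)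

/-- If `F` scales the metric and `u`, then `(2 / c) i_F dA - A` is closed, where `dA = *du`. -/
theorem GHData.fderiv_contract_symm [FiniteDimensional ℝ E] (hd : GHData G u A O) (he : e ∈ O)
    (h : MonopoleGerm G u A e b ν) {F : E → E} (hF : ContDiffOn ℝ ∞ F O) {c : ℝ} (hc : c ≠ 0)
    (hFu : ∀ e ∈ O, fderiv ℝ u e (F e) = c * u e)
    (hFG : ∀ X Y, lieDeriv F G e X Y = -c * G e X Y) (x y : E) :
    fderiv ℝ (fun e => (2 / c) • contract A F e - A e) e x y =
      fderiv ℝ (fun e => (2 / c) • contract A F e - A e) e y x := by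
  have hO := hd.metric.isOpen
  have hF' : DifferentiableAt ℝ F e := (hF.contDiffAt (hO.mem_nhds he)).differentiableAt (by simp)
  have hβ : ContDiffOn ℝ ∞ (fun e => (2 / c) • contract A F e - A e) O :=
    ((contDiffOn_contract hO hd.smooth_A hF).const_smul _).sub hd.smooth_A
  have hβ' : DifferentiableAt ℝ (fun e => (2 / c) • contract A F e - A e) e :=
    (hβ.contDiffAt (hO.mem_nhds he)).differentiableAt (by simp)
  have key : ∀ x y, fderiv ℝ (fun e => (2 / c) • contract A F e - A e) e x y =
      2 / c * (fderiv ℝ (fun e' => extDeriv₁ A e' (F e) y) e x + extDeriv₁ A e (fderiv ℝ F e x) y)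
      - fderiv ℝ A e x y := by
    intro x y
    refine (hasDerivAt_line_apply hβ' x y).unique ?_
    exact ((hasDerivAt_contract hO hd.smooth_A he hF' x y).const_mul (2 / c)).sub
      (hasDerivAt_line_apply (hd.differentiableAt_A he) x y)
  rw [key, key]
  -- Cartan's formula: `d(i_F dA) = L_F dA - i_F d(dA) = (c/2) dA`, so the factor `2/c` makes the
  -- difference with `A` closed.
  have h1 := hd.lieDeriv_extDeriv₁ he h hF'
    (by filter_upwards [hO.mem_nhds he] with e' he' using hFu e' he') hFG x y
  have h2 := fderiv_extDeriv₁_cyclic hO hd.smooth_A he (F e) x y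
  have h3 : fderiv ℝ (fun e' => extDeriv₁ A e' (F e) y) e x =
      -fderiv ℝ (fun e' => extDeriv₁ A e' y (F e)) e x := by
    have : (fun e' => extDeriv₁ A e' (F e) y) = fun e' => -extDeriv₁ A e' y (F e) := by
      funext e'; exact extDeriv₁_comm A e' _ _
    rw [this, fderiv_fun_neg]
    rfl
  rw [extDeriv₁_comm A e x (fderiv ℝ F e y)] at h1
  have h4 : fderiv ℝ A e x y - fderiv ℝ A e y x = extDeriv₁ A e x y := rfl
  rw [h3]
  linear_combination (2 / c) * h1 - (2 / c) * h2 - h4 + (extDeriv₁ A e x y) * (mul_inv_cancel₀ hc)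

variable [FiniteDimensional ℝ E]

set_option synthInstance.maxHeartbeats 200000 in
/-- The Lie derivative of the metric along `V` is twice the symmetric part of `∇ V♭`. -/
theorem MetricOn.lieDeriv_eq (hG : MetricOn G O) (he : e ∈ O) {V : E → E} {α : E → E →L[ℝ] ℝ}
    (hV : DifferentiableAt ℝ V e) (hα : DifferentiableAt ℝ α e)
    (hVα : ∀ᶠ e' in 𝓝 e, G e' (V e') = α e') (X Y : E) :
    lieDeriv V G e X Y = nabla G α e X Y + nabla G α e Y X := by
  have hVα0 := hVα.self_of_nhds
  have key : ∀ x y, fderiv ℝ α e x y = fderiv ℝ G e x (V e) y + G e (fderiv ℝ V e x) y := by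
    intro x y
    have hline : Filter.Tendsto (fun s : ℝ => e + s • x) (𝓝 0) (𝓝 e) := by
      have : ContinuousAt (fun s : ℝ => e + s • x) 0 := by fun_prop
      simpa [ContinuousAt] using this
    have hGl : HasDerivAt (fun s : ℝ => G (e + s • x)) (fderiv ℝ G e x) 0 :=
      hasDerivAt_comp_line (f := G) (e := e) (hG.differentiableAt he) x
    have h1 := (hGl.clm_apply (hasDerivAt_comp_line hV x)).clm_apply (hasDerivAt_const (0 : ℝ) y)
    have h2 := h1.unique ((hasDerivAt_line_apply hα x y).congr_of_eventuallyEq (by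
      filter_upwards [hline.eventually hVα] with s hs
      rw [hs]))
    rw [← h2]
    simp
  simp only [nabla, lieDeriv, key, ← hVα0, hG.fderiv_apply he]
  rw [hG.symm e he X, hG.symm e he X, hG.christoffel_symm he (V e) X,
    hG.christoffel_symm he (V e) Y, hG.christoffel_symm he Y X]
  ring

/-- The Hessian of `w`, when `dw = a W♭ + u² F♭`. -/
theorem GHData.nabla_eq (hd : GHData G u A O) (he : e ∈ O) {a : ℝ} {w : E → ℝ} {W F : E → E}
    {B φ : E → E →L[ℝ] ℝ} (hw : ContDiffOn ℝ ∞ w O) (hW : DifferentiableAt ℝ W e)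
    (hF : DifferentiableAt ℝ F e) (hB : DifferentiableAt ℝ B e) (hφ : DifferentiableAt ℝ φ e)
    (hWB : ∀ᶠ e' in 𝓝 e, G e' (W e') = B e') (hFφ : ∀ᶠ e' in 𝓝 e, G e' (F e') = φ e')
    (hdw : ∀ᶠ e' in 𝓝 e, fderiv ℝ w e' = a • B e' + u e' ^ 2 • φ e') (X Y : E) :
    nabla G (fderiv ℝ w) e X Y = 1 / 2 * a * lieDeriv W G e X Y
      + 1 / 2 * u e ^ 2 * lieDeriv F G e X Y
      + u e * (fderiv ℝ u e X * φ e Y + fderiv ℝ u e Y * φ e X) := by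
  have hdw0 := hdw.self_of_nhds
  have hu := hd.differentiableAt_u he
  have hwd : DifferentiableAt ℝ (fderiv ℝ w) e :=
    ((hw.fderiv_of_isOpen hd.metric.isOpen (m := ∞) (by simp)).contDiffAt
      (hd.metric.isOpen.mem_nhds he)).differentiableAt (by simp)
  have h2 : ∀ x y, fderiv ℝ (fderiv ℝ w) e x y = a * fderiv ℝ B e x y
      + (2 * u e * fderiv ℝ u e x * φ e y + u e ^ 2 * fderiv ℝ φ e x y) := by
    intro x y
    have h3 := (hB.hasFDerivAt.const_smul a).add ((hu.hasFDerivAt.pow 2).smul hφ.hasFDerivAt)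
    have h4 := h3.congr_of_eventuallyEq hdw
    rw [h4.fderiv]
    simp
    ring
  have h5 := (isSymmSndFDerivAt_of_contDiffOn hd.metric.isOpen hw he).eq X Y
  have hN : ∀ x y, nabla G (fderiv ℝ w) e x y = a * nabla G B e x y
      + (2 * u e * fderiv ℝ u e x * φ e y + u e ^ 2 * nabla G φ e x y) := by
    intro x y
    simp only [nabla, h2, hdw0, add_apply, smul_apply, smul_eq_mul]
    ring
  -- The Hessian equals its own symmetrization, in which `∇B` and `∇φ` become half the Lie
  -- derivatives of the metric along `W` and `F`.
  have hsym : nabla G (fderiv ℝ w) e X Y = nabla G (fderiv ℝ w) e Y X := by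
    simp only [nabla, h5, hd.metric.christoffel_symm he X Y]
  rw [hd.metric.lieDeriv_eq he hW hB hWB, hd.metric.lieDeriv_eq he hF hφ hFφ]
  have h6 := hN X Y
  have h7 := hN Y X
  rw [← hsym] at h7
  linear_combination 1 / 2 * h6 + 1 / 2 * h7

omit [FiniteDimensional ℝ E] in
/-- The contraction of `dA = *du` with the gradient of `u` vanishes. -/
theorem IsMonopoleFrame.extDeriv₁_grad {b : Module.Basis (Fin 3) ℝ E}
    (hb : IsMonopoleFrame G u A e b) {n : E} (hn : ∀ y, G e n y = fderiv ℝ u e y) (y : E) :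
    extDeriv₁ A e n y = 0 := by
  rw [hb.extDeriv₁_eq]
  simp only [hn]
  ring

set_option synthInstance.maxHeartbeats 200000 in
/-- The derivative of `du` along a field `F` scaling the metric and `u`, such that
`d(u² F♭) = -a dA` with `dA = *du`. -/
theorem GHData.nabla_scaling (hd : GHData G u A O) (he : e ∈ O)
    {b : Module.Basis (Fin 3) ℝ E} (hb : IsMonopoleFrame G u A e b) {F : E → E}
    {φ : E → E →L[ℝ] ℝ} {a c : ℝ} (hF : DifferentiableAt ℝ F e) (hφ : DifferentiableAt ℝ φ e)
    (hFφ : ∀ᶠ e' in 𝓝 e, G e' (F e') = φ e')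
    (hFu : ∀ᶠ e' in 𝓝 e, fderiv ℝ u e' (F e') = c * u e')
    (hFG : ∀ X Y, lieDeriv F G e X Y = -c * G e X Y)
    (hext : ∀ X Y, extDeriv₁ (fun e' => u e' ^ 2 • φ e') e X Y = -a * extDeriv₁ A e X Y)
    {n : E} (hn : ∀ y, G e n y = fderiv ℝ u e y) (X : E) :
    u e * nabla G (fderiv ℝ u) e (F e) X = -(fderiv ℝ u e n * φ e X)
      + 5 / 2 * c * u e * fderiv ℝ u e X := by
  have hu := hd.differentiableAt_u he
  have hne := (hd.pos_u e he).ne'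
  have hφ0 := hFφ.self_of_nhds
  have hFu0 := hFu.self_of_nhds
  -- Differentiating `F(u) = c u` gives `∇du(F, X) = c du(X) - ∇φ(X, n)`. The symmetric part of
  -- `∇φ(X, n)` is `-(c/2) du(X)` by the scaling of the metric. The antisymmetric part comes from
  -- `d(u² φ)(n, ·) = -a dA(n, ·) = 0` and yields `|du|² φ(X) / u - c du(X)`. Hence the coefficient
  -- `5/2 = 1 + 1/2 + 1`.
  have h1 : fderiv ℝ (fderiv ℝ u) e X (F e) + fderiv ℝ u e (fderiv ℝ F e X)
      = c * fderiv ℝ u e X := by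
    have h1 := (hd.differentiableAt_fderiv_u he).hasFDerivAt.clm_apply hF.hasFDerivAt
    have h2 := hu.hasFDerivAt.const_mul c
    have h3 := DFunLike.congr_fun (h1.unique (h2.congr_of_eventuallyEq hFu)) X
    simp at h3
    linarith
  have h2 : extDeriv₁ (fun e' => u e' ^ 2 • φ e') e n X = 2 * u e * (fderiv ℝ u e n * φ e X
      - fderiv ℝ u e X * φ e n) + u e ^ 2 * extDeriv₁ φ e n X := by
    have h3 := (hu.hasFDerivAt.pow 2).smul hφ.hasFDerivAt
    have h4 : fderiv ℝ (fun e' => u e' ^ 2 • φ e') e = _ := h3.fderiv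
    rw [extDeriv₁, h4]
    simp [extDeriv₁]
    ring
  have h3 := hFG X n
  rw [hd.metric.lieDeriv_eq he hF hφ hFφ] at h3
  have h4 : φ e n = c * u e := by
    rw [← hφ0, hd.metric.symm e he, hn, hFu0]
  rw [hext, hb.extDeriv₁_grad hn, h4] at h2
  -- `∇φ` in terms of the derivative of `F`
  have h5 : nabla G φ e X n = fderiv ℝ u e (fderiv ℝ F e X)
      + fderiv ℝ u e (christoffel G e X (F e)) := by
    have hGl : HasDerivAt (fun s : ℝ => G (e + s • X)) (fderiv ℝ G e X) 0 :=
      hasDerivAt_comp_line (f := G) (e := e) (hd.metric.differentiableAt he) X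
    have hline : Filter.Tendsto (fun s : ℝ => e + s • X) (𝓝 0) (𝓝 e) := by
      have : ContinuousAt (fun s : ℝ => e + s • X) 0 := by fun_prop
      simpa [ContinuousAt] using this
    have k1 := (hGl.clm_apply (hasDerivAt_comp_line hF X)).clm_apply (hasDerivAt_const (0 : ℝ) n)
    have k2 := k1.unique ((hasDerivAt_line_apply hφ X n).congr_of_eventuallyEq (by
      filter_upwards [hline.eventually hFφ] with s hs
      rw [hs]))
    simp at k2
    rw [nabla, ← k2, hd.metric.fderiv_apply he, ← hφ0, ← hn, ← hn,
      hd.metric.symm e he n, hd.metric.symm e he n]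
    ring
  have h6 : extDeriv₁ φ e n X = nabla G φ e n X - nabla G φ e X n := by
    simp only [extDeriv₁, nabla, hd.metric.christoffel_symm he n X]
    ring
  have h7 : nabla G (fderiv ℝ u) e (F e) X = fderiv ℝ (fderiv ℝ u) e X (F e)
      - fderiv ℝ u e (christoffel G e X (F e)) := by
    rw [hd.nabla_symm he]
    rfl
  have h8 : G e X n = fderiv ℝ u e X := by rw [hd.metric.symm e he, hn]
  rw [h8] at h3
  rw [h6] at h2
  have h9 : u e * (nabla G φ e n X - nabla G φ e X n)
      + 2 * (fderiv ℝ u e n * φ e X - fderiv ℝ u e X * (c * u e)) = 0 := by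
    apply mul_left_cancel₀ hne
    linear_combination -h2
  rw [h7]
  linear_combination u e * h1 + u e * h5 - u e / 2 * h3 + 1 / 2 * h9

set_option synthInstance.maxHeartbeats 200000 in
/-- The terms in `W = B♯` in the second equation of the system. -/
theorem GHData.bracket_sub_lieDeriv (hd : GHData G u A O) (he : e ∈ O)
    {b : Module.Basis (Fin 3) ℝ E} {n W : E → E} {B : E → E →L[ℝ] ℝ}
    (hb : IsMonopoleFrame G u B e b) (hn : DifferentiableAt ℝ n e) (hW : DifferentiableAt ℝ W e)
    (hB : DifferentiableAt ℝ B e)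
    (hnu : ∀ᶠ e' in 𝓝 e, G e' (n e') = fderiv ℝ u e') (hWB : ∀ᶠ e' in 𝓝 e, G e' (W e') = B e')
    (X : E) :
    1 / 2 * lieDeriv W G e (n e) X - G e (fderiv ℝ W e (n e) - fderiv ℝ n e (W e)) X =
      nabla G (fderiv ℝ u) e (W e) X := by
  have key : ∀ (V : E → E) (α : E → E →L[ℝ] ℝ), DifferentiableAt ℝ V e → DifferentiableAt ℝ α e →
      (∀ᶠ e' in 𝓝 e, G e' (V e') = α e') → ∀ x y, G e (fderiv ℝ V e x) y = nabla G α e x y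
        - G e (christoffel G e x (V e)) y := by
    intro V α hV hα hVα x y
    have hα0 := hVα.self_of_nhds
    have hGl : HasDerivAt (fun s : ℝ => G (e + s • x)) (fderiv ℝ G e x) 0 :=
      hasDerivAt_comp_line (f := G) (e := e) (hd.metric.differentiableAt he) x
    have hline : Filter.Tendsto (fun s : ℝ => e + s • x) (𝓝 0) (𝓝 e) := by
      have : ContinuousAt (fun s : ℝ => e + s • x) 0 := by fun_prop
      simpa [ContinuousAt] using this
    have k1 := (hGl.clm_apply (hasDerivAt_comp_line hV x)).clm_apply (hasDerivAt_const (0 : ℝ) y)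
    have k2 := k1.unique ((hasDerivAt_line_apply hα x y).congr_of_eventuallyEq (by
      filter_upwards [hline.eventually hVα] with s hs
      rw [hs]))
    simp at k2
    rw [nabla, ← k2, hd.metric.fderiv_apply he, ← hα0]
    ring
  have hn0 : ∀ y, G e (n e) y = fderiv ℝ u e y := fun y => by rw [hnu.self_of_nhds]
  -- In covariant terms the left-hand side is `½ (∇B(n, X) + ∇B(X, n)) - ∇B(n, X) + ∇du(W, X)`. It
  -- differs from `∇du(W, X)` by `-½ dB(n, X)`, which vanishes because `n` is the gradient and `dB =
  -- *du`.
  have h1 := hb.extDeriv₁_grad hn0 X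
  rw [map_sub, sub_apply, key W B hW hB hWB, key n _ hn (hd.differentiableAt_fderiv_u he) hnu,
    hd.metric.lieDeriv_eq he hW hB hWB, hd.metric.christoffel_symm he (n e)]
  have h2 : extDeriv₁ B e (n e) X = nabla G B e (n e) X - nabla G B e X (n e) := by
    simp only [extDeriv₁, nabla, hd.metric.christoffel_symm he (n e) X]
    ring
  linear_combination -1 / 2 * h1 + 1 / 2 * h2

end Coord

/-! ### Naturality under changes of coordinates, and unique continuation of Killing fields. -/

namespace Coord

variable {E : Type*} [NormedAddCommGroup E] [NormedSpace ℝ E]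
  {G : E → E →L[ℝ] E →L[ℝ] ℝ} {O : Set E} {e : E}

theorem tendsto_line (e x : E) : Filter.Tendsto (fun s : ℝ => e + s • x) (𝓝 0) (𝓝 e) := by
  have : ContinuousAt (fun s : ℝ => e + s • x) 0 := by fun_prop
  simpa [ContinuousAt] using this

/-- The second derivative of `ψ` enters symmetrically and cancels. The same symmetry underlies
`lieDeriv_pullback`. -/
theorem extDeriv₁_pullback {ψ : E → E} {α α' : E → E →L[ℝ] ℝ} (hψ : ContDiffAt ℝ ∞ ψ e)
    (hα : DifferentiableAt ℝ α e) (hα' : DifferentiableAt ℝ α' (ψ e))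
    (h : ∀ᶠ e' in 𝓝 e, α e' = (α' (ψ e')).comp (fderiv ℝ ψ e')) (x y : E) :
    extDeriv₁ α e x y = extDeriv₁ α' (ψ e) (fderiv ℝ ψ e x) (fderiv ℝ ψ e y) := by
  have hψd : DifferentiableAt ℝ ψ e := hψ.differentiableAt (by simp)
  have hψ2 : DifferentiableAt ℝ (fderiv ℝ ψ) e :=
    (hψ.fderiv_right (m := ∞) (by simp)).differentiableAt (by simp)
  have hsym : IsSymmSndFDerivAt ℝ ψ e := hψ.isSymmSndFDerivAt
    (by simpa using! WithTop.coe_le_coe.2 (le_top (a := (2 : ℕ∞))))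
  have key : ∀ x y, fderiv ℝ α e x y = fderiv ℝ α' (ψ e) (fderiv ℝ ψ e x) (fderiv ℝ ψ e y)
      + α' (ψ e) (fderiv ℝ (fderiv ℝ ψ) e x y) := by
    intro x y
    have h1 := hasDerivAt_comp_line (hα'.comp e hψd) x
    have h2 := h1.clm_apply (hasDerivAt_line_apply hψ2 x y)
    have h3 := (hasDerivAt_line_apply hα x y).unique (h2.congr_of_eventuallyEq (by
      filter_upwards [(tendsto_line e x).eventually h] with s hs
      rw [hs]
      rfl))
    rw [h3, fderiv_comp e hα' hψd]
    simp
  rw [extDeriv₁, extDeriv₁, key, key, hsym.eq x y]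
  ring

set_option synthInstance.maxHeartbeats 200000 in
theorem lieDeriv_pullback {ψ : E → E} {T T' : E → E →L[ℝ] E →L[ℝ] ℝ} {V V' : E → E}
    (hψ : ContDiffAt ℝ ∞ ψ e) (hT : DifferentiableAt ℝ T e) (hT' : DifferentiableAt ℝ T' (ψ e))
    (hV : DifferentiableAt ℝ V e) (hV' : DifferentiableAt ℝ V' (ψ e))
    (h : ∀ᶠ e' in 𝓝 e, T e' = pullBilin (T' (ψ e')) (fderiv ℝ ψ e'))
    (hVV : ∀ᶠ e' in 𝓝 e, fderiv ℝ ψ e' (V e') = V' (ψ e')) (x y : E) :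
    lieDeriv V T e x y = lieDeriv V' T' (ψ e) (fderiv ℝ ψ e x) (fderiv ℝ ψ e y) := by
  have hψd : DifferentiableAt ℝ ψ e := hψ.differentiableAt (by simp)
  have hψ2 : DifferentiableAt ℝ (fderiv ℝ ψ) e :=
    (hψ.fderiv_right (m := ∞) (by simp)).differentiableAt (by simp)
  have hsym : IsSymmSndFDerivAt ℝ ψ e := hψ.isSymmSndFDerivAt
    (by simpa using! WithTop.coe_le_coe.2 (le_top (a := (2 : ℕ∞))))
  have h0 := h.self_of_nhds
  have hVV0 := hVV.self_of_nhds
  have key : ∀ v x y, fderiv ℝ T e v x y =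
      fderiv ℝ T' (ψ e) (fderiv ℝ ψ e v) (fderiv ℝ ψ e x) (fderiv ℝ ψ e y)
      + T' (ψ e) (fderiv ℝ (fderiv ℝ ψ) e v x) (fderiv ℝ ψ e y)
      + T' (ψ e) (fderiv ℝ ψ e x) (fderiv ℝ (fderiv ℝ ψ) e v y) := by
    intro v x y
    have h1 : HasDerivAt (fun s : ℝ => (T' ∘ ψ) (e + s • v))
        (fderiv ℝ T' (ψ e) (fderiv ℝ ψ e v)) 0 :=
      (hasDerivAt_comp_line (f := T' ∘ ψ) (e := e) (hT'.comp e hψd) v).congr_deriv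
        (by rw [fderiv_comp e hT' hψd]; rfl)
    have h2 := (h1.clm_apply (hasDerivAt_line_apply hψ2 v x)).clm_apply
      (hasDerivAt_line_apply hψ2 v y)
    have h3 := (hasDerivAt_line_apply₂ hT v x y).unique (h2.congr_of_eventuallyEq (by
      filter_upwards [(tendsto_line e v).eventually h] with s hs
      rw [hs]
      rfl))
    rw [h3]
    simp
  have hDV : ∀ x, fderiv ℝ (fderiv ℝ ψ) e x (V e) + fderiv ℝ ψ e (fderiv ℝ V e x) =
      fderiv ℝ V' (ψ e) (fderiv ℝ ψ e x) := by
    intro x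
    have h1 := hψ2.hasFDerivAt.clm_apply hV.hasFDerivAt
    have h2 := hV'.hasFDerivAt.comp e hψd.hasFDerivAt
    have h3 := DFunLike.congr_fun (h1.unique (h2.congr_of_eventuallyEq hVV)) x
    simp at h3
    rw [← h3, add_comm]
  simp only [lieDeriv, key, h0, pullBilin_apply, ← hVV0, ← hDV, map_add, add_apply,
    hsym.eq x (V e), hsym.eq y (V e)]
  ring

/-- A function whose derivative is bounded by a multiple of its values vanishes near its zeros. -/
theorem eventually_eq_zero_of_norm_fderiv_le {F : Type*} [NormedAddCommGroup F] [NormedSpace ℝ F]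
    {η : E → F} {C : ℝ} (hd : ∀ᶠ e' in 𝓝 e, DifferentiableAt ℝ η e')
    (hC : ∀ᶠ e' in 𝓝 e, ∀ Z, ‖fderiv ℝ η e' Z‖ ≤ C * ‖η e'‖ * ‖Z‖) (h0 : η e = 0) : ∀ᶠ e' in 𝓝 e, η e' = 0 := by
  obtain ⟨r, hr, hball⟩ := Metric.eventually_nhds_iff_ball.1 (hd.and hC)
  filter_upwards [Metric.ball_mem_nhds e hr] with e' he'
  have hmem : ∀ s ∈ Icc (0 : ℝ) 1, e + s • (e' - e) ∈ Metric.ball e r := by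
    intro s hs
    rw [mem_ball_iff_norm] at he' ⊢
    rw [add_sub_cancel_left, norm_smul, Real.norm_of_nonneg hs.1]
    exact (mul_le_of_le_one_left (norm_nonneg _) hs.2).trans_lt he'
  have hder : ∀ s ∈ Icc (0 : ℝ) 1, HasDerivAt (fun s : ℝ => η (e + s • (e' - e)))
      (fderiv ℝ η (e + s • (e' - e)) (e' - e)) s := by
    intro s hs
    refine (hball _ (hmem s hs)).1.hasFDerivAt.comp_hasDerivAt s ?_
    simpa using! ((hasDerivAt_id s).smul_const (e' - e)).const_add e
  -- Grönwall's inequality on the segment from `e` to `e'`; with initial value `0` and no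
  -- inhomogeneous term the bound is `0`.
  have := norm_le_gronwallBound_of_norm_deriv_right_le (δ := 0) (K := C * ‖e' - e‖) (ε := 0)
    (f := fun s : ℝ => η (e + s • (e' - e)))
    (f' := fun s => fderiv ℝ η (e + s • (e' - e)) (e' - e)) (a := 0) (b := 1)
    (fun s hs => (hder s hs).continuousAt.continuousWithinAt)
    (fun s hs => (hder s (Ico_subset_Icc_self hs)).hasDerivWithinAt) (by simp [h0]) (by
      intro s hs
      rw [add_zero]
      calc _ ≤ C * ‖η (e + s • (e' - e))‖ * ‖e' - e‖ :=
            (hball _ (hmem s (Ico_subset_Icc_self hs))).2 _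
        _ = _ := by ring) 1 (by simp)
  rw [gronwallBound_ε0_δ0] at this
  simpa using this

theorem eventually_norm_fderiv_apply_le {F : Type*} [NormedAddCommGroup F] [NormedSpace ℝ F]
    {f : E → F} (hf : ContDiffAt ℝ ∞ f e) :
    ∃ C, 0 ≤ C ∧ ∀ᶠ e' in 𝓝 e, ‖f e'‖ ≤ C ∧ ∀ Z, ‖fderiv ℝ f e' Z‖ ≤ C * ‖Z‖ := by
  have h1 : ContinuousAt (fun e' => ‖f e'‖) e := hf.continuousAt.norm
  have h2 : ContinuousAt (fun e' => ‖fderiv ℝ f e'‖) e :=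
    (hf.fderiv_right (m := ∞) (by simp)).continuousAt.norm
  refine ⟨max (‖f e‖ + 1) (‖fderiv ℝ f e‖ + 1), le_max_of_le_left (by positivity), ?_⟩
  filter_upwards [h1.eventually (Iic_mem_nhds (lt_add_one _)),
    h2.eventually (Iic_mem_nhds (lt_add_one _))] with e' k1 k2
  refine ⟨(show _ ≤ _ from k1).trans (le_max_left _ _), fun Z => ?_⟩
  exact ((fderiv ℝ f e').le_opNorm Z).trans (by gcongr; exact (show _ ≤ _ from k2).trans (le_max_right _ _))

theorem fderiv_clm_apply_eq_zero {F F' : Type*} [NormedAddCommGroup F] [NormedSpace ℝ F]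
    [NormedAddCommGroup F'] [NormedSpace ℝ F'] {c : E → F →L[ℝ] F'} {V : E → F}
    (hc : DifferentiableAt ℝ c e) (hV : DifferentiableAt ℝ V e) (h0 : V e = 0)
    (h1 : fderiv ℝ V e = 0) : fderiv ℝ (fun e => c e (V e)) e = 0 := by
  rw [fderiv_clm_apply hc hV, h0, h1]
  simp

set_option synthInstance.maxHeartbeats 200000 in
set_option maxHeartbeats 400000 in
/-- Unique continuation of Killing fields. -/
theorem MetricOn.eventually_eq_zero_of_killing [FiniteDimensional ℝ E] (hG : MetricOn G O)
    (he : e ∈ O) {V : E → E} (hV : ContDiffOn ℝ ∞ V O)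
    (hkill : ∀ e ∈ O, ∀ X Y, lieDeriv V G e X Y = 0) (h0 : V e = 0) (h1 : fderiv ℝ V e = 0) :
    ∀ᶠ e' in 𝓝 e, V e' = 0 := by
  set α : E → E →L[ℝ] ℝ := fun e => G e (V e) with hα
  have hO := hG.isOpen.mem_nhds he
  have hαs : ContDiffOn ℝ ∞ α O := hG.smooth.clm_apply hV
  have hαs' : ContDiffOn ℝ ∞ (fderiv ℝ α) O := hαs.fderiv_of_isOpen hG.isOpen (by simp)
  have hαd : ∀ e ∈ O, DifferentiableAt ℝ α e := fun e he =>
    (hαs.contDiffAt (hG.isOpen.mem_nhds he)).differentiableAt (by simp)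
  have hαd' : ∀ e ∈ O, DifferentiableAt ℝ (fderiv ℝ α) e := fun e he =>
    (hαs'.contDiffAt (hG.isOpen.mem_nhds he)).differentiableAt (by simp)
  have hVd : ∀ e ∈ O, DifferentiableAt ℝ V e := fun e he =>
    (hV.contDiffAt (hG.isOpen.mem_nhds he)).differentiableAt (by simp)
  have hΓd : ∀ e ∈ O, DifferentiableAt ℝ (christoffel G) e := fun e he =>
    (hG.contDiffAt_christoffel he).differentiableAt (by simp)
  have hnabla : ∀ e ∈ O, ∀ X Y, fderiv ℝ α e X Y + fderiv ℝ α e Y X =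
      2 * α e (christoffel G e X Y) := by
    intro e he X Y
    have h := hkill e he X Y
    rw [hG.lieDeriv_eq he (hVd e he) (hαd e he) (Filter.Eventually.of_forall fun _ => rfl)] at h
    simp only [nabla, hG.christoffel_symm he Y X] at h
    linarith
  -- The derivative of Killing's equation for `α = V♭`. It prescribes the part of the second
  -- derivative symmetric in the last two slots by `α` and its first derivative; equality of mixed
  -- partials gives symmetry in the first two.
  have hQ : ∀ e ∈ O, ∀ Z X Y, fderiv ℝ (fderiv ℝ α) e Z X Y + fderiv ℝ (fderiv ℝ α) e Z Y X =
      2 * (fderiv ℝ α e Z (christoffel G e X Y)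
        + α e (fderiv ℝ (christoffel G) e Z X Y)) := by
    intro e he Z X Y
    have k1 := (hasDerivAt_line_apply₂ (hαd' e he) Z X Y).add
      (hasDerivAt_line_apply₂ (hαd' e he) Z Y X)
    have k2 := ((hasDerivAt_comp_line (hαd e he) Z).clm_apply
      (hasDerivAt_line_apply₂ (hΓd e he) Z X Y)).const_mul 2
    refine (k1.unique (k2.congr_of_eventuallyEq ?_)).trans (by simp)
    filter_upwards [(tendsto_line e Z).eventually (hG.isOpen.mem_nhds he)] with s hs
    exact hnabla _ hs X Y
  have hsym : ∀ e ∈ O, ∀ Z X Y, fderiv ℝ (fderiv ℝ α) e Z X Y = fderiv ℝ (fderiv ℝ α) e X Z Y := by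
    intro e he Z X Y
    have hs : IsSymmSndFDerivAt ℝ α e := (hαs.contDiffAt (hG.isOpen.mem_nhds he)).isSymmSndFDerivAt
      (by simpa using! WithTop.coe_le_coe.2 (le_top (a := (2 : ℕ∞))))
    rw [hs.eq Z X]
  obtain ⟨C, hC0, hC⟩ := eventually_norm_fderiv_apply_le (f := christoffel G) (hG.contDiffAt_christoffel he)
  have hfin : ∀ᶠ e' in 𝓝 e, (α e', fderiv ℝ α e') = 0 := by
    -- Killing's equation closes up at first order: the pair of `α` and its derivative controls its
    -- own derivative. The constant `1` bounds the first component; `6 C` is three terms of size `2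
    -- C` each for the second.
    refine eventually_eq_zero_of_norm_fderiv_le (η := fun e' => (α e', fderiv ℝ α e')) (C := max 1 (6 * C)) ?_ ?_ ?_
    · filter_upwards [hO] with e' he'
      exact (hαd e' he').prodMk (hαd' e' he')
    · filter_upwards [hO, hC] with e' he' ⟨hc₁, hc₂⟩
      have hη := norm_fst_le (α e', fderiv ℝ α e')
      have hη' := norm_snd_le (α e', fderiv ℝ α e')
      set M := ‖(α e', fderiv ℝ α e')‖
      have hM : 0 ≤ M := (norm_nonneg (α e')).trans hη
      have hbound : ∀ Z X Y, ‖fderiv ℝ α e' Z (christoffel G e' X Y)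
          + α e' (fderiv ℝ (christoffel G) e' Z X Y)‖ ≤ 2 * C * M * ‖Z‖ * ‖X‖ * ‖Y‖ := by
        intro Z X Y
        have b1 : ‖fderiv ℝ α e' Z (christoffel G e' X Y)‖ ≤ M * ‖Z‖ * (C * ‖X‖ * ‖Y‖) := by
          refine ((fderiv ℝ α e').le_opNorm₂ Z _).trans ?_
          gcongr
          exact ((christoffel G e').le_opNorm₂ X Y).trans (by gcongr)
        have b2 : ‖α e' (fderiv ℝ (christoffel G) e' Z X Y)‖ ≤ M * (C * ‖Z‖ * ‖X‖ * ‖Y‖) := by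
          refine ((α e').le_opNorm _).trans ?_
          gcongr
          exact ((fderiv ℝ (christoffel G) e' Z).le_opNorm₂ X Y).trans
            (by gcongr; exact hc₂ Z)
        calc _ ≤ _ := norm_add_le _ _
          _ ≤ _ := add_le_add b1 b2
          _ = _ := by ring
      have hsnd : ∀ Z, ‖fderiv ℝ (fderiv ℝ α) e' Z‖ ≤ 6 * C * M * ‖Z‖ := by
        intro Z
        refine ContinuousLinearMap.opNorm_le_bound _ (by positivity) fun X => ?_
        refine ContinuousLinearMap.opNorm_le_bound _ (by positivity) fun Y => ?_
        have q1 := hQ e' he' Z X Y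
        have q2 := hQ e' he' X Z Y
        have q3 := hQ e' he' Y Z X
        rw [hsym e' he' X Z Y] at q2
        rw [hsym e' he' Y Z X, hsym e' he' Y X Z] at q3
        -- The permutation argument that determines the Christoffel symbols: a trilinear form
        -- symmetric in two slots is recovered from its symmetrization in the other pair.
        have q : fderiv ℝ (fderiv ℝ α) e' Z X Y =
            (fderiv ℝ α e' Z (christoffel G e' X Y) + α e' (fderiv ℝ (christoffel G) e' Z X Y))
            + (fderiv ℝ α e' X (christoffel G e' Z Y) + α e' (fderiv ℝ (christoffel G) e' X Z Y))
            - (fderiv ℝ α e' Y (christoffel G e' Z X) + α e' (fderiv ℝ (christoffel G) e' Y Z X)) := by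
          linarith
        rw [q]
        refine (norm_sub_le _ _).trans ((add_le_add (norm_add_le _ _) le_rfl).trans ?_)
        have c1 := hbound Z X Y
        have c2 := hbound X Z Y
        have c3 := hbound Y Z X
        nlinarith [c1, c2, c3]
      rw [((hαd e' he').hasFDerivAt.prodMk (hαd' e' he').hasFDerivAt).fderiv]
      intro Z
      rw [ContinuousLinearMap.prod_apply, Prod.norm_mk, max_le_iff]
      constructor
      · refine ((fderiv ℝ α e').le_opNorm Z).trans ?_
        gcongr
        exact hη'.trans (le_mul_of_one_le_left hM (le_max_left _ _))
      · refine (hsnd Z).trans ?_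
        gcongr
        exact le_max_right _ _
    · have hz : α e = 0 := by simp [hα, h0]
      have hz' : fderiv ℝ α e = 0 :=
        fderiv_clm_apply_eq_zero (hG.differentiableAt he) (hVd e he) h0 h1
      rw [hz, hz']
      rfl
  filter_upwards [hfin, hO] with e' h' he'
  have hz : α e' = 0 := congrArg Prod.fst h'
  rw [← hG.inverse_apply he' (V e')]
  change (G e').inverse (α e') = 0
  rw [hz, map_zero]

end Coord

/-! ### Tensor fields in charts and changes of charts. -/

section Charts

variable {E : Type*} [NormedAddCommGroup E] [NormedSpace ℝ E]
  {H : Type*} [TopologicalSpace H] {I : ModelWithCorners ℝ E H}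
  {M : Type*} [TopologicalSpace M] [ChartedSpace H M]
  {x : M} {e : E}

/-- The tangent space at `x` is the model space, identified through the preferred chart at `x`. At
`x` the tensor operators are therefore literally their coordinate versions. -/
theorem chartDeriv_apply [IsManifold I 1 M] (X : TangentSpace I x) : chartDeriv I x X = X :=
  DFunLike.congr_fun (mfderiv_extChartAt_self (I := I) (x := x)) X

theorem ricciTensor_apply [IsManifold I 1 M] (g : Bilin I M) (x : M) (X Y : E) :
    ricciTensor g x X Y = Coord.ricci (g.inChart x) (extChartAt I x x) X Y :=
  congrArg₂ (Coord.ricci (g.inChart x) (extChartAt I x x)) (chartDeriv_apply X) (chartDeriv_apply Y)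

theorem covDeriv_apply [IsManifold I 1 M] (g : Bilin I M) (α : Form1 I M) (x : M) (X Y : E) :
    covDeriv g α x X Y = Coord.nabla (g.inChart x) (α.inChart x) (extChartAt I x x) X Y :=
  congrArg₂ (Coord.nabla (g.inChart x) (α.inChart x) (extChartAt I x x)) (chartDeriv_apply X)
    (chartDeriv_apply Y)

theorem extDerivForm_apply [IsManifold I 1 M] (α : Form1 I M) (x : M) (X Y : E) :
    extDerivForm α x X Y = Coord.extDeriv₁ (α.inChart x) (extChartAt I x x) X Y :=
  congrArg₂ (Coord.extDeriv₁ (α.inChart x) (extChartAt I x x)) (chartDeriv_apply X)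
    (chartDeriv_apply Y)

theorem lieDerivative_apply [IsManifold I 1 M] (V : VField I M) (T : Bilin I M) (x : M)
    (X Y : E) : lieDerivative V T x X Y =
      Coord.lieDeriv (V.inChart x) (T.inChart x) (extChartAt I x x) X Y :=
  congrArg₂ (Coord.lieDeriv (V.inChart x) (T.inChart x) (extChartAt I x x)) (chartDeriv_apply X)
    (chartDeriv_apply Y)

variable [I.Boundaryless]

theorem invChartDeriv_eq (x : M) (e : E) :
    invChartDeriv I x e = mfderivWithin 𝓘(ℝ, E) I (extChartAt I x).symm (range I) e := by
  rw [I.range_eq_univ, mfderivWithin_univ]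
  rfl

theorem invChartDeriv_self [IsManifold I 1 M] (x : M) (X : E) :
    invChartDeriv I x (extChartAt I x x) X = X := by
  rw [invChartDeriv_eq]
  exact DFunLike.congr_fun (mfderivWithin_range_extChartAt_symm (I := I) (x := x)) X

theorem isInvertible_invChartDeriv [IsManifold I 1 M] (he : e ∈ (extChartAt I x).target) :
    (invChartDeriv I x e).IsInvertible := by
  rw [invChartDeriv_eq]
  exact isInvertible_mfderivWithin_extChartAt_symm he

theorem mdifferentiableAt_extChartAt_symm [IsManifold I 1 M] (he : e ∈ (extChartAt I x).target) :
    MDifferentiableAt 𝓘(ℝ, E) I (extChartAt I x).symm e := by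
  have := mdifferentiableWithinAt_extChartAt_symm (I := I) he
  rwa [I.range_eq_univ, mdifferentiableWithinAt_univ] at this

theorem extChartAt_target_mem_nhds_self (x : M) :
    (extChartAt I x).target ∈ 𝓝 (extChartAt I x x) :=
  (isOpen_extChartAt_target x).mem_nhds (mem_extChartAt_target x)

section Values

variable [IsManifold I 1 M]

theorem Form1.inChart_self (α : Form1 I M) (x : M) (X : E) :
    α.inChart x (extChartAt I x x) X = α x X := by
  -- The base points agree only propositionally. With all fibres viewed as the model space, the
  -- equality can be substituted without transport; the other `key` statements of this kind serve
  -- the same purpose.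
  have key : ∀ y, y = x → ∀ X : E, (α y : E →L[ℝ] ℝ) X = (α x : E →L[ℝ] ℝ) X := by
    rintro _ rfl _; rfl
  change α _ (invChartDeriv I x (extChartAt I x x) X) = _
  rw [show invChartDeriv I x (extChartAt I x x) X = X from invChartDeriv_self x X]
  exact key _ (extChartAt_to_inv x) X

theorem Bilin.inChart_self (T : Bilin I M) (x : M) (X Y : E) :
    T.inChart x (extChartAt I x x) X Y = T x X Y := by
  have key : ∀ y, y = x → ∀ X Y : E, (T y : E →L[ℝ] E →L[ℝ] ℝ) X Y
      = (T x : E →L[ℝ] E →L[ℝ] ℝ) X Y := by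
    rintro _ rfl _ _; rfl
  change T _ (invChartDeriv I x (extChartAt I x x) X) (invChartDeriv I x (extChartAt I x x) Y) = _
  rw [show invChartDeriv I x (extChartAt I x x) X = X from invChartDeriv_self x X,
    show invChartDeriv I x (extChartAt I x x) Y = Y from invChartDeriv_self x Y]
  exact key _ (extChartAt_to_inv x) X Y

theorem invChartDeriv_inChart (V : VField I M) (he : e ∈ (extChartAt I x).target) :
    invChartDeriv I x e (V.inChart x e) = V ((extChartAt I x).symm e) := by
  obtain ⟨L, hL⟩ := isInvertible_invChartDeriv (I := I) he
  change invChartDeriv I x e ((invChartDeriv I x e).inverse _) = _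
  rw [← hL, ContinuousLinearMap.inverse_equiv]
  exact L.apply_symm_apply _

theorem VField.inChart_self (V : VField I M) (x : M) :
    V.inChart x (extChartAt I x x) = V x := by
  have key : ∀ y, y = x → (V y : E) = V x := by
    rintro _ rfl; rfl
  have h1 := invChartDeriv_inChart V (mem_extChartAt_target (I := I) x)
  rw [show invChartDeriv I x (extChartAt I x x) (V.inChart x (extChartAt I x x)) =
    V.inChart x (extChartAt I x x) from invChartDeriv_self x _] at h1
  exact h1.trans (key _ (extChartAt_to_inv x))

theorem Form1.inChart_apply_inChart (α : Form1 I M) (V : VField I M)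
    (he : e ∈ (extChartAt I x).target) :
    α.inChart x e (V.inChart x e) = α ((extChartAt I x).symm e) (V ((extChartAt I x).symm e)) := by
  rw [← invChartDeriv_inChart V he]
  rfl

theorem Bilin.inChart_apply_inChart (T : Bilin I M) (V : VField I M)
    (he : e ∈ (extChartAt I x).target) (Y : E) :
    T.inChart x e (V.inChart x e) Y =
      T ((extChartAt I x).symm e) (V ((extChartAt I x).symm e)) (invChartDeriv I x e Y) := by
  rw [← invChartDeriv_inChart V he]
  rfl

theorem dform_inChart {v : M → ℝ} (he : e ∈ (extChartAt I x).target)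
    (hv : MDifferentiableAt I 𝓘(ℝ, ℝ) v ((extChartAt I x).symm e)) :
    (dform I v).inChart x e = fderiv ℝ (v ∘ (extChartAt I x).symm) e := by
  rw [← mfderiv_eq_fderiv, mfderiv_comp e hv (mdifferentiableAt_extChartAt_symm he)]
  rfl

end Values

variable [IsManifold I ∞ M]

/-- The tangent map of the inverse chart applied to a constant field. Evaluating smooth sections on
these fields gives smoothness of their coordinate expressions. -/
theorem contMDiffOn_invChartDeriv [IsManifold I 1 M] (x : M) (X : E) :
    ContMDiffOn 𝓘(ℝ, E) I.tangent ∞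
      (fun e => (⟨(extChartAt I x).symm e, invChartDeriv I x e X⟩ : TangentBundle I M))
      (extChartAt I x).target := by
  have h1 := (contMDiffOn_extChartAt_symm (I := I) (n := ∞) x).contMDiffOn_tangentMapWithin
    (m := ∞) (by simp) (isOpen_extChartAt_target x).uniqueMDiffOn
  have h2 : ContMDiff 𝓘(ℝ, E) 𝓘(ℝ, E).tangent ∞
      (fun e => (⟨e, X⟩ : TangentBundle 𝓘(ℝ, E) E)) := by
    intro e
    exact contMDiffAt_vectorSpace_iff_contDiffAt.2 contDiffAt_const
  refine (h1.comp h2.contMDiffOn (s := (extChartAt I x).target) fun e he => he).congr ?_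
  intro e he
  simp only [Function.comp_apply, tangentMapWithin, invChartDeriv]
  rw [mfderivWithin_eq_mfderiv ((isOpen_extChartAt_target x).uniqueMDiffOn e he)
    (mdifferentiableAt_extChartAt_symm he)]
  rfl

omit [I.Boundaryless] in
theorem contDiffOn_comp_extChartAt_symm {v : M → ℝ} {U : Set M}
    (hv : ContMDiffOn I 𝓘(ℝ, ℝ) ∞ v U) (x : M) :
    ContDiffOn ℝ ∞ (v ∘ (extChartAt I x).symm)
      ((extChartAt I x).target ∩ (extChartAt I x).symm ⁻¹' U) := by
  rw [← contMDiffOn_iff_contDiffOn]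
  exact hv.comp ((contMDiffOn_extChartAt_symm x).mono inter_subset_left) fun e he => he.2

theorem SmoothForm1.contDiffOn_inChart [FiniteDimensional ℝ E] [IsManifold I 1 M] {α : Form1 I M}
    (hα : SmoothForm1 α) (x : M) : ContDiffOn ℝ ∞ (α.inChart x) (extChartAt I x).target := by
  refine contDiffOn_clm_apply.2 fun X => ?_
  rw [← contMDiffOn_iff_contDiffOn]
  have h1 := hα.contMDiffOn.comp (contMDiffOn_extChartAt_symm (I := I) (n := ∞) x)
    (t := univ) fun _ _ => mem_univ _
  intro e he
  have h2 := ((contMDiffOn_invChartDeriv (I := I) x X) e he)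
  have h3 := ContMDiffWithinAt.clm_bundle_apply (F₂ := ℝ) (E₂ := fun _ : M => ℝ)
    (b := (extChartAt I x).symm) (h1 e he) h2
  exact (contMDiffWithinAt_totalSpace.1 h3).2

theorem contDiffOn_inChart_of_contMDiff [FiniteDimensional ℝ E] [IsManifold I 1 M] {T : Bilin I M}
    (hT : ContMDiff I (I.prod 𝓘(ℝ, E →L[ℝ] E →L[ℝ] ℝ)) ∞ (fun x => TotalSpace.mk'
      (E →L[ℝ] E →L[ℝ] ℝ)
      (E := fun x : M => TangentSpace I x →L[ℝ] TangentSpace I x →L[ℝ] ℝ) x (T x))) (x : M) :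
    ContDiffOn ℝ ∞ (T.inChart x) (extChartAt I x).target := by
  refine contDiffOn_clm_apply.2 fun X => contDiffOn_clm_apply.2 fun Y => ?_
  rw [← contMDiffOn_iff_contDiffOn]
  have h1 := hT.contMDiffOn.comp (contMDiffOn_extChartAt_symm (I := I) (n := ∞) x)
    (t := univ) fun _ _ => mem_univ _
  intro e he
  have h2 := ((contMDiffOn_invChartDeriv (I := I) x X) e he)
  have h2' := ((contMDiffOn_invChartDeriv (I := I) x Y) e he)
  have h3 := ContMDiffWithinAt.clm_bundle_apply₂ (F₃ := ℝ) (E₃ := fun _ : M => ℝ)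
    (b := (extChartAt I x).symm) (h1 e he) h2 h2'
  exact (contMDiffWithinAt_totalSpace.1 h3).2

theorem SmoothVField.contDiffOn_inChart [CompleteSpace E] [IsManifold I 1 M] {V : VField I M}
    (hV : SmoothVField V) (x : M) : ContDiffOn ℝ ∞ (V.inChart x) (extChartAt I x).target := by
  intro e he
  refine ContDiffAt.contDiffWithinAt ?_
  have hat : ContMDiffAt 𝓘(ℝ, E) I ∞ (extChartAt I x).symm e :=
    (contMDiffOn_extChartAt_symm (I := I) (n := ∞) x).contMDiffAt
      ((isOpen_extChartAt_target x).mem_nhds he)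
  have hinv : (mfderiv 𝓘(ℝ, E) I (extChartAt I x).symm e).IsInvertible :=
    isInvertible_invChartDeriv (I := I) he
  have := ContMDiffAt.mpullback_vectorField_preimage (m := ∞) (n := ∞) (hV _) hat hinv (by simp)
  exact (contMDiffAt_vectorSpace_iff_contDiffAt (V := V.inChart x)).1 this

/-- The coordinate change from the chart at `x` to the chart at `y`. -/
theorem contDiffAt_coordChange {y : M} (he : e ∈ (extChartAt I x).target)
    (hy : (extChartAt I x).symm e ∈ (extChartAt I y).source) :
    ContDiffAt ℝ ∞ (extChartAt I y ∘ (extChartAt I x).symm) e := by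
  rw [← contMDiffAt_iff_contDiffAt]
  exact (contMDiffAt_extChartAt' (by rwa [extChartAt_source] at hy)).comp e
    ((contMDiffOn_extChartAt_symm x).contMDiffAt ((isOpen_extChartAt_target x).mem_nhds he))

omit [IsManifold I ∞ M] in
theorem eventually_mem_coordChange {y : M}
    (he : e ∈ (extChartAt I x).target)
    (hy : (extChartAt I x).symm e ∈ (extChartAt I y).source) :
    ∀ᶠ e' in 𝓝 e, e' ∈ (extChartAt I x).target ∧
      (extChartAt I x).symm e' ∈ (extChartAt I y).source := by
  have h1 : ContinuousAt (extChartAt I x).symm e := continuousAt_extChartAt_symm'' he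
  exact ((isOpen_extChartAt_target x).eventually_mem he).and
    (h1.eventually ((isOpen_extChartAt_source y).eventually_mem hy))

/-- The chain rule for the inverse chart at `y` composed with the coordinate change, which is
locally the inverse chart at `x`. The transformation laws of forms, bilinear forms and vector fields
follow from it. -/
theorem invChartDeriv_coordChange [IsManifold I 1 M] {y : M}
    (he : e ∈ (extChartAt I x).target)
    (hy : (extChartAt I x).symm e ∈ (extChartAt I y).source) (X : E) :
    (invChartDeriv I y ((extChartAt I y ∘ (extChartAt I x).symm) e)
      (fderiv ℝ (extChartAt I y ∘ (extChartAt I x).symm) e X) : E) =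
      (invChartDeriv I x e X : E) := by
  have hd := (contDiffAt_coordChange (I := I) he hy).differentiableAt (by simp)
  have h1 : mfderiv 𝓘(ℝ, E) I ((extChartAt I y).symm ∘ (extChartAt I y ∘ (extChartAt I x).symm)) e
      = (mfderiv 𝓘(ℝ, E) I (extChartAt I y).symm ((extChartAt I y ∘ (extChartAt I x).symm) e)).comp
        (mfderiv 𝓘(ℝ, E) 𝓘(ℝ, E) (extChartAt I y ∘ (extChartAt I x).symm) e) :=
    mfderiv_comp e (mdifferentiableAt_extChartAt_symm ((extChartAt I y).map_source hy))
      hd.mdifferentiableAt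
  have h2 : (extChartAt I y).symm ∘ (extChartAt I y ∘ (extChartAt I x).symm) =ᶠ[𝓝 e]
      (extChartAt I x).symm := by
    filter_upwards [eventually_mem_coordChange (I := I) he hy] with e' he'
    exact (extChartAt I y).left_inv he'.2
  rw [h2.mfderiv_eq, mfderiv_eq_fderiv] at h1
  exact (DFunLike.congr_fun h1 X).symm

theorem Form1.inChart_coordChange [IsManifold I 1 M] (α : Form1 I M) {y : M}
    (he : e ∈ (extChartAt I x).target)
    (hy : (extChartAt I x).symm e ∈ (extChartAt I y).source) :
    α.inChart x e = (α.inChart y ((extChartAt I y ∘ (extChartAt I x).symm) e)).comp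
      (fderiv ℝ (extChartAt I y ∘ (extChartAt I x).symm) e) := by
  have key : ∀ z, z = (extChartAt I x).symm e → ∀ X : E, (α z : E →L[ℝ] ℝ) X =
      (α ((extChartAt I x).symm e) : E →L[ℝ] ℝ) X := by
    rintro _ rfl _; rfl
  ext X
  exact (congrArg (α ((extChartAt I x).symm e) : E →L[ℝ] ℝ)
    (invChartDeriv_coordChange he hy X)).symm.trans
    (key _ ((extChartAt I y).left_inv hy) _).symm

theorem Bilin.inChart_coordChange [IsManifold I 1 M] (T : Bilin I M) {y : M}
    (he : e ∈ (extChartAt I x).target)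
    (hy : (extChartAt I x).symm e ∈ (extChartAt I y).source) :
    T.inChart x e = pullBilin (T.inChart y ((extChartAt I y ∘ (extChartAt I x).symm) e))
      (fderiv ℝ (extChartAt I y ∘ (extChartAt I x).symm) e) := by
  have key : ∀ z, z = (extChartAt I x).symm e → ∀ X Y : E, (T z : E →L[ℝ] E →L[ℝ] ℝ) X Y =
      (T ((extChartAt I x).symm e) : E →L[ℝ] E →L[ℝ] ℝ) X Y := by
    rintro _ rfl _ _; rfl
  ext X Y
  exact (congrArg₂ (fun X Y => (T ((extChartAt I x).symm e) : E →L[ℝ] E →L[ℝ] ℝ) X Y)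
    (invChartDeriv_coordChange he hy X) (invChartDeriv_coordChange he hy Y)).symm.trans
    (key _ ((extChartAt I y).left_inv hy) _ _).symm

theorem VField.inChart_coordChange [IsManifold I 1 M] (V : VField I M) {y : M}
    (he : e ∈ (extChartAt I x).target)
    (hy : (extChartAt I x).symm e ∈ (extChartAt I y).source) :
    fderiv ℝ (extChartAt I y ∘ (extChartAt I x).symm) e (V.inChart x e) =
      V.inChart y ((extChartAt I y ∘ (extChartAt I x).symm) e) := by
  have key : ∀ z, z = (extChartAt I x).symm e → (V z : E) =
      (V ((extChartAt I x).symm e) : E) := by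
    rintro _ rfl; rfl
  have hy' := (extChartAt I y).map_source hy
  have hinj : Function.Injective
      (invChartDeriv I y ((extChartAt I y ∘ (extChartAt I x).symm) e)) := by
    obtain ⟨L, hL⟩ := isInvertible_invChartDeriv (I := I) hy'
    rw [Function.comp_apply, ← hL]
    exact L.injective
  apply hinj
  have h1 := invChartDeriv_inChart V he
  have h2 := invChartDeriv_inChart V hy'
  exact (invChartDeriv_coordChange he hy _).trans
    (h1.trans ((key _ ((extChartAt I y).left_inv hy)).symm.trans h2.symm))

end Charts

/-! ### Locality of the coordinate operators. -/

namespace Coord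

variable {E : Type*} [NormedAddCommGroup E] [NormedSpace ℝ E]
  {G G' : E → E →L[ℝ] E →L[ℝ] ℝ} {e : E}

theorem christoffel_congr (h : G =ᶠ[𝓝 e] G') : christoffel G e = christoffel G' e := by
  rw [christoffel, christoffel, h.fderiv_eq, raise, raise, raise, raise, raise, raise, h.eq_of_nhds]

theorem ricci_congr (h : G =ᶠ[𝓝 e] G') (Y Z : E) : ricci G e Y Z = ricci G' e Y Z := by
  have h1 : christoffel G =ᶠ[𝓝 e] christoffel G' :=
    h.eventuallyEq_nhds.mono fun _ h => christoffel_congr h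
  rw [ricci, ricci, curvature, curvature, h1.fderiv_eq, h1.eq_of_nhds]

theorem lieDeriv_congr {V V' : E → E} (h : G =ᶠ[𝓝 e] G') (hV : V =ᶠ[𝓝 e] V') (X Y : E) :
    lieDeriv V G e X Y = lieDeriv V' G' e X Y := by
  rw [lieDeriv, lieDeriv, h.fderiv_eq, hV.fderiv_eq, h.eq_of_nhds, hV.eq_of_nhds]

end Coord

/-! ### The Gibbons–Hawking metric and the soliton tensor on `N × ℝ`. -/

section GibbonsHawking

variable {N : Type*} [TopologicalSpace N] [ChartedSpace E3 N] [IsManifold (𝓡 3) ∞ N]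
  {h : Bilin (𝓡 3) N} {u : N → ℝ} {A : Form1 (𝓡 3) N} {f : N × ℝ → ℝ} {F : VField (𝓡 3) N}
  {x : N} {t : ℝ} {q : E3 × ℝ}

omit [IsManifold (𝓡 3) ∞ N] in
theorem extChartAt_I4_symm_apply (x : N) (t : ℝ) (q : E3 × ℝ) :
    (extChartAt I4 (x, t)).symm q = ((extChartAt (𝓡 3) x).symm q.1, q.2) := by
  rw [extChartAt_prod, extChartAt_model_space_eq_id]
  rfl

omit [IsManifold (𝓡 3) ∞ N] in
theorem extChartAt_I4_self (x : N) (t : ℝ) :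
    extChartAt I4 (x, t) (x, t) = (extChartAt (𝓡 3) x x, t) := by
  rw [extChartAt_prod, extChartAt_model_space_eq_id]
  rfl

omit [IsManifold (𝓡 3) ∞ N] in
theorem mem_extChartAt_I4_target (hq : q.1 ∈ (extChartAt (𝓡 3) x).target) :
    q ∈ (extChartAt I4 (x, t)).target := by
  rw [extChartAt_prod, extChartAt_model_space_eq_id]
  exact ⟨hq, mem_univ _⟩

theorem invChartDeriv_I4 (hq : q.1 ∈ (extChartAt (𝓡 3) x).target) (X : E3 × ℝ) :
    (invChartDeriv I4 (x, t) q X : E3 × ℝ) = (invChartDeriv (𝓡 3) x q.1 X.1, X.2) := by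
  have h1 : HasMFDerivAt 𝓘(ℝ, E3 × ℝ) 𝓘(ℝ, E3) (Prod.fst : E3 × ℝ → E3) q
      (ContinuousLinearMap.fst ℝ E3 ℝ) := hasFDerivAt_fst.hasMFDerivAt
  have h2 : HasMFDerivAt 𝓘(ℝ, E3 × ℝ) 𝓘(ℝ, ℝ) (Prod.snd : E3 × ℝ → ℝ) q
      (ContinuousLinearMap.snd ℝ E3 ℝ) := hasFDerivAt_snd.hasMFDerivAt
  have h3 := (mdifferentiableAt_extChartAt_symm (I := 𝓡 3) hq).hasMFDerivAt
  have h4 : HasMFDerivAt 𝓘(ℝ, E3 × ℝ) I4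
      (fun q : E3 × ℝ => ((extChartAt (𝓡 3) x).symm q.1, q.2)) q _ := (h3.comp q h1).prodMk h2
  have h5 : ((extChartAt I4 (x, t)).symm : E3 × ℝ → N × ℝ) =
      fun q : E3 × ℝ => ((extChartAt (𝓡 3) x).symm q.1, q.2) :=
    funext (extChartAt_I4_symm_apply x t)
  rw [← h5] at h4
  rw [invChartDeriv, h4.mfderiv]
  rfl

omit [IsManifold (𝓡 3) ∞ N] in
theorem dproj_apply (p : N × ℝ) (X : E3 × ℝ) : (dproj p X : E3) = X.1 := by
  rw [dproj, mfderiv_fst]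
  rfl

omit [IsManifold (𝓡 3) ∞ N] in
theorem theta_apply (A : Form1 (𝓡 3) N) (p : N × ℝ) (X : E3 × ℝ) :
    theta A p X = X.2 + A p.1 X.1 := by
  have h1 : dform I4 (Prod.snd : N × ℝ → ℝ) p X = X.2 := by
    rw [dform, mvfderiv, mfderiv_snd]
    rfl
  have h2 : A p.1 (dproj p X) = A p.1 X.1 := congrArg (A p.1 : E3 →L[ℝ] ℝ) (dproj_apply p X)
  rw [← h1, ← h2]
  rfl

omit [IsManifold (𝓡 3) ∞ N] in
theorem ghMetric_apply (h : Bilin (𝓡 3) N) (u : N → ℝ) (A : Form1 (𝓡 3) N) (p : N × ℝ)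
    (X Y : E3 × ℝ) : ghMetric h u A p X Y = u p.1 * h p.1 X.1 Y.1
      + (u p.1)⁻¹ * ((X.2 + A p.1 X.1) * (Y.2 + A p.1 Y.1)) := by
  rw [← theta_apply, ← theta_apply]
  have h2 : h p.1 (dproj p X) (dproj p Y) = h p.1 X.1 Y.1 :=
    congrArg₂ (fun X Y => (h p.1 : E3 →L[ℝ] E3 →L[ℝ] ℝ) X Y) (dproj_apply p X) (dproj_apply p Y)
  rw [← h2]
  rfl

theorem ghMetric_inChart (hq : q.1 ∈ (extChartAt (𝓡 3) x).target) :
    (ghMetric h u A).inChart (x, t) q =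
      Coord.gh (h.inChart x) (u ∘ (extChartAt (𝓡 3) x).symm) (A.inChart x) q := by
  have key : ∀ p, p = ((extChartAt (𝓡 3) x).symm q.1, q.2) → ∀ X Y : E3 × ℝ,
      (ghMetric h u A p : E3 × ℝ →L[ℝ] E3 × ℝ →L[ℝ] ℝ) X Y =
      (ghMetric h u A ((extChartAt (𝓡 3) x).symm q.1, q.2) : E3 × ℝ →L[ℝ] E3 × ℝ →L[ℝ] ℝ) X Y := by
    rintro _ rfl _ _; rfl
  refine ContinuousLinearMap.ext fun X => ContinuousLinearMap.ext fun Y => ?_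
  refine (congrArg₂ (fun X Y => (ghMetric h u A ((extChartAt I4 (x, t)).symm q) :
    E3 × ℝ →L[ℝ] E3 × ℝ →L[ℝ] ℝ) X Y) (invChartDeriv_I4 hq X) (invChartDeriv_I4 hq Y)).trans ?_
  refine (key _ (extChartAt_I4_symm_apply x t q) _ _).trans ?_
  exact ghMetric_apply _ _ _ _ _ _

theorem flowField_inChart (hq : q.1 ∈ (extChartAt (𝓡 3) x).target) :
    (flowField A f F).inChart (x, t) q =
      Coord.ghField (A.inChart x) (f ∘ (extChartAt I4 (x, t)).symm) (F.inChart x) q := by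
  have hq' := mem_extChartAt_I4_target (t := t) hq
  have key : ∀ p, p = ((extChartAt (𝓡 3) x).symm q.1, q.2) → (flowField A f F p : E3 × ℝ) =
      flowField A f F ((extChartAt (𝓡 3) x).symm q.1, q.2) := by
    rintro _ rfl; rfl
  have hinj : Function.Injective (invChartDeriv I4 (x, t) q) := by
    obtain ⟨L, hL⟩ := isInvertible_invChartDeriv (I := I4) hq'
    rw [← hL]
    exact L.injective
  apply hinj
  refine (invChartDeriv_inChart _ hq').trans ((key _ (extChartAt_I4_symm_apply x t q)).trans ?_)
  refine Eq.trans ?_ (invChartDeriv_I4 hq _).symm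
  have h1 := invChartDeriv_inChart F hq
  have h2 := A.inChart_apply_inChart F hq
  rw [Coord.ghField, h2, Function.comp_apply, extChartAt_I4_symm_apply]
  refine Prod.ext ?_ ?_
  · have hlin : ∀ (r s : ℝ) (v w : E3) (L : E3 →L[ℝ] E3), L w = v → r • (0 : E3) + s • v =
        L (s • w) := by
      rintro r s _ w L rfl
      rw [map_smul, smul_zero, zero_add]
    exact hlin _ _ _ _ _ h1
  · change f _ • (1 : ℝ) + q.2 • (-(A _ (F ((extChartAt (𝓡 3) x).symm q.1)))) = _
    simp only [smul_eq_mul]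
    ring

/-- The soliton tensor of a Gibbons--Hawking metric. -/
theorem solitonTensor_ghMetric {O : Set E3}
    {b : Module.Basis (Fin 3) ℝ E3} {ν : E3 → ℝ}
    (hd : Coord.GHData (h.inChart x) (u ∘ (extChartAt (𝓡 3) x).symm) (A.inChart x) O)
    (hx : extChartAt (𝓡 3) x x ∈ O)
    (hm : Coord.MonopoleGerm (h.inChart x) (u ∘ (extChartAt (𝓡 3) x).symm) (A.inChart x)
      (extChartAt (𝓡 3) x x) b ν)
    (hu : MDifferentiableAt (𝓡 3) 𝓘(ℝ, ℝ) u x) (hf : MDifferentiableAt I4 𝓘(ℝ, ℝ) f (x, t))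
    (hF : DifferentiableAt ℝ (F.inChart x) (extChartAt (𝓡 3) x x)) (a : ℝ) (X Y : E3 × ℝ) :
    solitonTensor (ghMetric h u A) a (flowField A f F) (x, t) X Y =
      ricciTensor h x X.1 Y.1 + a * (u x * h x X.1 Y.1
        + (u x)⁻¹ * ((X.2 + A x X.1) * (Y.2 + A x Y.1)))
      + 1 / 2 * ((u x)⁻¹ * (dform I4 f (x, t) X * (Y.2 + A x Y.1)
          + dform I4 f (x, t) Y * (X.2 + A x X.1))
        + u x * (X.2 * h x (F x) Y.1 + Y.2 * h x (F x) X.1)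
        + t * (dform (𝓡 3) u x (F x) * h x X.1 Y.1 + u x * lieDerivative F h x X.1 Y.1
          - (u x)⁻¹ ^ 2 * dform (𝓡 3) u x (F x) * ((X.2 + A x X.1) * (Y.2 + A x Y.1))
          + (u x)⁻¹ * ((X.2 + A x X.1) * extDerivForm A x (F x) Y.1
            + (Y.2 + A x Y.1) * extDerivForm A x (F x) X.1))) := by
  have hT := extChartAt_target_mem_nhds_self (I := 𝓡 3) x
  have hev : ∀ᶠ q in 𝓝 (extChartAt (𝓡 3) x x, t), q.1 ∈ (extChartAt (𝓡 3) x).target :=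
    continuousAt_fst.eventually hT
  have hg : (ghMetric h u A).inChart (x, t) =ᶠ[𝓝 (extChartAt (𝓡 3) x x, t)]
      Coord.gh (h.inChart x) (u ∘ (extChartAt (𝓡 3) x).symm) (A.inChart x) :=
    hev.mono fun q hq => ghMetric_inChart hq
  have hE : (flowField A f F).inChart (x, t) =ᶠ[𝓝 (extChartAt (𝓡 3) x x, t)]
      Coord.ghField (A.inChart x) (f ∘ (extChartAt I4 (x, t)).symm) (F.inChart x) :=
    hev.mono fun q hq => flowField_inChart hq
  have hft : MDifferentiableAt I4 𝓘(ℝ, ℝ) f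
      ((extChartAt I4 (x, t)).symm (extChartAt I4 (x, t) (x, t))) := by
    rwa [extChartAt_to_inv]
  have hut : MDifferentiableAt (𝓡 3) 𝓘(ℝ, ℝ) u
      ((extChartAt (𝓡 3) x).symm (extChartAt (𝓡 3) x x)) := by
    rwa [extChartAt_to_inv]
  have hfd : DifferentiableAt ℝ (f ∘ (extChartAt I4 (x, t)).symm) (extChartAt (𝓡 3) x x, t) := by
    rw [← extChartAt_I4_self]
    exact (hft.comp _ (mdifferentiableAt_extChartAt_symm
      (mem_extChartAt_target _))).differentiableAt
  have hdf : ∀ X : E3 × ℝ, fderiv ℝ (f ∘ (extChartAt I4 (x, t)).symm)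
      (extChartAt (𝓡 3) x x, t) X = dform I4 f (x, t) X := by
    intro X
    rw [← extChartAt_I4_self, ← dform_inChart (mem_extChartAt_target _) hft]
    exact Form1.inChart_self _ _ _
  have hdu : ∀ X : E3, fderiv ℝ (u ∘ (extChartAt (𝓡 3) x).symm) (extChartAt (𝓡 3) x x) X =
      dform (𝓡 3) u x X := by
    intro X
    rw [← dform_inChart (mem_extChartAt_target _) hut]
    exact Form1.inChart_self _ _ _
  have hgx : ghMetric h u A (x, t) X Y = u x * h x X.1 Y.1
      + (u x)⁻¹ * ((X.2 + A x X.1) * (Y.2 + A x Y.1)) := ghMetric_apply _ _ _ _ _ _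
  have hF0 : F.inChart x (extChartAt (𝓡 3) x x) = F x := F.inChart_self x
  have hux : (u ∘ (extChartAt (𝓡 3) x).symm) (extChartAt (𝓡 3) x x) = u x := by simp
  have hA0 : ∀ X : E3, A.inChart x (extChartAt (𝓡 3) x x) X = A x X := A.inChart_self x
  have hh0 : ∀ X Y : E3, h.inChart x (extChartAt (𝓡 3) x x) X Y = h x X Y := h.inChart_self x
  have r1 : ricciTensor (ghMetric h u A) (x, t) X Y = ricciTensor h x X.1 Y.1 := by
    refine (ricciTensor_apply _ _ _ _).trans (Eq.trans ?_ (ricciTensor_apply _ _ _ _).symm)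
    rw [extChartAt_I4_self, Coord.ricci_congr hg]
    exact hd.ricci_gh_of_monopole (p := (extChartAt (𝓡 3) x x, t)) hx hm X Y
  have r2 : lieDerivative (flowField A f F) (ghMetric h u A) (x, t) X Y =
      Coord.lieDeriv (Coord.ghField (A.inChart x) (f ∘ (extChartAt I4 (x, t)).symm) (F.inChart x))
        (Coord.gh (h.inChart x) (u ∘ (extChartAt (𝓡 3) x).symm) (A.inChart x))
        (extChartAt (𝓡 3) x x, t) X Y := by
    refine (lieDerivative_apply _ _ _ _ _).trans ?_
    rw [extChartAt_I4_self, Coord.lieDeriv_congr hg hE]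
  have r3 : lieDerivative F h x X.1 Y.1 =
      Coord.lieDeriv (F.inChart x) (h.inChart x) (extChartAt (𝓡 3) x x) X.1 Y.1 :=
    lieDerivative_apply _ _ _ _ _
  have r4 : ∀ Z : E3, extDerivForm A x (F x) Z =
      Coord.extDeriv₁ (A.inChart x) (extChartAt (𝓡 3) x x) (F x) Z := extDerivForm_apply _ _ _
  unfold solitonTensor
  rw [r1, r2, r3, r4, r4, hgx,
    hd.lieDeriv_gh (p := (extChartAt (𝓡 3) x x, t)) hx hfd hF X Y]
  have hduF := hdu (F x)
  have hhF := fun Y => hh0 (F x) Y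
  simp only [Coord.ghForm_apply, hF0, hux, hA0, hh0, hdf, hduF, hhF]

end GibbonsHawking

/-! ### Oriented orthonormal bases and the Hodge star as a determinant. -/

section LinearAlgebra

variable {V : Type*} [NormedAddCommGroup V] [NormedSpace ℝ V]

theorem exists_orthonormal_basis [FiniteDimensional ℝ V] (hV : Module.finrank ℝ V = 3)
    {g : V →L[ℝ] V →L[ℝ] ℝ} (hs : ∀ X Y, g X Y = g Y X) (hp : ∀ X, X ≠ 0 → 0 < g X X) :
    ∃ b : Module.Basis (Fin 3) ℝ V, ∀ i j, g (b i) (b j) = if i = j then 1 else 0 := by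
  let B : LinearMap.BilinForm ℝ V := (ContinuousLinearMap.coeLM ℝ).comp (g : V →ₗ[ℝ] V →L[ℝ] ℝ)
  have hB : ∀ X Y, B X Y = g X Y := fun _ _ => rfl
  obtain ⟨v, hv⟩ := LinearMap.BilinForm.exists_orthogonal_basis (B := B) ⟨fun X Y => hs X Y⟩
  have hpos : ∀ i, 0 < Real.sqrt (g (v i) (v i)) := fun i => Real.sqrt_pos.2 (hp _ (v.ne_zero i))
  let w := v.unitsSMul fun i => Units.mk0 (Real.sqrt (g (v i) (v i)))⁻¹ (inv_pos.2 (hpos i)).ne'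
  refine ⟨w.reindex (finCongr hV), fun i j => ?_⟩
  obtain ⟨i, rfl⟩ := (finCongr hV).surjective i
  obtain ⟨j, rfl⟩ := (finCongr hV).surjective j
  simp only [Module.Basis.reindex_apply, Equiv.symm_apply_apply, (finCongr hV).injective.eq_iff]
  simp only [w, Module.Basis.unitsSMul_apply, Units.smul_mk0, map_smul, smul_apply, smul_eq_mul]
  split_ifs with hij
  · subst hij
    have h1 := Real.mul_self_sqrt (hp _ (v.ne_zero i)).le
    have h2 := (hpos i).ne'
    field_simp
    linarith
  · have : g (v i) (v j) = 0 := hv hij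
    rw [this, mul_zero, mul_zero]

theorem exists_oriented_orthonormal_basis [FiniteDimensional ℝ V] (hV : Module.finrank ℝ V = 3)
    {g : V →L[ℝ] V →L[ℝ] ℝ} (hs : ∀ X Y, g X Y = g Y X) (hp : ∀ X, X ≠ 0 → 0 < g X X)
    {vol : V [⋀^Fin 3]→L[ℝ] ℝ}
    (hvol : ∀ X : Fin 3 → V, (vol X) ^ 2 = (Matrix.of fun i j => g (X i) (X j)).det) :
    ∃ b : Module.Basis (Fin 3) ℝ V, (∀ i j, g (b i) (b j) = if i = j then 1 else 0) ∧
      vol b = 1 := by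
  obtain ⟨b, hb⟩ := exists_orthonormal_basis hV hs hp
  have h1 : vol b ^ 2 = 1 := by
    rw [hvol]
    convert! Matrix.det_one (n := Fin 3) (R := ℝ) using 2
    ext i j
    simp [hb, Matrix.one_apply]
  rcases (sq_eq_sq_iff_eq_or_eq_neg (b := (1 : ℝ))).1 (by rw [h1, one_pow]) with h | h
  · exact ⟨b, hb, h⟩
  -- An orthonormal basis has volume `±1`; exchanging two vectors corrects the sign.
  · refine ⟨b.reindex (Equiv.swap 0 1), fun i j => ?_, ?_⟩
    · simp [hb]
    · have := vol.toAlternatingMap.map_swap b (show (0 : Fin 3) ≠ 1 by decide)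
      simp only [Module.Basis.coe_reindex, Equiv.symm_swap]
      refine this.trans ?_
      change -vol b = 1
      rw [h, neg_neg]

theorem map_cyclic (vol : V [⋀^Fin 3]→L[ℝ] ℝ) (X Y Z : V) : vol ![Y, Z, X] = vol ![X, Y, Z] := by
  have h := vol.toAlternatingMap.map_perm ![X, Y, Z] (finRotate 3)
  rw [show Equiv.Perm.sign (finRotate 3) = 1 by decide, one_smul] at h
  refine Eq.trans ?_ h
  change vol _ = vol _
  congr 1
  ext i
  fin_cases i <;> rfl

/-- This is `α ∧ y♭ ∧ z♭ = β(y, z) vol` for `β = *α`. On the orthonormal basis it is the cofactor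
expansion, and both sides change by the determinant of the change of basis. It transfers the star,
defined by orthonormal frames, to a fixed basis that need not be orthonormal. -/
theorem det_eq_mul_of_orthonormal {g : V →L[ℝ] V →L[ℝ] ℝ}
    (c : Module.Basis (Fin 3) ℝ V) (hc : ∀ i j, g (c i) (c j) = if i = j then 1 else 0)
    {vol : V [⋀^Fin 3]→L[ℝ] ℝ} (hvol : vol c = 1) (α : V →L[ℝ] ℝ) (β : V →L[ℝ] V →L[ℝ] ℝ)
    (hβ : ∀ y, β y y = 0) (h01 : β (c 0) (c 1) = α (c 2)) (h12 : β (c 1) (c 2) = α (c 0))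
    (h20 : β (c 2) (c 0) = α (c 1)) (B : Fin 3 → V) (y z : V) :
    β y z * vol B = (Matrix.of ![fun j => α (B j), fun j => g y (B j), fun j => g z (B j)]).det := by
  have hP : (Matrix.of ![fun j => α (B j), fun j => g y (B j), fun j => g z (B j)]) =
      (Matrix.of ![fun j => α (c j), fun j => g y (c j), fun j => g z (c j)]) * c.toMatrix B := by
    have key : ∀ (f : V →L[ℝ] ℝ) j, f (B j) = ∑ k, f (c k) * c.toMatrix B k j := by
      intro f j
      conv_lhs => rw [← c.sum_repr (B j)]
      simp only [map_sum, map_smul, smul_eq_mul, Module.Basis.toMatrix_apply, mul_comm]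
    ext i j
    fin_cases i
    · exact key α j
    · exact key (g y) j
    · exact key (g z) j
  have hv : vol B = (c.toMatrix B).det := by
    have := congrArg (fun f => f B) (vol.toAlternatingMap.eq_smul_basis_det c)
    refine this.trans ?_
    change vol c * c.det B = _
    rw [hvol, one_mul, Module.Basis.det_apply]
  have hanti : ∀ y z, β y z = -β z y := by
    intro y z
    have := hβ (y + z)
    simp only [map_add, add_apply, hβ, zero_add, add_zero] at this
    linarith
  have hy := Coord.eq_sum_of_orthonormal c hc y
  have hz := Coord.eq_sum_of_orthonormal c hc z
  have hyz : β y z = (Matrix.of ![fun j => α (c j), fun j => g y (c j), fun j => g z (c j)]).det := by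
    conv_lhs => rw [hy, hz]
    simp only [map_add, map_smul, add_apply, smul_apply, smul_eq_mul, hβ, hanti (c 1) (c 0),
      hanti (c 2) (c 1), hanti (c 0) (c 2), h01, h12, h20]
    rw [Matrix.det_fin_three]
    simp
    ring
  rw [hP, Matrix.det_mul, hyz, hv]

end LinearAlgebra

/-! ### The monopole equation in a chart. -/

section Monopole

variable {N : Type*} [TopologicalSpace N] [ChartedSpace E3 N] [IsManifold (𝓡 3) ∞ N]
  {x : N} {e : E3}

/-- By definition `dα` at a point is computed in the preferred chart there. Naturality under
coordinate changes allows a single chart to be used in a whole neighbourhood, as differentiating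
`dα` requires. -/
theorem SmoothForm1.extDerivForm_invChartDeriv {α : Form1 (𝓡 3) N} (hα : SmoothForm1 α)
    (he : e ∈ (extChartAt (𝓡 3) x).target) (X Y : E3) :
    extDerivForm α ((extChartAt (𝓡 3) x).symm e) (invChartDeriv (𝓡 3) x e X)
      (invChartDeriv (𝓡 3) x e Y) = Coord.extDeriv₁ (α.inChart x) e X Y := by
  have hy := mem_extChartAt_source (I := 𝓡 3) ((extChartAt (𝓡 3) x).symm e)
  have hd : ∀ X : E3, (fderiv ℝ (extChartAt (𝓡 3) ((extChartAt (𝓡 3) x).symm e) ∘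
      (extChartAt (𝓡 3) x).symm) e X : E3) = invChartDeriv (𝓡 3) x e X := fun X =>
    (invChartDeriv_self _ _).symm.trans (invChartDeriv_coordChange he hy X)
  refine (extDerivForm_apply _ _ _ _).trans ?_
  rw [Coord.extDeriv₁_pullback (contDiffAt_coordChange he hy)
    (((hα.contDiffOn_inChart x).contDiffAt ((isOpen_extChartAt_target x).mem_nhds he)).differentiableAt
      (by simp))
    (((hα.contDiffOn_inChart _).contDiffAt (extChartAt_target_mem_nhds_self _)).differentiableAt
      (by simp))
    ((eventually_mem_coordChange he hy).mono fun e' h => α.inChart_coordChange h.1 h.2),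
    hd, hd]
  rfl

theorem metricOn_inChart (h : ContMDiffRiemannianMetric (𝓡 3) ∞ E3
    (fun x : N => TangentSpace (𝓡 3) x)) (x : N) :
    Coord.MetricOn (Bilin.inChart h.inner x) (extChartAt (𝓡 3) x).target where
  isOpen := isOpen_extChartAt_target x
  smooth := contDiffOn_inChart_of_contMDiff h.contMDiff x
  symm e _ X Y := h.symm _ _ _
  pos e he X hX := by
    refine h.pos _ _ fun h0 => hX ?_
    obtain ⟨L, hL⟩ := isInvertible_invChartDeriv (I := 𝓡 3) he
    rw [← hL] at h0
    exact L.injective (h0.trans (map_zero L).symm)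

variable {h : ContMDiffRiemannianMetric (𝓡 3) ∞ E3 (fun x : N => TangentSpace (𝓡 3) x)}
  {vol : Form3 N} {u : N → ℝ} {A : Form1 (𝓡 3) N}

theorem monopoleGerm_inChart (hvol : IsVolumeForm h.inner vol)
    (hu : ContMDiff (𝓡 3) 𝓘(ℝ, ℝ) ∞ u) (hA : SmoothForm1 A)
    (hm : IsMonopole h.inner vol u A) (he : e ∈ (extChartAt (𝓡 3) x).target) :
    ∃ b ν, Coord.MonopoleGerm (Bilin.inChart h.inner x) (u ∘ (extChartAt (𝓡 3) x).symm)
      (A.inChart x) e b ν := by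
  have hG := metricOn_inChart h x
  -- The volume form in coordinates. Its value on one basis, oriented orthonormal at `e`, is the
  -- function `ν` of the germ.
  let volc : E3 → E3 [⋀^Fin 3]→L[ℝ] ℝ := fun e =>
    (vol ((extChartAt (𝓡 3) x).symm e)).compContinuousLinearMap (invChartDeriv (𝓡 3) x e)
  have hvc : ∀ e (X : Fin 3 → E3), (volc e X) ^ 2 =
      (Matrix.of fun i j => Bilin.inChart h.inner x e (X i) (X j)).det := fun e X =>
    hvol.sq_eq _ _
  have hb : ∀ e ∈ (extChartAt (𝓡 3) x).target, ∃ b : Module.Basis (Fin 3) ℝ E3,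
      (∀ i j, Bilin.inChart h.inner x e (b i) (b j) = if i = j then 1 else 0) ∧ volc e b = 1 :=
    fun e he => exists_oriented_orthonormal_basis (by simp) (hG.symm e he) (hG.pos e he) (hvc e)
  obtain ⟨b, hb1, hb2⟩ := hb e he
  have hnhds := (isOpen_extChartAt_target x).mem_nhds he
  refine ⟨b, fun e' => volc e' b, hb1, hb2,
    ((hvol.smooth x b).contDiffAt hnhds).differentiableAt (by simp),
    Filter.Eventually.of_forall fun e' => hvc e' b, ?_⟩
  filter_upwards [hnhds] with e' he' y z
  -- At a nearby point the fixed basis `b` is no longer orthonormal, so the star is evaluated on an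
  -- auxiliary oriented orthonormal basis there and transferred to `b`.
  obtain ⟨c, hc1, hc2⟩ := hb e' he'
  have hstar : ∀ X Y Z : E3, Bilin.inChart h.inner x e' X X = 1 →
      Bilin.inChart h.inner x e' Y Y = 1 → Bilin.inChart h.inner x e' Z Z = 1 →
      Bilin.inChart h.inner x e' X Y = 0 → Bilin.inChart h.inner x e' X Z = 0 →
      Bilin.inChart h.inner x e' Y Z = 0 → volc e' ![X, Y, Z] = 1 →
      Coord.extDeriv₁ (A.inChart x) e' X Y =
        fderiv ℝ (u ∘ (extChartAt (𝓡 3) x).symm) e' Z := by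
    intro X Y Z h1 h2 h3 h4 h5 h6 h7
    rw [← hA.extDerivForm_invChartDeriv he',
      ← dform_inChart he' (hu.mdifferentiableAt (by simp))]
    refine (hm _ _ _ _ h1 h2 h3 h4 h5 h6 ?_).symm
    refine Eq.trans ?_ h7
    change vol _ _ = vol _ _
    congr 1
    ext i
    fin_cases i <;> rfl
  have hc012 : volc e' ![c 0, c 1, c 2] = 1 := by
    rw [← hc2]
    congr 1
    ext i
    fin_cases i <;> rfl
  have hc120 := (map_cyclic (volc e') (c 0) (c 1) (c 2)).trans hc012
  have hc201 := (map_cyclic (volc e') (c 1) (c 2) (c 0)).trans hc120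
  exact det_eq_mul_of_orthonormal c hc1 hc2 (fderiv ℝ (u ∘ (extChartAt (𝓡 3) x).symm) e')
    (fderiv ℝ (A.inChart x) e' - (fderiv ℝ (A.inChart x) e').flip) (fun y => sub_self _)
    (hstar _ _ _ (by simp [hc1]) (by simp [hc1]) (by simp [hc1]) (by simp [hc1]) (by simp [hc1])
      (by simp [hc1]) hc012)
    (hstar _ _ _ (by simp [hc1]) (by simp [hc1]) (by simp [hc1]) (by simp [hc1]) (by simp [hc1])
      (by simp [hc1]) hc120)
    (hstar _ _ _ (by simp [hc1]) (by simp [hc1]) (by simp [hc1]) (by simp [hc1]) (by simp [hc1])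
      (by simp [hc1]) hc201) b y z

theorem ghData_inChart (h : ContMDiffRiemannianMetric (𝓡 3) ∞ E3
    (fun x : N => TangentSpace (𝓡 3) x)) (hu : ContMDiff (𝓡 3) 𝓘(ℝ, ℝ) ∞ u) (hpos : ∀ x, 0 < u x)
    (hA : SmoothForm1 A) (x : N) :
    Coord.GHData (Bilin.inChart h.inner x) (u ∘ (extChartAt (𝓡 3) x).symm) (A.inChart x)
      (extChartAt (𝓡 3) x).target where
  metric := metricOn_inChart h x
  smooth_u := by
    have := contDiffOn_comp_extChartAt_symm hu.contMDiffOn (U := univ) x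
    rwa [preimage_univ, inter_univ] at this
  pos_u e _ := hpos _
  smooth_A := hA.contDiffOn_inChart x

end Monopole

/-! ### Sharps, the basic field, and functions with vanishing differential. -/

section

variable {N : Type*} [TopologicalSpace N] [ChartedSpace E3 N] [IsManifold (𝓡 3) ∞ N]
  {x : N} {e : E3} {h : ContMDiffRiemannianMetric (𝓡 3) ∞ E3 (fun x : N => TangentSpace (𝓡 3) x)}
  {u w : N → ℝ} {B : Form1 (𝓡 3) N}

omit [IsManifold (𝓡 3) ∞ N] in
theorem isOpen_target_inter_preimage (x : N) {U : Set N} (hU : IsOpen U) :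
    IsOpen ((extChartAt (𝓡 3) x).target ∩ (extChartAt (𝓡 3) x).symm ⁻¹' U) :=
  (continuousOn_extChartAt_symm x).isOpen_inter_preimage (isOpen_extChartAt_target x) hU

theorem sharp_apply (α : Form1 (𝓡 3) N) (x : N) (Y : TangentSpace (𝓡 3) x) :
    h.inner x (sharp h.inner α x) Y = α x Y := by
  have hinv : (h.inner x : E3 →L[ℝ] E3 →L[ℝ] ℝ).IsInvertible :=
    Coord.isInvertible_of_pos (E := E3) fun X hX => h.pos x X hX
  obtain ⟨L, hL⟩ := hinv
  have key : ∀ α : E3 →L[ℝ] ℝ, (h.inner x : E3 →L[ℝ] E3 →L[ℝ] ℝ)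
      ((h.inner x : E3 →L[ℝ] E3 →L[ℝ] ℝ).inverse α) = α := by
    intro α
    rw [← hL, ContinuousLinearMap.inverse_equiv]
    exact L.apply_symm_apply _
  exact DFunLike.congr_fun (key (α x)) Y

theorem inChart_sharp (α : Form1 (𝓡 3) N) (he : e ∈ (extChartAt (𝓡 3) x).target) :
    Bilin.inChart h.inner x e ((sharp h.inner α).inChart x e) = α.inChart x e := by
  refine ContinuousLinearMap.ext fun Y => ?_
  rw [Bilin.inChart_apply_inChart _ _ he]
  exact sharp_apply _ _ _

theorem contDiffOn_inChart_of_apply {V : VField (𝓡 3) N} {β : E3 → E3 →L[ℝ] ℝ}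
    (hβ : ContDiffOn ℝ ∞ β (extChartAt (𝓡 3) x).target)
    (hV : ∀ e ∈ (extChartAt (𝓡 3) x).target,
      Bilin.inChart h.inner x e (V.inChart x e) = β e) :
    ContDiffOn ℝ ∞ (V.inChart x) (extChartAt (𝓡 3) x).target := by
  have hG := metricOn_inChart h x
  have h1 : ContDiffOn ℝ ∞ (fun e => (Bilin.inChart h.inner x e).inverse (β e))
      (extChartAt (𝓡 3) x).target := fun e he =>
    ((hG.contDiffAt_inverse he).clm_apply
      (hβ.contDiffAt (hG.isOpen.mem_nhds he))).contDiffWithinAt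
  exact h1.congr fun e he => by rw [← hV e he, hG.inverse_apply he]

theorem contDiffOn_sharp {α : Form1 (𝓡 3) N}
    (hα : ContDiffOn ℝ ∞ (α.inChart x) (extChartAt (𝓡 3) x).target) :
    ContDiffOn ℝ ∞ ((sharp h.inner α).inChart x) (extChartAt (𝓡 3) x).target :=
  contDiffOn_inChart_of_apply hα fun _ he => inChart_sharp α he

theorem contDiffOn_chart (hu : ContMDiff (𝓡 3) 𝓘(ℝ, ℝ) ∞ u) (x : N) :
    ContDiffOn ℝ ∞ (u ∘ (extChartAt (𝓡 3) x).symm) (extChartAt (𝓡 3) x).target := by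
  have := contDiffOn_comp_extChartAt_symm hu.contMDiffOn (U := univ) x
  rwa [preimage_univ, inter_univ] at this

theorem contDiffOn_dform (hu : ContMDiff (𝓡 3) 𝓘(ℝ, ℝ) ∞ u) (x : N) :
    ContDiffOn ℝ ∞ ((dform (𝓡 3) u).inChart x) (extChartAt (𝓡 3) x).target :=
  ((contDiffOn_chart hu x).fderiv_of_isOpen (isOpen_extChartAt_target x) (by simp)).congr
    fun _ he => dform_inChart he (hu.mdifferentiableAt (by simp))

theorem basicField_apply (a : ℝ) (x : N) (Y : TangentSpace (𝓡 3) x) :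
    h.inner x (basicField h.inner a u B w x) Y =
      (u x ^ 2)⁻¹ * (dform (𝓡 3) w x Y - a * B x Y) := by
  rw [basicField, map_smul, map_sub, map_smul, smul_apply, sub_apply, smul_apply, grad,
    sharp_apply, sharp_apply]
  rfl

theorem inChart_basicField (a : ℝ) (he : e ∈ (extChartAt (𝓡 3) x).target) :
    Bilin.inChart h.inner x e ((basicField h.inner a u B w).inChart x e) =
      (((u ∘ (extChartAt (𝓡 3) x).symm) e) ^ 2)⁻¹ • ((dform (𝓡 3) w).inChart x e
        - a • B.inChart x e) := by
  refine ContinuousLinearMap.ext fun Y => ?_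
  rw [Bilin.inChart_apply_inChart _ _ he]
  exact basicField_apply _ _ _

theorem contDiffOn_basicField (a : ℝ) (hu : ContMDiff (𝓡 3) 𝓘(ℝ, ℝ) ∞ u) (hpos : ∀ x, 0 < u x)
    (hB : SmoothForm1 B) (hw : ContMDiff (𝓡 3) 𝓘(ℝ, ℝ) ∞ w) (x : N) :
    ContDiffOn ℝ ∞ ((basicField h.inner a u B w).inChart x) (extChartAt (𝓡 3) x).target := by
  have h1 : ContDiffOn ℝ ∞ (fun e => (((u ∘ (extChartAt (𝓡 3) x).symm) e) ^ 2)⁻¹)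
      (extChartAt (𝓡 3) x).target :=
    ((contDiffOn_chart hu x).pow 2).inv fun e _ => (pow_pos (hpos _) 2).ne'
  have h2 : ContDiffOn ℝ ∞ (fun e => (dform (𝓡 3) w).inChart x e - a • B.inChart x e)
      (extChartAt (𝓡 3) x).target :=
    (contDiffOn_dform hw x).sub ((hB.contDiffOn_inChart x).const_smul a)
  exact contDiffOn_inChart_of_apply (h1.smul h2) fun _ he => inChart_basicField a he

/-- The counterpart of `SmoothForm1.extDerivForm_invChartDeriv`: Lie derivatives of the metric at
all points near `x` may be computed in the chart at `x`. -/
theorem lieDerivative_invChartDeriv {V : VField (𝓡 3) N}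
    (hV : ∀ x, ContDiffOn ℝ ∞ (V.inChart x) (extChartAt (𝓡 3) x).target)
    (he : e ∈ (extChartAt (𝓡 3) x).target) (X Y : E3) :
    lieDerivative V h.inner ((extChartAt (𝓡 3) x).symm e) (invChartDeriv (𝓡 3) x e X)
      (invChartDeriv (𝓡 3) x e Y) =
      Coord.lieDeriv (V.inChart x) (Bilin.inChart h.inner x) e X Y := by
  have hy := mem_extChartAt_source (I := 𝓡 3) ((extChartAt (𝓡 3) x).symm e)
  have hd : ∀ X : E3, (fderiv ℝ (extChartAt (𝓡 3) ((extChartAt (𝓡 3) x).symm e) ∘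
      (extChartAt (𝓡 3) x).symm) e X : E3) = invChartDeriv (𝓡 3) x e X := fun X =>
    (invChartDeriv_self _ _).symm.trans (invChartDeriv_coordChange he hy X)
  refine (lieDerivative_apply _ _ _ _ _).trans ?_
  rw [Coord.lieDeriv_pullback (contDiffAt_coordChange he hy)
    ((metricOn_inChart h x).differentiableAt he)
    ((metricOn_inChart h _).differentiableAt (mem_extChartAt_target _))
    (((hV x).contDiffAt ((isOpen_extChartAt_target x).mem_nhds he)).differentiableAt (by simp))
    (((hV _).contDiffAt (extChartAt_target_mem_nhds_self _)).differentiableAt (by simp))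
    ((eventually_mem_coordChange he hy).mono fun e' h' => Bilin.inChart_coordChange _ h'.1 h'.2)
    ((eventually_mem_coordChange he hy).mono fun e' h' => V.inChart_coordChange h'.1 h'.2),
    hd, hd]
  rfl

theorem dform_eq_fderiv {g : N → ℝ} (hg : MDifferentiableAt (𝓡 3) 𝓘(ℝ, ℝ) g x) (X : E3) :
    dform (𝓡 3) g x X = fderiv ℝ (g ∘ (extChartAt (𝓡 3) x).symm) (extChartAt (𝓡 3) x x) X := by
  rw [← dform_inChart (mem_extChartAt_target x) (by rwa [extChartAt_to_inv])]
  exact (Form1.inChart_self _ _ _).symm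

/-- A function with zero differential on a preconnected open set is constant there. -/
theorem exists_eq_const_of_dform_eq_zero {W : Set N} (hW : IsOpen W) (hc : IsPreconnected W)
    {g : N → ℝ} (hg : ContMDiffOn (𝓡 3) 𝓘(ℝ, ℝ) ∞ g W)
    (h0 : ∀ x ∈ W, ∀ X, dform (𝓡 3) g x X = 0) : ∃ c, ∀ x ∈ W, g x = c := by
  rcases W.eq_empty_or_nonempty with rfl | ⟨x₀, hx₀⟩
  · exact ⟨0, by simp⟩
  refine ⟨g x₀, fun x hx => ?_⟩
  have := isPreconnected_iff_preconnectedSpace.1 hc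
  have hloc : IsLocallyConstant (fun x : W => g x) := by
    rw [IsLocallyConstant.iff_eventually_eq]
    rintro ⟨y, hy⟩
    have hO := isOpen_target_inter_preimage y hW
    have hmem : extChartAt (𝓡 3) y y ∈
        (extChartAt (𝓡 3) y).target ∩ (extChartAt (𝓡 3) y).symm ⁻¹' W :=
      ⟨mem_extChartAt_target y, by simpa using hy⟩
    obtain ⟨r, hr, hball⟩ := Metric.isOpen_iff.1 hO _ hmem
    have hdiff : ∀ e ∈ Metric.ball (extChartAt (𝓡 3) y y) r,
        MDifferentiableAt (𝓡 3) 𝓘(ℝ, ℝ) g ((extChartAt (𝓡 3) y).symm e) := fun e he =>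
      (hg.contMDiffAt (hW.mem_nhds (hball he).2)).mdifferentiableAt (by simp)
    have hconst : ∀ e ∈ Metric.ball (extChartAt (𝓡 3) y y) r,
        (g ∘ (extChartAt (𝓡 3) y).symm) e = (g ∘ (extChartAt (𝓡 3) y).symm)
          (extChartAt (𝓡 3) y y) := fun e he =>
      Metric.isOpen_ball.is_const_of_fderiv_eq_zero (convex_ball _ _).isPreconnected
        (fun e he => (((contDiffOn_comp_extChartAt_symm hg y).contDiffAt (hO.mem_nhds
          (hball he))).differentiableAt (by simp)).differentiableWithinAt)
        (fun e he => by
          rw [← dform_inChart (hball he).1 (hdiff e he)]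
          exact ContinuousLinearMap.ext fun X => h0 _ (hball he).2 _) he (Metric.mem_ball_self hr)
    have hev : ∀ᶠ z in 𝓝 y, z ∈ (extChartAt (𝓡 3) y).source ∧
        extChartAt (𝓡 3) y z ∈ Metric.ball (extChartAt (𝓡 3) y y) r :=
      Filter.Eventually.and (extChartAt_source_mem_nhds y) ((continuousAt_extChartAt y).eventually
        (Metric.ball_mem_nhds _ hr))
    filter_upwards [continuousAt_subtype_val.eventually hev] with z hz
    have := hconst _ hz.2
    rwa [Function.comp_apply, Function.comp_apply, (extChartAt (𝓡 3) y).left_inv hz.1,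
      extChartAt_to_inv] at this
  exact hloc.apply_eq_of_preconnectedSpace ⟨x, hx⟩ ⟨x₀, hx₀⟩

omit [IsManifold (𝓡 3) ∞ N] in
theorem hasMFDerivAt_vertCoeff {f₀ : N → ℝ} (hf : MDifferentiableAt (𝓡 3) 𝓘(ℝ, ℝ) f₀ x)
    (a b t : ℝ) : HasMFDerivAt I4 𝓘(ℝ, ℝ) (vertCoeff a b f₀) (x, t)
      ((dform (𝓡 3) f₀ x : E3 →L[ℝ] ℝ).comp (ContinuousLinearMap.fst ℝ E3 ℝ) +
        ((-a + 1 / 2 * b * t) • ContinuousLinearMap.id ℝ ℝ).comp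
          (ContinuousLinearMap.snd ℝ E3 ℝ)) := by
  have h1 := hf.hasMFDerivAt.comp (x, t) (hasMFDerivAt_fst (I := 𝓡 3) (I' := 𝓘(ℝ, ℝ)) (x, t))
  have h0 : HasDerivAt (fun s : ℝ => -a * s + 1 / 4 * b * s ^ 2) (-a + 1 / 2 * b * t) t := by
    have := ((hasDerivAt_id t).const_mul (-a)).add (((hasDerivAt_id t).pow 2).const_mul (1 / 4 * b))
    refine this.congr_deriv ?_
    simp
    ring
  have h0' : HasFDerivAt (fun s : ℝ => -a * s + 1 / 4 * b * s ^ 2)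
      ((-a + 1 / 2 * b * t) • ContinuousLinearMap.id ℝ ℝ) t := by
    refine h0.hasFDerivAt.congr_fderiv ?_
    ext
    simp
  have h2 := h0'.hasMFDerivAt.comp (x, t) (hasMFDerivAt_snd (I := 𝓡 3) (I' := 𝓘(ℝ, ℝ)) (x, t))
  have h3 := h1.add h2
  refine (h3.congr_of_eventuallyEq ?_)
  refine Filter.Eventually.of_forall fun p => ?_
  simp only [vertCoeff, Pi.add_apply, Function.comp_apply]
  ring

omit [IsManifold (𝓡 3) ∞ N] in
theorem dform_vertCoeff {f₀ : N → ℝ} (hf : MDifferentiableAt (𝓡 3) 𝓘(ℝ, ℝ) f₀ x)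
    (a b t : ℝ) (X : E3 × ℝ) : dform I4 (vertCoeff a b f₀) (x, t) X =
      dform (𝓡 3) f₀ x X.1 + (-a + 1 / 2 * b * t) * X.2 := by
  rw [dform, mvfderiv, (hasMFDerivAt_vertCoeff hf a b t).mfderiv]
  rfl

end

/-! ### The soliton equation for `A = B + dv` and a vertical coefficient quadratic in `t`. -/

set_option synthInstance.maxHeartbeats 200000 in
theorem Coord.ricci_zero_left {E : Type*} [NormedAddCommGroup E] [NormedSpace ℝ E]
    (G : E → E →L[ℝ] E →L[ℝ] ℝ) (e Z : E) : Coord.ricci G e 0 Z = 0 := by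
  have : Coord.curvature G e 0 Z = 0 := by
    refine ContinuousLinearMap.ext fun X => ?_
    rw [Coord.curvature_apply]
    simp
  rw [Coord.ricci, this]
  simp

section

variable {N : Type*} [TopologicalSpace N] [ChartedSpace E3 N] [IsManifold (𝓡 3) ∞ N]
  {x : N} {e : E3} {h : ContMDiffRiemannianMetric (𝓡 3) ∞ E3 (fun x : N => TangentSpace (𝓡 3) x)}
  {vol : Form3 N} {a b : ℝ} {u w v : N → ℝ} {B : Form1 (𝓡 3) N} {U : Set N}

theorem inChart_add_dform (hU : IsOpen U) (hv : ContMDiffOn (𝓡 3) 𝓘(ℝ, ℝ) ∞ v U)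
    (he : e ∈ (extChartAt (𝓡 3) x).target ∩ (extChartAt (𝓡 3) x).symm ⁻¹' U) :
    (B + dform (𝓡 3) v).inChart x e =
      B.inChart x e + fderiv ℝ (v ∘ (extChartAt (𝓡 3) x).symm) e := by
  rw [← dform_inChart he.1 ((hv.contMDiffAt (hU.mem_nhds he.2)).mdifferentiableAt (by simp))]
  rfl

theorem contDiffOn_inChart_add_dform (hB : SmoothForm1 B) (hU : IsOpen U)
    (hv : ContMDiffOn (𝓡 3) 𝓘(ℝ, ℝ) ∞ v U) (x : N) :
    ContDiffOn ℝ ∞ ((B + dform (𝓡 3) v).inChart x)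
      ((extChartAt (𝓡 3) x).target ∩ (extChartAt (𝓡 3) x).symm ⁻¹' U) := by
  have h1 := (contDiffOn_comp_extChartAt_symm hv x).fderiv_of_isOpen
    (isOpen_target_inter_preimage x hU) (m := ∞) (by simp)
  exact (((hB.contDiffOn_inChart x).mono inter_subset_left).add h1).congr fun e he =>
    inChart_add_dform hU hv he

theorem extDeriv₁_add_dform (hB : SmoothForm1 B) (hU : IsOpen U)
    (hv : ContMDiffOn (𝓡 3) 𝓘(ℝ, ℝ) ∞ v U)
    (he : e ∈ (extChartAt (𝓡 3) x).target ∩ (extChartAt (𝓡 3) x).symm ⁻¹' U) (X Y : E3) :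
    Coord.extDeriv₁ ((B + dform (𝓡 3) v).inChart x) e X Y =
      Coord.extDeriv₁ (B.inChart x) e X Y := by
  have hO := isOpen_target_inter_preimage x hU
  have hvs := contDiffOn_comp_extChartAt_symm hv x
  have h1 := hvs.fderiv_of_isOpen hO (m := ∞) (by simp)
  have hev : (B + dform (𝓡 3) v).inChart x =ᶠ[𝓝 e]
      (B.inChart x + fderiv ℝ (v ∘ (extChartAt (𝓡 3) x).symm)) :=
    (hO.eventually_mem he).mono fun e he => inChart_add_dform hU hv he
  rw [Coord.extDeriv₁, Coord.extDeriv₁, hev.fderiv_eq, fderiv_add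
    (((hB.contDiffOn_inChart x).contDiffAt ((isOpen_extChartAt_target x).mem_nhds
      he.1)).differentiableAt (by simp))
    ((h1.contDiffAt (hO.mem_nhds he)).differentiableAt (by simp)), add_apply, add_apply,
    add_apply, add_apply, (Coord.isSymmSndFDerivAt_of_contDiffOn hO hvs he).eq X Y]
  ring

theorem extDerivForm_add_dform (hB : SmoothForm1 B) (hU : IsOpen U)
    (hv : ContMDiffOn (𝓡 3) 𝓘(ℝ, ℝ) ∞ v U) (hx : x ∈ U) (X Y : E3) :
    extDerivForm (B + dform (𝓡 3) v) x X Y = extDerivForm B x X Y := by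
  refine (extDerivForm_apply _ _ _ _).trans (Eq.trans ?_ (extDerivForm_apply _ _ _ _).symm)
  exact extDeriv₁_add_dform hB hU hv ⟨mem_extChartAt_target x, by simpa using hx⟩ _ _

/-- The content of the first equation of the system, divided by `u²`. -/
theorem dform_basicField (hpos : ∀ x, 0 < u x) (hS : SolvesSystem h.inner a b u B w) (x : N) :
    dform (𝓡 3) u x (basicField h.inner a u B w x) = b * u x := by
  have hu := (hpos x).ne'
  rw [basicField, map_smul, map_sub, map_smul, hS.first, smul_eq_mul, smul_eq_mul]
  field_simp
  ring

/-- The content of the third equation. The Hessian of `w` computed from `dw = a B + u² F♭` and the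
prescribed one share the terms in `L_{B♯} h` and in `du ⊙ (dw - a B)`; what is left is `½ u² L_F h =
-½ b u² h`. -/
theorem lieDerivative_basicField (hu : ContMDiff (𝓡 3) 𝓘(ℝ, ℝ) ∞ u) (hpos : ∀ x, 0 < u x)
    (hB : SmoothForm1 B) (hw : ContMDiff (𝓡 3) 𝓘(ℝ, ℝ) ∞ w)
    (hS : SolvesSystem h.inner a b u B w) (x : N) (X Y : E3) :
    lieDerivative (basicField h.inner a u B w) h.inner x X Y = -b * h.inner x X Y := by
  have hd := ghData_inChart h hu hpos hB x
  have he := mem_extChartAt_target (I := 𝓡 3) x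
  have hnhds := extChartAt_target_mem_nhds_self (I := 𝓡 3) x
  have hux := hpos x
  have hF : ContDiffOn ℝ ∞ ((basicField h.inner a u B w).inChart x) _ :=
    contDiffOn_basicField a hu hpos hB hw x
  have hFd := (hF.contDiffAt hnhds).differentiableAt (by simp)
  have hB' := hB.contDiffOn_inChart x
  have h1 := hd.nabla_eq he (a := a) (B := B.inChart x)
    (φ := fun e => Bilin.inChart h.inner x e ((basicField h.inner a u B w).inChart x e))
    (contDiffOn_chart hw x)
    (((contDiffOn_sharp (h := h) hB').contDiffAt hnhds).differentiableAt (by simp)) hFd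
    ((hB'.contDiffAt hnhds).differentiableAt (by simp))
    ((hd.metric.differentiableAt he).clm_apply hFd)
    (Filter.Eventually.mono hnhds fun e he => inChart_sharp B he)
    (Filter.Eventually.of_forall fun _ => rfl)
    (Filter.Eventually.mono hnhds fun e he => by
      have := (pow_pos (hd.pos_u e he) 2).ne'
      rw [inChart_basicField a he, smul_smul, mul_inv_cancel₀ this, one_smul,
        dform_inChart he (hw.mdifferentiableAt (by simp)), add_sub_cancel]) X Y
  have h2 := hS.third x X Y
  have e1 : covDeriv h.inner (dform (𝓡 3) w) x X Y =
      Coord.nabla (Bilin.inChart h.inner x) (fderiv ℝ (w ∘ (extChartAt (𝓡 3) x).symm))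
        (extChartAt (𝓡 3) x x) X Y := by
    refine (covDeriv_apply _ _ _ _ _).trans ?_
    have hev : (dform (𝓡 3) w).inChart x =ᶠ[𝓝 (extChartAt (𝓡 3) x x)]
        fderiv ℝ (w ∘ (extChartAt (𝓡 3) x).symm) :=
      Filter.Eventually.mono hnhds fun e he => dform_inChart he (hw.mdifferentiableAt (by simp))
    rw [Coord.nabla, Coord.nabla, hev.fderiv_eq, hev.eq_of_nhds]
  have e2 : lieDerivative (sharp h.inner B) h.inner x X Y = _ := lieDerivative_apply _ _ _ X Y
  have e3 : lieDerivative (basicField h.inner a u B w) h.inner x X Y = _ :=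
    lieDerivative_apply _ _ _ X Y
  have e4 : ∀ Y : E3, Bilin.inChart h.inner x (extChartAt (𝓡 3) x x)
      ((basicField h.inner a u B w).inChart x (extChartAt (𝓡 3) x x)) Y =
      (u x ^ 2)⁻¹ * (dform (𝓡 3) w x Y - a * B x Y) := by
    intro Y
    rw [VField.inChart_self]
    exact (Bilin.inChart_self h.inner x _ Y).trans (basicField_apply a x Y)
  have e5 : (u ∘ (extChartAt (𝓡 3) x).symm) (extChartAt (𝓡 3) x x) = u x := by simp
  have e6 := dform_eq_fderiv (x := x) (g := u) (hu.mdifferentiableAt (by simp))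
  have e7 : symProd (dform (𝓡 3) u x) (dform (𝓡 3) w x - a • B x) X Y =
      1 / 2 * (dform (𝓡 3) u x X * (dform (𝓡 3) w x Y - a * B x Y)
        + dform (𝓡 3) u x Y * (dform (𝓡 3) w x X - a * B x X)) := rfl
  rw [e4, e4, e5, ← e6, ← e6, ← e1, ← e2, ← e3, h2, e7] at h1
  have hune := hux.ne'
  have hfin : u x ^ 3 * (lieDerivative (basicField h.inner a u B w) h.inner x X Y
      + b * h.inner x X Y) = 0 := by
    field_simp at h1
    linarith
  have := (mul_eq_zero.1 hfin).resolve_left (pow_pos hux 3).ne'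
  linarith

/-- Adding `dv` leaves the exterior derivative unchanged, so the germ of `B` serves for `B + dv`
wherever `v` is smooth. -/
theorem exists_monopoleGerm_add_dform (hvol : IsVolumeForm h.inner vol)
    (hu : ContMDiff (𝓡 3) 𝓘(ℝ, ℝ) ∞ u) (hB : SmoothForm1 B)
    (hm : IsMonopole h.inner vol u B) (hU : IsOpen U)
    (hv : ContMDiffOn (𝓡 3) 𝓘(ℝ, ℝ) ∞ v U) (hx : x ∈ U) :
    ∃ c ν, Coord.MonopoleGerm (Bilin.inChart h.inner x) (u ∘ (extChartAt (𝓡 3) x).symm)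
      ((B + dform (𝓡 3) v).inChart x) (extChartAt (𝓡 3) x x) c ν := by
  obtain ⟨c, ν, hg⟩ := monopoleGerm_inChart (x := x) hvol hu hB hm (mem_extChartAt_target x)
  refine ⟨c, ν, hg.orthonormal, hg.one, hg.differentiable, hg.sq, ?_⟩
  have hmem : extChartAt (𝓡 3) x x ∈
      (extChartAt (𝓡 3) x).target ∩ (extChartAt (𝓡 3) x).symm ⁻¹' U :=
    ⟨mem_extChartAt_target x, by simpa using hx⟩
  filter_upwards [hg.ext, (isOpen_target_inter_preimage x hU).eventually_mem hmem] with e he he' y z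
  rw [extDeriv₁_add_dform hB hU hv he', he]

theorem ghData_inChart_add_dform (hu : ContMDiff (𝓡 3) 𝓘(ℝ, ℝ) ∞ u) (hpos : ∀ x, 0 < u x)
    (hB : SmoothForm1 B) (hU : IsOpen U) (hv : ContMDiffOn (𝓡 3) 𝓘(ℝ, ℝ) ∞ v U) (x : N) :
    Coord.GHData (Bilin.inChart h.inner x) (u ∘ (extChartAt (𝓡 3) x).symm)
      ((B + dform (𝓡 3) v).inChart x)
      ((extChartAt (𝓡 3) x).target ∩ (extChartAt (𝓡 3) x).symm ⁻¹' U) :=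
  have hd := (ghData_inChart h hu hpos hB x).mono (isOpen_target_inter_preimage x hU)
    inter_subset_left
  ⟨hd.metric, hd.smooth_u, hd.pos_u, contDiffOn_inChart_add_dform hB hU hv x⟩

/-- The soliton tensor for `f = f₀ - a t + ¼ b t²`. -/
theorem solitonTensor_vertCoeff (hvol : IsVolumeForm h.inner vol)
    (hu : ContMDiff (𝓡 3) 𝓘(ℝ, ℝ) ∞ u) (hpos : ∀ x, 0 < u x) (hB : SmoothForm1 B)
    (hm : IsMonopole h.inner vol u B) (hU : IsOpen U)
    (hv : ContMDiffOn (𝓡 3) 𝓘(ℝ, ℝ) ∞ v U) {f₀ : N → ℝ}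
    (hf₀ : ContMDiffOn (𝓡 3) 𝓘(ℝ, ℝ) ∞ f₀ U) {F : VField (𝓡 3) N}
    (hF : ∀ x, ContDiffOn ℝ ∞ (F.inChart x) (extChartAt (𝓡 3) x).target) (hx : x ∈ U) (t : ℝ)
    (hFu : dform (𝓡 3) u x (F x) = b * u x) (X Y : E3 × ℝ) :
    solitonTensor (ghMetric h.inner u (B + dform (𝓡 3) v)) a
        (flowField (B + dform (𝓡 3) v) (vertCoeff a b f₀) F) (x, t) X Y =
      ricciTensor h.inner x X.1 Y.1 + a * (u x * h.inner x X.1 Y.1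
        + (u x)⁻¹ * ((X.2 + (B x X.1 + dform (𝓡 3) v x X.1))
          * (Y.2 + (B x Y.1 + dform (𝓡 3) v x Y.1))))
      + 1 / 2 * ((u x)⁻¹ *
          ((dform (𝓡 3) f₀ x X.1 + (-a + 1 / 2 * b * t) * X.2)
            * (Y.2 + (B x Y.1 + dform (𝓡 3) v x Y.1))
          + (dform (𝓡 3) f₀ x Y.1 + (-a + 1 / 2 * b * t) * Y.2)
            * (X.2 + (B x X.1 + dform (𝓡 3) v x X.1)))
        + u x * (X.2 * h.inner x (F x) Y.1 + Y.2 * h.inner x (F x) X.1)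
        + t * (b * u x * h.inner x X.1 Y.1 + u x * lieDerivative F h.inner x X.1 Y.1
          - (u x)⁻¹ ^ 2 * (b * u x) * ((X.2 + (B x X.1 + dform (𝓡 3) v x X.1))
            * (Y.2 + (B x Y.1 + dform (𝓡 3) v x Y.1)))
          + (u x)⁻¹ * ((X.2 + (B x X.1 + dform (𝓡 3) v x X.1)) * extDerivForm B x (F x) Y.1
            + (Y.2 + (B x Y.1 + dform (𝓡 3) v x Y.1)) * extDerivForm B x (F x) X.1))) := by
  obtain ⟨c, ν, hg⟩ := exists_monopoleGerm_add_dform hvol hu hB hm hU hv hx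
  have hf : MDifferentiableAt (𝓡 3) 𝓘(ℝ, ℝ) f₀ x :=
    (hf₀.contMDiffAt (hU.mem_nhds hx)).mdifferentiableAt (by simp)
  have hmem : extChartAt (𝓡 3) x x ∈
      (extChartAt (𝓡 3) x).target ∩ (extChartAt (𝓡 3) x).symm ⁻¹' U :=
    ⟨mem_extChartAt_target x, by simpa using hx⟩
  have hFd := ((hF x).contDiffAt (extChartAt_target_mem_nhds_self x)).differentiableAt (by simp)
  rw [solitonTensor_ghMetric (ghData_inChart_add_dform hu hpos hB hU hv x) hmem hg
    (hu.mdifferentiableAt (by simp)) (hasMFDerivAt_vertCoeff hf a b t).mdifferentiableAt hFd a X Y,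
    dform_vertCoeff hf, dform_vertCoeff hf, hFu]
  have e1 : ∀ Z : E3, extDerivForm (B + dform (𝓡 3) v) x (F x) Z = extDerivForm B x (F x) Z :=
    fun Z => extDerivForm_add_dform hB hU hv hx _ _
  have e2 : ∀ Z : E3, (B + dform (𝓡 3) v) x Z = B x Z + dform (𝓡 3) v x Z := fun Z => rfl
  rw [e1, e1, e2, e2]

/-- The vertical part of the soliton equation at a point of `N`. -/
theorem solitonTensor_vertical_iff (hvol : IsVolumeForm h.inner vol)
    (hu : ContMDiff (𝓡 3) 𝓘(ℝ, ℝ) ∞ u) (hpos : ∀ x, 0 < u x) (hB : SmoothForm1 B)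
    (hm : IsMonopole h.inner vol u B) (hU : IsOpen U)
    (hv : ContMDiffOn (𝓡 3) 𝓘(ℝ, ℝ) ∞ v U) {f₀ : N → ℝ}
    (hf₀ : ContMDiffOn (𝓡 3) 𝓘(ℝ, ℝ) ∞ f₀ U) {F : VField (𝓡 3) N}
    (hF : ∀ x, ContDiffOn ℝ ∞ (F.inChart x) (extChartAt (𝓡 3) x).target) (hx : x ∈ U)
    (hFu : dform (𝓡 3) u x (F x) = b * u x) :
    (∀ (t : ℝ) (X : E3 × ℝ), solitonTensor (ghMetric h.inner u (B + dform (𝓡 3) v)) a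
      (flowField (B + dform (𝓡 3) v) (vertCoeff a b f₀) F) (x, t) ((0, 1) : E3 × ℝ) X = 0) ↔
    ∀ y : E3, dform (𝓡 3) f₀ x y + a * (B x y + dform (𝓡 3) v x y)
        + u x ^ 2 * h.inner x (F x) y = 0 ∧
      extDerivForm B x (F x) y = b / 2 * (B x y + dform (𝓡 3) v x y) := by
  have hux := (hpos x).ne'
  have z1 : ∀ y : E3, ricciTensor h.inner x (0 : E3) y = 0 := fun y =>
    (ricciTensor_apply _ _ _ _).trans (Coord.ricci_zero_left _ _ _)
  have z2 : ∀ y : E3, lieDerivative F h.inner x (0 : E3) y = 0 := fun y =>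
    (lieDerivative_apply _ _ _ _ _).trans (by simp [Coord.lieDeriv])
  have z3 : extDerivForm B x (F x) (0 : E3) = 0 :=
    (extDerivForm_apply _ _ _ _).trans (by simp [Coord.extDeriv₁]; rfl)
  have z4 : ∀ y : E3, h.inner x (0 : E3) y = 0 := fun y => by
    rw [show h.inner x (0 : E3) = 0 from map_zero _]; rfl
  have z5 : h.inner x (F x) (0 : E3) = 0 := map_zero _
  have z6 : B x (0 : E3) = 0 := map_zero _
  have z7 : dform (𝓡 3) v x (0 : E3) = 0 := map_zero _
  have z8 : dform (𝓡 3) f₀ x (0 : E3) = 0 := map_zero _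
  -- The coefficients `-a` and `¼ b` of the ansatz, with `F(u) = b u`, make the purely vertical
  -- component vanish. The mixed component is affine in `t`; its values at `t = 0` and `t = 1` give
  -- the two equations.
  have key : ∀ (t : ℝ) (X : E3 × ℝ),
      2 * u x * solitonTensor (ghMetric h.inner u (B + dform (𝓡 3) v)) a
      (flowField (B + dform (𝓡 3) v) (vertCoeff a b f₀) F) (x, t) ((0, 1) : E3 × ℝ) X =
      (dform (𝓡 3) f₀ x X.1 + a * (B x X.1 + dform (𝓡 3) v x X.1)
        + u x ^ 2 * h.inner x (F x) X.1) + t * (extDerivForm B x (F x) X.1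
          - b / 2 * (B x X.1 + dform (𝓡 3) v x X.1)) := by
    intro t X
    rw [solitonTensor_vertCoeff hvol hu hpos hB hm hU hv hf₀ hF hx t hFu]
    simp only [z1, z2, z3, z4, z5, z6, z7, z8]
    field_simp
    ring
  constructor
  · intro hz y
    have h0 := key 0 (y, 0)
    have h1 := key 1 (y, 0)
    rw [hz] at h0 h1
    constructor <;> linarith
  · intro hz t X
    have h0 := key t X
    rw [(hz X.1).1, (hz X.1).2, sub_self, mul_zero, add_zero] at h0
    exact (mul_eq_zero.1 h0).resolve_left (mul_ne_zero two_ne_zero hux)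

/-- The soliton tensor when the vertical part of the soliton equation holds. -/
theorem solitonTensor_of_vertical (hvol : IsVolumeForm h.inner vol)
    (hu : ContMDiff (𝓡 3) 𝓘(ℝ, ℝ) ∞ u) (hpos : ∀ x, 0 < u x) (hB : SmoothForm1 B)
    (hm : IsMonopole h.inner vol u B) (hU : IsOpen U)
    (hv : ContMDiffOn (𝓡 3) 𝓘(ℝ, ℝ) ∞ v U) {f₀ : N → ℝ}
    (hf₀ : ContMDiffOn (𝓡 3) 𝓘(ℝ, ℝ) ∞ f₀ U) {F : VField (𝓡 3) N}
    (hF : ∀ x, ContDiffOn ℝ ∞ (F.inChart x) (extChartAt (𝓡 3) x).target) (hx : x ∈ U) (t : ℝ)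
    (hFu : dform (𝓡 3) u x (F x) = b * u x)
    (hFh : ∀ X Y : E3, lieDerivative F h.inner x X Y = -b * h.inner x X Y)
    (hvert : ∀ y : E3, dform (𝓡 3) f₀ x y + a * (B x y + dform (𝓡 3) v x y)
        + u x ^ 2 * h.inner x (F x) y = 0 ∧
      extDerivForm B x (F x) y = b / 2 * (B x y + dform (𝓡 3) v x y)) (X Y : E3 × ℝ) :
    solitonTensor (ghMetric h.inner u (B + dform (𝓡 3) v)) a
        (flowField (B + dform (𝓡 3) v) (vertCoeff a b f₀) F) (x, t) X Y =
      ricciTensor h.inner x X.1 Y.1 + a * u x * h.inner x X.1 Y.1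
        - 1 / 2 * u x * ((B x X.1 + dform (𝓡 3) v x X.1) * h.inner x (F x) Y.1
          + (B x Y.1 + dform (𝓡 3) v x Y.1) * h.inner x (F x) X.1) := by
  have hux := (hpos x).ne'
  rw [solitonTensor_vertCoeff hvol hu hpos hB hm hU hv hf₀ hF hx t hFu, hFh, (hvert X.1).2,
    (hvert Y.1).2]
  -- Substituting for `df₀` cancels all terms in `θ`, and the terms in `t` cancel by the scaling
  -- laws. Only base quantities remain, so the tensor is independent of `t`.
  have hX : dform (𝓡 3) f₀ x X.1 = -(a * (B x X.1 + dform (𝓡 3) v x X.1)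
    + u x ^ 2 * h.inner x (F x) X.1) := by linarith [(hvert X.1).1]
  have hY : dform (𝓡 3) f₀ x Y.1 = -(a * (B x Y.1 + dform (𝓡 3) v x Y.1)
    + u x ^ 2 * h.inner x (F x) Y.1) := by linarith [(hvert Y.1).1]
  rw [hX, hY]
  field_simp
  ring

end

/-! ### Local existence and uniqueness of `v` and `f₀`: part (1). -/

section

variable {N : Type*} [TopologicalSpace N] [ChartedSpace E3 N] [IsManifold (𝓡 3) ∞ N]
  {x : N} {e : E3} {h : ContMDiffRiemannianMetric (𝓡 3) ∞ E3 (fun x : N => TangentSpace (𝓡 3) x)}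
  {vol : Form3 N} {a b : ℝ} {u w v : N → ℝ} {B : Form1 (𝓡 3) N} {U : Set N}

/-- If `F(u) = b u` and `L_F h = -b h`, then `(2 / b) i_F dB - B` is locally exact. -/
theorem exists_dform_eq (hvol : IsVolumeForm h.inner vol) (hb : b ≠ 0)
    (hu : ContMDiff (𝓡 3) 𝓘(ℝ, ℝ) ∞ u) (hpos : ∀ x, 0 < u x) (hB : SmoothForm1 B)
    (hm : IsMonopole h.inner vol u B) {F : VField (𝓡 3) N}
    (hF : ∀ x, ContDiffOn ℝ ∞ (F.inChart x) (extChartAt (𝓡 3) x).target)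
    (hFu : ∀ x, dform (𝓡 3) u x (F x) = b * u x)
    (hFh : ∀ (x : N) (X Y : E3), lieDerivative F h.inner x X Y = -b * h.inner x X Y) (p : N) :
    ∃ U : Set N, IsOpen U ∧ IsConnected U ∧ p ∈ U ∧ ∃ v : N → ℝ,
      ContMDiffOn (𝓡 3) 𝓘(ℝ, ℝ) ∞ v U ∧ ∀ x ∈ U, ∀ y : E3,
        extDerivForm B x (F x) y = b / 2 * (B x y + dform (𝓡 3) v x y) := by
  have hd := ghData_inChart h hu hpos hB p
  have hT := isOpen_extChartAt_target (I := 𝓡 3) p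
  obtain ⟨r, hr, hball⟩ := Metric.isOpen_iff.1 hT _ (mem_extChartAt_target p)
  set β : E3 → E3 →L[ℝ] ℝ := fun e =>
    (2 / b) • Coord.contract (B.inChart p) (F.inChart p) e - B.inChart p e with hβ
  have hβs : ContDiffOn ℝ ∞ β (extChartAt (𝓡 3) p).target :=
    ((Coord.contDiffOn_contract hT (hB.contDiffOn_inChart p) (hF p)).const_smul (2 / b)).sub
      (hB.contDiffOn_inChart p)
  have hdu : ∀ e ∈ (extChartAt (𝓡 3) p).target,
      fderiv ℝ (u ∘ (extChartAt (𝓡 3) p).symm) e (F.inChart p e) =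
        b * (u ∘ (extChartAt (𝓡 3) p).symm) e := by
    intro e he
    rw [← dform_inChart he (hu.mdifferentiableAt (by simp)), Form1.inChart_apply_inChart _ _ he]
    exact hFu _
  have hsym : ∀ e ∈ (extChartAt (𝓡 3) p).target, ∀ x y,
      fderiv ℝ β e x y = fderiv ℝ β e y x := by
    intro e he x y
    obtain ⟨c, ν, hg⟩ := monopoleGerm_inChart (x := p) hvol hu hB hm he
    refine hd.fderiv_contract_symm he hg (hF p) hb hdu (fun X Y => ?_) x y
    rw [← lieDerivative_invChartDeriv hF he]
    exact hFh _ _ _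
  -- The Poincaré lemma on a coordinate ball. The neighbourhood `U` is the image of this ball, hence
  -- connected.
  obtain ⟨vh, hvh⟩ := (convex_ball (extChartAt (𝓡 3) p p) r).exists_forall_hasFDerivAt_of_fderiv_symmetric
    Metric.isOpen_ball ((hβs.mono hball).differentiableOn (by simp)) (fun e he x y => hsym e (hball he) x y)
  have hvs : ContDiffOn ℝ ∞ vh (Metric.ball (extChartAt (𝓡 3) p p) r) := by
    rw [contDiffOn_infty_iff_fderiv_of_isOpen Metric.isOpen_ball]
    exact ⟨fun e he => (hvh e he).differentiableAt.differentiableWithinAt,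
      (hβs.mono hball).congr fun e he => (hvh e he).fderiv⟩
  have hU : (extChartAt (𝓡 3) p).source ∩ extChartAt (𝓡 3) p ⁻¹'
      (Metric.ball (extChartAt (𝓡 3) p p) r) = (extChartAt (𝓡 3) p).symm ''
      (Metric.ball (extChartAt (𝓡 3) p p) r) := by
    ext y
    constructor
    · rintro ⟨hy, hy'⟩
      exact ⟨_, hy', (extChartAt (𝓡 3) p).left_inv hy⟩
    · rintro ⟨e, he, rfl⟩
      exact ⟨(extChartAt (𝓡 3) p).map_target (hball he), by
        rwa [mem_preimage, (extChartAt (𝓡 3) p).right_inv (hball he)]⟩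
  have hUo : IsOpen ((extChartAt (𝓡 3) p).source ∩ extChartAt (𝓡 3) p ⁻¹'
      (Metric.ball (extChartAt (𝓡 3) p p) r)) :=
    (continuousOn_extChartAt p).isOpen_inter_preimage (isOpen_extChartAt_source p)
      Metric.isOpen_ball
  have hv : ContMDiffOn (𝓡 3) 𝓘(ℝ, ℝ) ∞ (vh ∘ extChartAt (𝓡 3) p)
      ((extChartAt (𝓡 3) p).source ∩ extChartAt (𝓡 3) p ⁻¹'
        (Metric.ball (extChartAt (𝓡 3) p p) r)) := by
    refine hvs.contMDiffOn.comp (contMDiffOn_extChartAt.mono ?_) fun y hy => hy.2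
    rw [← extChartAt_source (𝓡 3)]
    exact inter_subset_left
  refine ⟨_, hUo, ?_, ⟨mem_extChartAt_source p, Metric.mem_ball_self hr⟩, vh ∘ extChartAt (𝓡 3) p,
    hv, ?_⟩
  · rw [hU]
    exact ((convex_ball _ _).isConnected ⟨_, Metric.mem_ball_self hr⟩).image _
      ((continuousOn_extChartAt_symm p).mono hball)
  · intro y hy z
    rw [hU] at hy
    obtain ⟨e, he, rfl⟩ := hy
    obtain ⟨L, hL⟩ := isInvertible_invChartDeriv (I := 𝓡 3) (hball he)
    have hvd : MDifferentiableAt (𝓡 3) 𝓘(ℝ, ℝ) (vh ∘ extChartAt (𝓡 3) p)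
        ((extChartAt (𝓡 3) p).symm e) :=
      (hv.contMDiffAt (hUo.mem_nhds (by rw [hU]; exact ⟨e, he, rfl⟩))).mdifferentiableAt (by simp)
    have hz : ∃ Z : E3, invChartDeriv (𝓡 3) p e Z = z := ⟨L.symm z, by
      rw [← hL]; exact L.apply_symm_apply z⟩
    obtain ⟨Z, rfl⟩ := hz
    have h1 : dform (𝓡 3) (vh ∘ extChartAt (𝓡 3) p) ((extChartAt (𝓡 3) p).symm e)
        (invChartDeriv (𝓡 3) p e Z) = β e Z := by
      have hev : (vh ∘ extChartAt (𝓡 3) p) ∘ (extChartAt (𝓡 3) p).symm =ᶠ[𝓝 e] vh :=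
        (hT.eventually_mem (hball he)).mono fun e' he' =>
          congrArg vh ((extChartAt (𝓡 3) p).right_inv he')
      rw [← (hvh e he).fderiv, ← hev.fderiv_eq, ← dform_inChart (hball he) hvd]
      rfl
    have h2 : extDerivForm B ((extChartAt (𝓡 3) p).symm e) (F ((extChartAt (𝓡 3) p).symm e))
        (invChartDeriv (𝓡 3) p e Z) =
        Coord.contract (B.inChart p) (F.inChart p) e Z := by
      rw [Coord.contract_apply, ← hB.extDerivForm_invChartDeriv (hball he),
        invChartDeriv_inChart F (hball he)]
    have h3 : β e Z = 2 / b * Coord.contract (B.inChart p) (F.inChart p) e Z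
      - B ((extChartAt (𝓡 3) p).symm e) (invChartDeriv (𝓡 3) p e Z) := rfl
    rw [h1, h2, h3]
    field_simp
    ring

/-- Existence, uniqueness and the Ricci condition for the flow fields of the ansatz. -/
theorem exists_vertical_solution (hvol : IsVolumeForm h.inner vol) (hb : b ≠ 0)
    (hu : ContMDiff (𝓡 3) 𝓘(ℝ, ℝ) ∞ u) (hpos : ∀ x, 0 < u x) (hB : SmoothForm1 B)
    (hm : IsMonopole h.inner vol u B) (hw : ContMDiff (𝓡 3) 𝓘(ℝ, ℝ) ∞ w)
    (hS : SolvesSystem h.inner a b u B w) (p : N) :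
    ∃ U : Set N, IsOpen U ∧ IsConnected U ∧ p ∈ U ∧ ∃ v f₀ : N → ℝ,
        ContMDiffOn (𝓡 3) 𝓘(ℝ, ℝ) ∞ v U ∧ ContMDiffOn (𝓡 3) 𝓘(ℝ, ℝ) ∞ f₀ U ∧
        VerticalSolitonOn (ghMetric h.inner u (B + dform (𝓡 3) v)) a
          (ansatzField h.inner a b u B (B + dform (𝓡 3) v) w f₀) U ∧
        (∀ W ⊆ U, IsOpen W → IsPreconnected W → ∀ v' f₀' : N → ℝ,
          ContMDiffOn (𝓡 3) 𝓘(ℝ, ℝ) ∞ v' W → ContMDiffOn (𝓡 3) 𝓘(ℝ, ℝ) ∞ f₀' W →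
          VerticalSolitonOn (ghMetric h.inner u (B + dform (𝓡 3) v')) a
            (ansatzField h.inner a b u B (B + dform (𝓡 3) v') w f₀') W →
          (∃ c : ℝ, ∀ x ∈ W, v' x = v x + c) ∧ (∃ c : ℝ, ∀ x ∈ W, f₀' x = f₀ x + c)) ∧
        (∀ W ⊆ U, IsOpen W →
          (IsSolitonFlowOn (ghMetric h.inner u (B + dform (𝓡 3) v)) a
              (ansatzField h.inner a b u B (B + dform (𝓡 3) v) w f₀) (W ×ˢ univ) ↔
            RicciConditionOn h.inner a u B (B + dform (𝓡 3) v) w W)) := by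
  have hF : ∀ x, ContDiffOn ℝ ∞ ((basicField h.inner a u B w).inChart x)
      (extChartAt (𝓡 3) x).target := contDiffOn_basicField a hu hpos hB hw
  have hFu := dform_basicField hpos hS
  have hFh := lieDerivative_basicField hu hpos hB hw hS
  obtain ⟨U, hU, hUc, hpU, v, hv, hvU⟩ := exists_dform_eq hvol hb hu hpos hB hm hF hFu hFh p
  -- The equation `df₀ = -a (B + dv) - u² F♭` becomes `df₀ = -dw - a dv`, since `u² F♭ = dw - a B`.
  have hf₀ : ContMDiffOn (𝓡 3) 𝓘(ℝ, ℝ) ∞ (fun x => -w x - a * v x) U :=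
    hw.contMDiffOn.neg.sub (contMDiffOn_const.mul hv)
  have hvd : ∀ {W : Set N} {g : N → ℝ}, IsOpen W → ContMDiffOn (𝓡 3) 𝓘(ℝ, ℝ) ∞ g W → ∀ x ∈ W,
      MDifferentiableAt (𝓡 3) 𝓘(ℝ, ℝ) g x := fun hW hg x hx =>
    (hg.contMDiffAt (hW.mem_nhds hx)).mdifferentiableAt (by simp)
  have hu2 : ∀ (x : N) (y : E3), u x ^ 2 * h.inner x (basicField h.inner a u B w x) y =
      dform (𝓡 3) w x y - a * B x y := by
    intro x y
    rw [show h.inner x (basicField h.inner a u B w x) y = _ from basicField_apply a x y, ← mul_assoc, mul_inv_cancel₀ (pow_pos (hpos x) 2).ne', one_mul]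
  have hdf₀ : ∀ x ∈ U, ∀ y : E3, dform (𝓡 3) (fun x => -w x - a * v x) x y =
      -dform (𝓡 3) w x y - a * dform (𝓡 3) v x y := by
    intro x hx y
    have hwx : MDifferentiableAt (𝓡 3) 𝓘(ℝ, ℝ) w x := hw.mdifferentiableAt (by simp)
    have hvx := hvd hU hv x hx
    have h1 : dform (𝓡 3) (fun x => -w x - a * v x) x =
        -dform (𝓡 3) w x - a • dform (𝓡 3) v x := by
      have hc : MDifferentiableAt (𝓡 3) 𝓘(ℝ, ℝ) (fun _ : N => a) x := mdifferentiableAt_const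
      have k1 : dform (𝓡 3) (fun x => -w x - a * v x) x =
          dform (𝓡 3) (-w) x - dform (𝓡 3) ((fun _ : N => a) * v) x :=
        mvfderiv_sub hwx.neg (hc.mul hvx)
      have k2 : dform (𝓡 3) (-w) x = -dform (𝓡 3) w x := mvfderiv_neg
      have k3 : dform (𝓡 3) ((fun _ : N => a) * v) x =
          a • dform (𝓡 3) v x + v x • dform (𝓡 3) (fun _ : N => a) x := mvfderiv_mul hc hvx
      have k4 : dform (𝓡 3) (fun _ : N => a) x = 0 := mvfderiv_const a
      rw [k1, k2, k3, k4, smul_zero, add_zero]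
    rw [h1]
    rfl
  have hvert : ∀ x ∈ U, ∀ y : E3, dform (𝓡 3) (fun x => -w x - a * v x) x y
        + a * (B x y + dform (𝓡 3) v x y)
        + u x ^ 2 * h.inner x (basicField h.inner a u B w x) y = 0 ∧
      extDerivForm B x (basicField h.inner a u B w x) y
        = b / 2 * (B x y + dform (𝓡 3) v x y) := by
    intro x hx y
    refine ⟨?_, hvU x hx y⟩
    rw [hu2, hdf₀ x hx]
    ring
  refine ⟨U, hU, hUc, hpU, v, fun x => -w x - a * v x, hv, hf₀, ?_, ?_, ?_⟩
  · rintro ⟨x, t⟩ hx X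
    exact (solitonTensor_vertical_iff hvol hu hpos hB hm hU hv hf₀ hF hx (hFu x)).2
      (hvert x hx) t X
  · intro W hWU hW hWc v' f₀' hv' hf₀' hsol
    have hvert' := fun x (hx : x ∈ W) =>
      (solitonTensor_vertical_iff hvol hu hpos hB hm hW hv' hf₀' hF hx (hFu x)).1
        fun t X => hsol (x, t) hx X
    -- The form `i_F dB` does not involve `v`, so `i_F dB = (b/2) (B + dv)` with `b ≠ 0` determines
    -- `dv`; the other equation then determines `df₀`.
    have hdv : ∀ x ∈ W, ∀ y : E3, dform (𝓡 3) v' x y = dform (𝓡 3) v x y := by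
      intro x hx y
      have h1 := (hvert' x hx y).2
      rw [(hvert x (hWU hx) y).2] at h1
      have := mul_left_cancel₀ (div_ne_zero hb two_ne_zero) h1
      linarith
    have hdf : ∀ x ∈ W, ∀ y : E3, dform (𝓡 3) f₀' x y =
        dform (𝓡 3) (fun x => -w x - a * v x) x y := by
      intro x hx y
      have h1 := (hvert' x hx y).1
      have h2 := (hvert x (hWU hx) y).1
      rw [hdv x hx] at h1
      linarith
    have hgen : ∀ {g g' : N → ℝ}, ContMDiffOn (𝓡 3) 𝓘(ℝ, ℝ) ∞ g W →
        ContMDiffOn (𝓡 3) 𝓘(ℝ, ℝ) ∞ g' W →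
        (∀ x ∈ W, ∀ y : E3, dform (𝓡 3) g' x y = dform (𝓡 3) g x y) →
        ∃ c, ∀ x ∈ W, g' x = g x + c := by
      intro g g' hg hg' hgg
      obtain ⟨c, hc⟩ := exists_eq_const_of_dform_eq_zero hW hWc (hg'.sub hg) fun x hx X => by
        have h1 : dform (𝓡 3) (fun x => g' x - g x) x = dform (𝓡 3) g' x - dform (𝓡 3) g x :=
          mvfderiv_sub (hvd hW hg' x hx) (hvd hW hg x hx)
        rw [h1, sub_apply]
        exact sub_eq_zero.2 (hgg x hx X)
      exact ⟨c, fun x hx => by have h1 : g' x - g x = c := hc x hx; linarith⟩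
    exact ⟨hgen (hv.mono hWU) hv' hdv, hgen (hf₀.mono hWU) hf₀' hdf⟩
  · intro W hWU hW
    have hform := fun x (hx : x ∈ W) t (X Y : E3 × ℝ) =>
      solitonTensor_of_vertical hvol hu hpos hB hm hU hv hf₀ hF (hWU hx) t (hFu x) (hFh x)
        (hvert x (hWU hx)) X Y
    have hric : ∀ x (X Y : E3), (u x)⁻¹ * symProd ((B + dform (𝓡 3) v) x)
        (dform (𝓡 3) w x - a • B x) X Y =
        1 / 2 * u x * ((B x X + dform (𝓡 3) v x X)
          * h.inner x (basicField h.inner a u B w x) Y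
          + (B x Y + dform (𝓡 3) v x Y) * h.inner x (basicField h.inner a u B w x) X) := by
      intro x X Y
      have h1 : symProd ((B + dform (𝓡 3) v) x) (dform (𝓡 3) w x - a • B x) X Y =
        1 / 2 * ((B x X + dform (𝓡 3) v x X) * (dform (𝓡 3) w x Y - a * B x Y)
          + (B x Y + dform (𝓡 3) v x Y) * (dform (𝓡 3) w x X - a * B x X)) := rfl
      have := (hpos x).ne'
      rw [h1, ← hu2, ← hu2]
      field_simp
    constructor
    · intro hs x hx X Y
      have h1 := hs (x, 0) ⟨hx, mem_univ _⟩ ((X, 0) : E3 × ℝ) ((Y, 0) : E3 × ℝ)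
      refine (congrArg (fun r => ricciTensor h.inner x X Y + a * u x * h.inner x X Y - r)
        (hric x X Y)).trans ?_
      exact (hform x hx 0 ((X, 0) : E3 × ℝ) ((Y, 0) : E3 × ℝ)).symm.trans h1
    · rintro hs ⟨x, t⟩ ⟨hx, -⟩ X Y
      refine (hform x hx t X Y).trans ?_
      exact (congrArg (fun r => ricciTensor h.inner x X.1 Y.1 + a * u x * h.inner x X.1 Y.1 - r)
        (hric x X.1 Y.1)).symm.trans (hs x hx X.1 Y.1)

end

/-! ### From the scaling laws of `F` to the system. -/

section

variable {N : Type*} [TopologicalSpace N] [ChartedSpace E3 N] [IsManifold (𝓡 3) ∞ N]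
  {x : N} {e : E3} {h : ContMDiffRiemannianMetric (𝓡 3) ∞ E3 (fun x : N => TangentSpace (𝓡 3) x)}
  {vol : Form3 N} {a b : ℝ} {u w : N → ℝ} {A : Form1 (𝓡 3) N} {F : VField (𝓡 3) N}

theorem repr_eq_of_orthonormal {V ι : Type*} [NormedAddCommGroup V] [NormedSpace ℝ V]
    [Fintype ι] [DecidableEq ι] {g : V →L[ℝ] V →L[ℝ] ℝ} (b : Module.Basis ι ℝ V)
    (hb : ∀ i j, g (b i) (b j) = if i = j then 1 else 0) (X : V) (i : ι) :
    b.repr X i = g X (b i) := by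
  conv_rhs => rw [← b.sum_repr X, map_sum, sum_apply]
  simp only [map_smul, smul_apply, hb, smul_eq_mul, mul_ite, mul_one, mul_zero,
    Finset.sum_ite_eq', Finset.mem_univ, if_true]

/-- Both sums are the trace of the endomorphism `g⁻¹ T`. Harmonicity concerns every orthonormal
basis, whereas the monopole germ supplies one. -/
theorem sum_apply_self_eq_of_orthonormal {V ι κ : Type*} [NormedAddCommGroup V] [NormedSpace ℝ V]
    [FiniteDimensional ℝ V] [Fintype ι] [DecidableEq ι] [Fintype κ] [DecidableEq κ]
    {g : V →L[ℝ] V →L[ℝ] ℝ} (hp : ∀ X, X ≠ 0 → 0 < g X X)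
    (b : Module.Basis ι ℝ V) (c : Module.Basis κ ℝ V)
    (hb : ∀ i j, g (b i) (b j) = if i = j then 1 else 0)
    (hc : ∀ i j, g (c i) (c j) = if i = j then 1 else 0) (T : V →L[ℝ] V →L[ℝ] ℝ) :
    ∑ i, T (b i) (b i) = ∑ k, T (c k) (c k) := by
  obtain ⟨L, hL⟩ := Coord.isInvertible_of_pos hp
  have hgT : ∀ X, g (g.inverse.comp T X) = T X := by
    intro X
    rw [← hL, ContinuousLinearMap.inverse_equiv]
    exact L.apply_symm_apply _
  have h1 := Coord.trace_eq_sum b (g.inverse.comp T)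
  rw [Coord.trace_eq_sum c] at h1
  simp only [repr_eq_of_orthonormal b hb, repr_eq_of_orthonormal c hc, hgT] at h1
  exact h1.symm

theorem covDeriv_dform (hu : ContMDiff (𝓡 3) 𝓘(ℝ, ℝ) ∞ u) (X Y : E3) :
    covDeriv h.inner (dform (𝓡 3) u) x X Y =
      Coord.nabla (Bilin.inChart h.inner x) (fderiv ℝ (u ∘ (extChartAt (𝓡 3) x).symm))
        (extChartAt (𝓡 3) x x) X Y := by
  refine (covDeriv_apply _ _ _ _ _).trans ?_
  have hev : (dform (𝓡 3) u).inChart x =ᶠ[𝓝 (extChartAt (𝓡 3) x x)]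
      fderiv ℝ (u ∘ (extChartAt (𝓡 3) x).symm) :=
    Filter.Eventually.mono (extChartAt_target_mem_nhds_self x) fun e he =>
      dform_inChart he (hu.mdifferentiableAt (by simp))
  rw [Coord.nabla, Coord.nabla, hev.fderiv_eq, hev.eq_of_nhds]

theorem isHarmonic_of_isMonopole (hvol : IsVolumeForm h.inner vol)
    (hu : ContMDiff (𝓡 3) 𝓘(ℝ, ℝ) ∞ u) (hpos : ∀ x, 0 < u x) (hA : SmoothForm1 A)
    (hm : IsMonopole h.inner vol u A) : IsHarmonic h.inner u := by
  intro x b hb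
  obtain ⟨c, ν, hg⟩ := monopoleGerm_inChart (x := x) hvol hu hA hm (mem_extChartAt_target x)
  have hlap := (ghData_inChart h hu hpos hA x).laplacian_eq_zero (mem_extChartAt_target x) hg
  have hb' : ∀ i j, (Bilin.inChart h.inner x (extChartAt (𝓡 3) x x)) (b i) (b j) =
      if i = j then 1 else 0 := fun i j => (Bilin.inChart_self h.inner x (b i) (b j)).trans (hb i j)
  let G := Bilin.inChart h.inner x
  let uh := u ∘ (extChartAt (𝓡 3) x).symm
  let T : E3 →L[ℝ] E3 →L[ℝ] ℝ := fderiv ℝ (fderiv ℝ uh) (extChartAt (𝓡 3) x x) -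
    (ContinuousLinearMap.compL ℝ E3 E3 ℝ (fderiv ℝ uh (extChartAt (𝓡 3) x x))).comp
      (Coord.christoffel G (extChartAt (𝓡 3) x x))
  have hsum : ∑ i, T (b i) (b i) = ∑ k, T (c k) (c k) :=
    sum_apply_self_eq_of_orthonormal
      ((metricOn_inChart h x).pos _ (mem_extChartAt_target x)) b c hb' hg.orthonormal T
  refine Eq.trans ?_ (hsum.trans hlap)
  exact Finset.sum_congr rfl fun i _ => covDeriv_dform hu (b i) (b i)

theorem mlieBracket_eq (V W : VField (𝓡 3) N) (x : N) :
    (VectorField.mlieBracket (𝓡 3) V W x : E3) =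
      fderiv ℝ (W.inChart x) (extChartAt (𝓡 3) x x) (V x)
        - fderiv ℝ (V.inChart x) (extChartAt (𝓡 3) x x) (W x) := by
  have hinv : ∀ (L : E3 →L[ℝ] E3), L = ContinuousLinearMap.id ℝ E3 → ∀ Z, L.inverse Z = Z := by
    rintro _ rfl Z
    rw [ContinuousLinearMap.inverse_id, ContinuousLinearMap.id_apply]
  have hlie : ∀ (V W : E3 → E3) (e : E3), VectorField.lieBracketWithin ℝ V W univ e =
      fderiv ℝ W e (V e) - fderiv ℝ V e (W e) := fun V W e => by
    rw [VectorField.lieBracketWithin_univ]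
    rfl
  change VectorField.mlieBracketWithin (𝓡 3) V W univ x = _
  rw [VectorField.mlieBracketWithin_apply, (𝓡 3).range_eq_univ, preimage_univ, univ_inter,
    VectorField.mpullbackWithin_univ, VectorField.mpullbackWithin_univ]
  refine (hinv _ mfderiv_extChartAt_self _).trans ((hlie _ _ _).trans ?_)
  change fderiv ℝ (W.inChart x) _ (V.inChart x (extChartAt (𝓡 3) x x))
    - fderiv ℝ (V.inChart x) _ (W.inChart x (extChartAt (𝓡 3) x x)) = _
  rw [VField.inChart_self, VField.inChart_self]

theorem inner_ext {X Y : TangentSpace (𝓡 3) x} (hXY : ∀ Z, h.inner x X Z = h.inner x Y Z) :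
    X = Y := by
  by_contra hne
  have h1 := h.pos x (X - Y) (sub_ne_zero.2 hne)
  have h2 : h.inner x (X - Y) = h.inner x X - h.inner x Y := map_sub _ _ _
  rw [h2, sub_apply, hXY, sub_self] at h1
  exact lt_irrefl _ h1

theorem grad_eq_of_dform_eq
    (hdw : ∀ x (y : E3), dform (𝓡 3) w x y = a * A x y + u x ^ 2 * h.inner x (F x) y) (x : N) :
    grad h.inner w x = u x ^ 2 • F x + a • sharp h.inner A x := by
  refine inner_ext (h := h) fun Z => ?_
  rw [grad, sharp_apply, map_add, map_smul, map_smul, add_apply, smul_apply, smul_apply,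
    sharp_apply]
  exact (hdw x Z).trans (add_comm _ _)

theorem eq_basicField_of_dform_eq (hpos : ∀ x, 0 < u x)
    (hdw : ∀ x (y : E3), dform (𝓡 3) w x y = a * A x y + u x ^ 2 * h.inner x (F x) y) :
    F = basicField h.inner a u A w := by
  funext x
  rw [basicField, grad_eq_of_dform_eq hdw, add_sub_cancel_right, smul_smul,
    inv_mul_cancel₀ (pow_pos (hpos x) 2).ne', one_smul]

/-- The converse of `dform_basicField` and `lieDerivative_basicField`, together with the second
equation. For the latter `grad w = u² F + a A♯` is inserted in the Hessian of `u`: the part in `F`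
is `GHData.nabla_scaling`, and the part in `A♯` is `GHData.bracket_sub_lieDeriv`. -/
theorem solvesSystem_of_dform_eq (hvol : IsVolumeForm h.inner vol)
    (hu : ContMDiff (𝓡 3) 𝓘(ℝ, ℝ) ∞ u) (hpos : ∀ x, 0 < u x) (hA : SmoothForm1 A)
    (hm : IsMonopole h.inner vol u A) (hw : ContMDiff (𝓡 3) 𝓘(ℝ, ℝ) ∞ w)
    (hF : ∀ x, ContDiffOn ℝ ∞ (F.inChart x) (extChartAt (𝓡 3) x).target)
    (hFu : ∀ x, dform (𝓡 3) u x (F x) = b * u x)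
    (hFh : ∀ (x : N) (X Y : E3), lieDerivative F h.inner x X Y = -b * h.inner x X Y)
    (hdw : ∀ x (y : E3), dform (𝓡 3) w x y = a * A x y + u x ^ 2 * h.inner x (F x) y) :
    SolvesSystem h.inner a b u A w := by
  have hux := fun x => (hpos x).ne'
  have hgrad := grad_eq_of_dform_eq hdw
  have hdw' : ∀ x (y : E3), dform (𝓡 3) w x y - a * A x y = u x ^ 2 * h.inner x (F x) y :=
    fun x y => by rw [hdw]; ring
  refine ⟨fun x => ?_, fun x => ?_, fun x => ?_⟩
  · rw [hgrad, map_add, map_smul, map_smul, hFu]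
    simp only [smul_eq_mul]
    ring
  all_goals
    have he := mem_extChartAt_target (I := 𝓡 3) x
    have hnhds := extChartAt_target_mem_nhds_self (I := 𝓡 3) x
    have hd := ghData_inChart h hu hpos hA x
    have hA' := hA.contDiffOn_inChart x
    have hFd := ((hF x).contDiffAt hnhds).differentiableAt (by simp)
    have hAd := (hA'.contDiffAt hnhds).differentiableAt (by simp)
    have hWd := ((contDiffOn_sharp (h := h) hA').contDiffAt hnhds).differentiableAt (by simp)
    have hφd := (hd.metric.differentiableAt he).clm_apply hFd
    have hwF : ∀ e ∈ (extChartAt (𝓡 3) x).target, fderiv ℝ (w ∘ (extChartAt (𝓡 3) x).symm) e =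
        a • A.inChart x e + ((u ∘ (extChartAt (𝓡 3) x).symm) e) ^ 2 •
          Bilin.inChart h.inner x e (F.inChart x e) := by
      intro e he
      rw [← dform_inChart he (hw.mdifferentiableAt (by simp))]
      refine ContinuousLinearMap.ext fun Y => ?_
      refine (hdw _ _).trans ?_
      rw [add_apply, smul_apply, smul_apply, Bilin.inChart_apply_inChart _ _ he]
      rfl
    have e5 : (u ∘ (extChartAt (𝓡 3) x).symm) (extChartAt (𝓡 3) x x) = u x := by simp
    have e6 : ∀ Z : E3, fderiv ℝ (u ∘ (extChartAt (𝓡 3) x).symm) (extChartAt (𝓡 3) x x) Z =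
        dform (𝓡 3) u x Z := fun Z => (dform_eq_fderiv (hu.mdifferentiableAt (by simp)) Z).symm
    have e7 : ∀ Z : E3, Bilin.inChart h.inner x (extChartAt (𝓡 3) x x)
        (F.inChart x (extChartAt (𝓡 3) x x)) Z = h.inner x (F x) Z := fun Z => by
      rw [VField.inChart_self]
      exact Bilin.inChart_self _ _ _ _
    have e8 : ∀ Y Z : E3, Coord.lieDeriv (F.inChart x) (Bilin.inChart h.inner x)
        (extChartAt (𝓡 3) x x) Y Z = -b * Bilin.inChart h.inner x (extChartAt (𝓡 3) x x) Y Z :=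
      fun Y Z => ((lieDerivative_apply _ _ _ _ _).symm.trans (hFh x Y Z)).trans
        (congrArg (-b * ·) (Bilin.inChart_self _ _ _ _).symm)
    have e9 : ∀ Y Z : E3, Coord.lieDeriv ((sharp h.inner A).inChart x) (Bilin.inChart h.inner x)
        (extChartAt (𝓡 3) x x) Y Z = lieDerivative (sharp h.inner A) h.inner x Y Z :=
      fun Y Z => (lieDerivative_apply _ _ _ _ _).symm
  · intro (X : E3)
    obtain ⟨c, ν, hg⟩ := monopoleGerm_inChart (x := x) hvol hu hA hm he
    have hgu : ContDiffOn ℝ ∞ ((dform (𝓡 3) u).inChart x) (extChartAt (𝓡 3) x).target :=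
      contDiffOn_dform hu x
    have hnd := ((contDiffOn_sharp (h := h) hgu).contDiffAt hnhds).differentiableAt (by simp)
    have hnu : ∀ᶠ e' in 𝓝 (extChartAt (𝓡 3) x x), Bilin.inChart h.inner x e'
        ((sharp h.inner (dform (𝓡 3) u)).inChart x e') =
          fderiv ℝ (u ∘ (extChartAt (𝓡 3) x).symm) e' :=
      Filter.Eventually.mono hnhds fun e he =>
        (inChart_sharp _ he).trans (dform_inChart he (hu.mdifferentiableAt (by simp)))
    have hwc := (contDiffOn_chart hw x).contDiffAt hnhds
    -- `u² F♭ = dw - a A`, and `d(dw) = 0`.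
    have hext : ∀ Y Z : E3, Coord.extDeriv₁ (fun e' => (u ∘ (extChartAt (𝓡 3) x).symm) e' ^ 2 •
        Bilin.inChart h.inner x e' (F.inChart x e')) (extChartAt (𝓡 3) x x) Y Z =
          -a * Coord.extDeriv₁ (A.inChart x) (extChartAt (𝓡 3) x x) Y Z := by
      intro Y Z
      have hev : (fun e' => (u ∘ (extChartAt (𝓡 3) x).symm) e' ^ 2 •
          Bilin.inChart h.inner x e' (F.inChart x e')) =ᶠ[𝓝 (extChartAt (𝓡 3) x x)]
          (fderiv ℝ (w ∘ (extChartAt (𝓡 3) x).symm) - a • A.inChart x) :=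
        Filter.Eventually.mono hnhds fun e he => by
          rw [Pi.sub_apply, Pi.smul_apply, hwF e he, add_sub_cancel_left]
      have hsym := Coord.isSymmSndFDerivAt_of_contDiffOn (isOpen_extChartAt_target x)
        (contDiffOn_chart hw x) he
      rw [Coord.extDeriv₁, Coord.extDeriv₁, hev.fderiv_eq, fderiv_sub
        ((hwc.fderiv_right (m := ∞) (by simp)).differentiableAt (by simp)) (hAd.const_smul a),
        fderiv_const_smul hAd]
      simp only [sub_apply, smul_apply, smul_eq_mul]
      rw [hsym Y Z]
      ring
    have h1 := hd.nabla_scaling he hg.frame (a := a) (c := b)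
      (φ := fun e => Bilin.inChart h.inner x e (F.inChart x e)) hFd hφd
      (Filter.Eventually.of_forall fun _ => rfl)
      (Filter.Eventually.mono hnhds fun e he => by
        rw [← dform_inChart he (hu.mdifferentiableAt (by simp))]
        exact (Form1.inChart_apply_inChart _ _ he).trans (hFu _)) e8 hext
      (fun y => congrArg (· y) hnu.self_of_nhds) X
    have h2 := hd.bracket_sub_lieDeriv he hg.frame hnd hWd hAd hnu
      (Filter.Eventually.mono hnhds fun e he => inChart_sharp A he) X
    have hlin : ∀ (α β : ℝ) (Y Z : E3), covDeriv h.inner (dform (𝓡 3) u) x (α • Y + β • Z : E3) X =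
        α * covDeriv h.inner (dform (𝓡 3) u) x Y X
          + β * covDeriv h.inner (dform (𝓡 3) u) x Z X := by
      intro α β Y Z
      rw [covDeriv_dform hu, covDeriv_dform hu, covDeriv_dform hu]
      simp only [Coord.nabla, map_add, map_smul, add_apply, smul_apply, smul_eq_mul]
      ring
    have h3 : covDeriv h.inner (dform (𝓡 3) u) x (grad h.inner w x) X = _ :=
      (congrArg (fun Z : E3 => covDeriv h.inner (dform (𝓡 3) u) x Z X) (hgrad x)).trans
        (hlin (u x ^ 2) a (F x) (sharp h.inner A x))
    have h4 : u x * covDeriv h.inner (dform (𝓡 3) u) x (F x) X =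
        -(dform (𝓡 3) u x (grad h.inner u x) * h.inner x (F x) X)
          + 5 / 2 * b * u x * dform (𝓡 3) u x X := by
      rw [VField.inChart_self, VField.inChart_self, e5] at h1
      refine Eq.trans (congrArg (u x * ·) (covDeriv_dform hu (F x) X)) (h1.trans ?_)
      rw [← e6]
      exact congrArg₂ (fun p q : ℝ => -(p * q) + _) (e6 _) (Bilin.inChart_self _ _ _ _)
    have h5 : covDeriv h.inner (dform (𝓡 3) u) x (sharp h.inner A x) X =
        1 / 2 * lieDerivative (sharp h.inner A) h.inner x (grad h.inner u x) X
        - h.inner x (VectorField.mlieBracket (𝓡 3) (grad h.inner u) (sharp h.inner A) x) X := by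
      rw [VField.inChart_self, VField.inChart_self] at h2
      refine (covDeriv_dform hu _ X).trans (h2.symm.trans ?_)
      refine congrArg₂ (fun p q : ℝ => 1 / 2 * p - q) (e9 _ _) ?_
      refine (Bilin.inChart_self _ _ _ _).trans ?_
      exact congrArg (fun Z : E3 => h.inner x Z X) (mlieBracket_eq _ _ x).symm
    have h6 : dform (𝓡 3) w x X - a * A x X = _ := hdw' x X
    have := hux x
    refine h3.trans ?_
    rw [h5, h6]
    field_simp
    linear_combination 2 * u x * h4
  · intro (X : E3) (Y : E3)
    have h1 := hd.nabla_eq he (a := a) (B := A.inChart x)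
      (φ := fun e => Bilin.inChart h.inner x e (F.inChart x e)) (contDiffOn_chart hw x) hWd hFd hAd
      hφd (Filter.Eventually.mono hnhds fun e he => inChart_sharp A he)
      (Filter.Eventually.of_forall fun _ => rfl)
      (Filter.Eventually.mono hnhds hwF) X Y
    have h2 : symProd (dform (𝓡 3) u x) (dform (𝓡 3) w x - a • A x) X Y =
        1 / 2 * (dform (𝓡 3) u x X * (dform (𝓡 3) w x Y - a * A x Y)
          + dform (𝓡 3) u x Y * (dform (𝓡 3) w x X - a * A x X)) := rfl
    have h3 : covDeriv h.inner (dform (𝓡 3) w) x X Y = _ := covDeriv_dform hw X Y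
    have h4 : Bilin.inChart h.inner x (extChartAt (𝓡 3) x x) X Y = h.inner x X Y :=
      Bilin.inChart_self _ _ _ _
    have h5 : dform (𝓡 3) w x X - a * A x X = _ := hdw' x X
    have h6 : dform (𝓡 3) w x Y - a * A x Y = _ := hdw' x Y
    rw [e5, e8, e9, e6, e6, e7, e7, h4] at h1
    have := hux x
    rw [h3, h1, h2, h5, h6]
    field_simp
    ring

end

/-! ### Vectors annihilated by both `du` and `*du`. -/

theorem Coord.IsMonopoleFrame.eq_zero_of_extDeriv₁_eq_zero {E : Type*} [NormedAddCommGroup E]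
    [NormedSpace ℝ E] {G : E → E →L[ℝ] E →L[ℝ] ℝ} {u : E → ℝ} {A : E → E →L[ℝ] ℝ} {e : E}
    {b : Module.Basis (Fin 3) ℝ E} (hb : IsMonopoleFrame G u A e b) {V : E}
    (hu : fderiv ℝ u e V = 0) (hA : ∀ y, extDeriv₁ A e V y = 0) (hne : fderiv ℝ u e ≠ 0) :
    V = 0 := by
  have h0 := hA (b 0)
  have h1 := hA (b 1)
  have h2 := hA (b 2)
  rw [hb.extDeriv₁_eq] at h0 h1 h2
  simp only [hb.orthonormal, Fin.isValue, Fin.reduceEq, if_true, if_false, mul_one, mul_zero,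
    zero_mul, sub_zero, zero_sub, add_zero, zero_add] at h0 h1 h2
  have hV := Coord.eq_sum_of_orthonormal b hb.orthonormal V
  rw [hV] at hu
  simp only [map_add, map_smul, smul_eq_mul] at hu
  generalize G e V (b 0) = p at *
  generalize G e V (b 1) = q at *
  generalize G e V (b 2) = r at *
  have hpos : 0 < fderiv ℝ u e (b 0) ^ 2 + fderiv ℝ u e (b 1) ^ 2 + fderiv ℝ u e (b 2) ^ 2 := by
    by_contra hle
    refine hne (ContinuousLinearMap.ext fun y => ?_)
    have k0 : fderiv ℝ u e (b 0) = 0 := by nlinarith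
    have k1 : fderiv ℝ u e (b 1) = 0 := by nlinarith
    have k2 : fderiv ℝ u e (b 2) = 0 := by nlinarith
    rw [Coord.eq_sum_of_orthonormal b hb.orthonormal y]
    simp [k0, k1, k2]
  generalize fderiv ℝ u e (b 0) = u0 at *
  generalize fderiv ℝ u e (b 1) = u1 at *
  generalize fderiv ℝ u e (b 2) = u2 at *
  -- In vector notation with `m = grad u`: `|m|² V = (V · m) m + m × (V × m)`, where both `V · m`
  -- and `V × m` vanish.
  have hp : (u0 ^ 2 + u1 ^ 2 + u2 ^ 2) * p = 0 := by
    linear_combination u0 * hu - u1 * h2 + u2 * h1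
  have hq : (u0 ^ 2 + u1 ^ 2 + u2 ^ 2) * q = 0 := by
    linear_combination u1 * hu + u0 * h2 - u2 * h0
  have hr : (u0 ^ 2 + u1 ^ 2 + u2 ^ 2) * r = 0 := by
    linear_combination u2 * hu + u1 * h0 - u0 * h1
  rw [hV, (mul_eq_zero.1 hp).resolve_left hpos.ne', (mul_eq_zero.1 hq).resolve_left hpos.ne',
    (mul_eq_zero.1 hr).resolve_left hpos.ne']
  simp

/-! ### Restriction of functions on `N × ℝ` to slices and fibres. -/

section

variable {N : Type*} [TopologicalSpace N] [ChartedSpace E3 N]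
  {x : N} {f : N × ℝ → ℝ}

theorem contMDiff_slice [IsManifold (𝓡 3) ∞ N] (hf : ContMDiff I4 𝓘(ℝ, ℝ) ∞ f) (t : ℝ) :
    ContMDiff (𝓡 3) 𝓘(ℝ, ℝ) ∞ (fun y : N => f (y, t)) :=
  hf.comp (contMDiff_id.prodMk contMDiff_const)

theorem dform_slice {t : ℝ} (hf : MDifferentiableAt I4 𝓘(ℝ, ℝ) f (x, t)) (y : E3) :
    dform (𝓡 3) (fun y : N => f (y, t)) x y = dform I4 f (x, t) ((y, 0) : E3 × ℝ) := by
  have h1 : HasMFDerivAt (𝓡 3) I4 (fun y : N => (y, t)) x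
      (ContinuousLinearMap.inl ℝ E3 ℝ) := by
    have h2 : MDifferentiableAt (𝓡 3) I4 (fun y : N => (y, t)) x :=
      mdifferentiableAt_id.prodMk mdifferentiableAt_const
    have h3 := h2.hasMFDerivAt
    rw [mfderiv_prod_left] at h3
    exact h3
  have h4 := hf.hasMFDerivAt.comp x h1
  exact congrArg (fun L : E3 →L[ℝ] ℝ => L y) h4.mfderiv

theorem hasDerivAt_fiber {t : ℝ} (hf : MDifferentiableAt I4 𝓘(ℝ, ℝ) f (x, t)) :
    HasDerivAt (fun s => f (x, s)) (dform I4 f (x, t) ((0, 1) : E3 × ℝ)) t := by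
  have h1 : HasMFDerivAt 𝓘(ℝ, ℝ) I4 (fun s : ℝ => (x, s)) t
      (ContinuousLinearMap.inr ℝ E3 ℝ) := by
    have h2 : MDifferentiableAt 𝓘(ℝ, ℝ) I4 (fun s : ℝ => (x, s)) t :=
      mdifferentiableAt_const.prodMk mdifferentiableAt_id
    have h3 := h2.hasMFDerivAt
    rw [mfderiv_prod_right] at h3
    exact h3
  have h4 := hf.hasMFDerivAt.comp t h1
  have h5 : HasFDerivAt (fun s : ℝ => f (x, s)) ((dform I4 f (x, t) : E3 × ℝ →L[ℝ] ℝ).comp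
      (ContinuousLinearMap.inr ℝ E3 ℝ)) t := hasMFDerivAt_iff_hasFDerivAt.1 h4
  exact h5.hasDerivAt

end

/-! ### Killing fields on a connected manifold. -/

section

variable {N : Type*} [TopologicalSpace N] [ChartedSpace E3 N] [IsManifold (𝓡 3) ∞ N]
  {x : N} {h : ContMDiffRiemannianMetric (𝓡 3) ∞ E3 (fun x : N => TangentSpace (𝓡 3) x)}
  {vol : Form3 N} {a b : ℝ} {u : N → ℝ} {A : Form1 (𝓡 3) N} {f : N × ℝ → ℝ} {F : VField (𝓡 3) N}

theorem VField.inChart_eq_zero_iff {e : E3} (he : e ∈ (extChartAt (𝓡 3) x).target) :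
    F.inChart x e = 0 ↔ F ((extChartAt (𝓡 3) x).symm e) = 0 := by
  constructor
  · intro h0
    rw [← invChartDeriv_inChart F he, h0, map_zero]
  · intro h0
    change (invChartDeriv (𝓡 3) x e).inverse _ = 0
    rw [h0, map_zero]

theorem VField.eventually_inChart_eq_zero_iff {y : N} (hy : y ∈ (extChartAt (𝓡 3) x).source) :
    (∀ᶠ e in 𝓝 (extChartAt (𝓡 3) x y), F.inChart x e = 0) ↔ ∀ᶠ z in 𝓝 y, F z = 0 := by
  constructor
  · intro h0
    filter_upwards [(continuousAt_extChartAt' hy).eventually h0,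
      (isOpen_extChartAt_source x).eventually_mem hy] with z hz hz'
    have h1 := (VField.inChart_eq_zero_iff ((extChartAt (𝓡 3) x).map_source hz')).1 hz
    rwa [(extChartAt (𝓡 3) x).left_inv hz'] at h1
  · intro h0
    have hy' := (extChartAt (𝓡 3) x).map_source hy
    have hc := continuousAt_extChartAt_symm'' hy'
    rw [ContinuousAt, (extChartAt (𝓡 3) x).left_inv hy] at hc
    filter_upwards [hc.eventually h0, (isOpen_extChartAt_target x).eventually_mem hy']
      with e he he'
    exact (VField.inChart_eq_zero_iff he').2 he

/-- A Killing field on a connected manifold vanishing on a nonempty open set is zero. -/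
theorem eq_zero_of_killing_of_eventually_eq_zero [PreconnectedSpace N]
    (hF : ∀ x, ContDiffOn ℝ ∞ (F.inChart x) (extChartAt (𝓡 3) x).target)
    (hkill : ∀ (x : N) (X Y : E3), lieDerivative F h.inner x X Y = 0)
    (h0 : ∀ᶠ y in 𝓝 x, F y = 0) (y : N) : F y = 0 := by
  have hopen : IsOpen {x | ∀ᶠ y in 𝓝 x, F y = 0} := isOpen_setOfPred_eventually_nhds
  have hclosed : IsClosed {x | ∀ᶠ y in 𝓝 x, F y = 0} := by
    refine isClosed_of_closure_subset fun z hz => ?_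
    rw [mem_closure_iff_frequently] at hz
    have hT := isOpen_extChartAt_target (I := 𝓡 3) z
    have he := mem_extChartAt_target (I := 𝓡 3) z
    have hnhds := hT.mem_nhds he
    -- At a limit of interior zeros the field and its first derivative vanish by continuity. Unique
    -- continuation then makes the limit an interior zero, so the set of interior zeros is closed as
    -- well as open.
    have hz' : ∃ᶠ y in 𝓝 z, F.inChart z (extChartAt (𝓡 3) z y) = 0 ∧
        fderiv ℝ (F.inChart z) (extChartAt (𝓡 3) z y) = 0 := by
      refine (hz.and_eventually (extChartAt_source_mem_nhds (I := 𝓡 3) z)).mono ?_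
      rintro y ⟨hy, hy'⟩
      have hev := (VField.eventually_inChart_eq_zero_iff hy').2 hy
      refine ⟨hev.self_of_nhds, ?_⟩
      have : F.inChart z =ᶠ[𝓝 (extChartAt (𝓡 3) z y)] fun _ => 0 := hev
      rw [this.fderiv_eq]
      simp
    have hcz := continuousAt_extChartAt (I := 𝓡 3) z
    have c0 : ContinuousAt (fun y => F.inChart z (extChartAt (𝓡 3) z y)) z :=
      ((hF z).continuousOn.continuousAt hnhds).comp hcz
    have c1 : ContinuousAt (fun y => fderiv ℝ (F.inChart z) (extChartAt (𝓡 3) z y)) z :=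
      ContinuousAt.comp (g := fderiv ℝ (F.inChart z))
        ((((hF z).fderiv_of_isOpen hT (m := ∞) (by simp)).continuousOn).continuousAt hnhds) hcz
    have e0 : F.inChart z (extChartAt (𝓡 3) z z) = 0 := by
      by_contra hne
      exact hz' ((c0.eventually_ne hne).mono fun y hy h => hy h.1)
    have e1 : fderiv ℝ (F.inChart z) (extChartAt (𝓡 3) z z) = 0 := by
      by_contra hne
      exact hz' ((c1.eventually_ne hne).mono fun y hy h => hy h.2)
    have := (metricOn_inChart h z).eventually_eq_zero_of_killing he (hF z)
      (fun e he X Y => (lieDerivative_invChartDeriv hF he X Y).symm.trans (hkill _ _ _)) e0 e1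
    exact (VField.eventually_inChart_eq_zero_iff (mem_extChartAt_source z)).1 this
  have huniv := IsClopen.eq_univ ⟨hclosed, hopen⟩ ⟨x, h0⟩
  have hy : y ∈ {x | ∀ᶠ y in 𝓝 x, F y = 0} := huniv ▸ mem_univ y
  exact Filter.Eventually.self_of_nhds (p := fun z => F z = 0) hy

/-- A field annihilating `u` and contracting `dA = *du` to zero vanishes where `du ≠ 0`. -/
theorem eq_zero_of_extDerivForm_eq_zero (hvol : IsVolumeForm h.inner vol)
    (hu : ContMDiff (𝓡 3) 𝓘(ℝ, ℝ) ∞ u) (hA : SmoothForm1 A)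
    (hm : IsMonopole h.inner vol u A) {V : E3} (hV : dform (𝓡 3) u x V = 0)
    (hAV : ∀ y : E3, extDerivForm A x V y = 0) (hne : dform (𝓡 3) u x ≠ 0) : V = 0 := by
  obtain ⟨c, ν, hg⟩ := monopoleGerm_inChart (x := x) hvol hu hA hm (mem_extChartAt_target x)
  have hdu := fun Z => dform_eq_fderiv (x := x) (hu.mdifferentiableAt (by simp)) Z
  refine hg.frame.eq_zero_of_extDeriv₁_eq_zero ((hdu V).symm.trans hV)
    (fun y => (extDerivForm_apply _ _ _ _).symm.trans (hAV y)) fun h0 => hne ?_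
  refine ContinuousLinearMap.ext fun Z => (hdu Z).trans ?_
  rw [h0]
  rfl

/-- A nonconstant `u` has `du ≠ 0` on a nonempty open set, where `F` vanishes algebraically; the
Killing property spreads this over `N`. This excludes `b = 0` in part (2). -/
theorem eq_zero_of_killing_of_extDerivForm_eq_zero [ConnectedSpace N]
    (hvol : IsVolumeForm h.inner vol)
    (hu : ContMDiff (𝓡 3) 𝓘(ℝ, ℝ) ∞ u) (hnc : ¬ ∃ c : ℝ, ∀ x, u x = c) (hA : SmoothForm1 A)
    (hm : IsMonopole h.inner vol u A)
    (hF : ∀ x, ContDiffOn ℝ ∞ (F.inChart x) (extChartAt (𝓡 3) x).target)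
    (hFu : ∀ x, dform (𝓡 3) u x (F x) = 0)
    (hFA : ∀ (x : N) (y : E3), extDerivForm A x (F x) y = 0)
    (hkill : ∀ (x : N) (X Y : E3), lieDerivative F h.inner x X Y = 0) (y : N) : F y = 0 := by
  have hex : ∃ x, dform (𝓡 3) u x ≠ 0 := by
    by_contra! hall
    obtain ⟨c, hc⟩ := exists_eq_const_of_dform_eq_zero isOpen_univ isPreconnected_univ
      hu.contMDiffOn fun x _ X => by rw [hall x]; rfl
    exact hnc ⟨c, fun x => hc x (mem_univ x)⟩
  obtain ⟨z, hz⟩ := hex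
  refine eq_zero_of_killing_of_eventually_eq_zero (x := z) hF hkill ?_ y
  rw [← VField.eventually_inChart_eq_zero_iff (mem_extChartAt_source z)]
  have he := mem_extChartAt_target (I := 𝓡 3) z
  have hnhds := (isOpen_extChartAt_target (I := 𝓡 3) z).mem_nhds he
  have hne : (dform (𝓡 3) u).inChart z (extChartAt (𝓡 3) z z) ≠ 0 := fun h0 => hz <|
    ContinuousLinearMap.ext fun X => (Form1.inChart_self _ _ _).symm.trans (by rw [h0]; rfl)
  filter_upwards [((contDiffOn_dform hu z).continuousOn.continuousAt hnhds).eventually_ne hne,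
    hnhds] with e h1 h2
  rw [VField.inChart_eq_zero_iff h2]
  refine eq_zero_of_extDerivForm_eq_zero hvol hu hA hm (hFu _) (hFA _) fun h3 => h1 ?_
  rw [Form1.inChart, h3]
  rfl

end

/-! ### Soliton flows of the given shape arise from the system: part (2). -/

section

variable {N : Type*} [TopologicalSpace N] [ChartedSpace E3 N] [IsManifold (𝓡 3) ∞ N]
  {x : N} {h : ContMDiffRiemannianMetric (𝓡 3) ∞ E3 (fun x : N => TangentSpace (𝓡 3) x)}
  {vol : Form3 N} {a b : ℝ} {u : N → ℝ} {A : Form1 (𝓡 3) N} {f : N × ℝ → ℝ} {F : VField (𝓡 3) N}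

/-- The components of the soliton equation for `f ∂/∂t + t F`. -/
theorem components_of_isSolitonFlowOn (hvol : IsVolumeForm h.inner vol)
    (hu : ContMDiff (𝓡 3) 𝓘(ℝ, ℝ) ∞ u) (hpos : ∀ x, 0 < u x) (hA : SmoothForm1 A)
    (hm : IsMonopole h.inner vol u A) (hf : ContMDiff I4 𝓘(ℝ, ℝ) ∞ f)
    (hF : ∀ x, ContDiffOn ℝ ∞ (F.inChart x) (extChartAt (𝓡 3) x).target)
    (hs : IsSolitonFlowOn (ghMetric h.inner u A) a (flowField A f F) univ) (x : N) (t : ℝ) :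
    dform I4 f (x, t) ((0, 1) : E3 × ℝ) = -a + t / 2 * (dform (𝓡 3) u x (F x) / u x) ∧
    (∀ y : E3, dform I4 f (x, t) ((y, 0) : E3 × ℝ) =
      A x y * (-a + t / 2 * (dform (𝓡 3) u x (F x) / u x)) - u x ^ 2 * h.inner x (F x) y
        - t * extDerivForm A x (F x) y) ∧
    ∀ X Y : E3, ricciTensor h.inner x X Y + a * u x * h.inner x X Y
      - 1 / 2 * u x * (A x X * h.inner x (F x) Y + A x Y * h.inner x (F x) X)
      + t / 2 * (dform (𝓡 3) u x (F x) * h.inner x X Y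
        + u x * lieDerivative F h.inner x X Y) = 0 := by
  have hux := (hpos x).ne'
  have z1 : ∀ y : E3, ricciTensor h.inner x (0 : E3) y = 0 := fun y =>
    (ricciTensor_apply _ _ _ _).trans (Coord.ricci_zero_left _ _ _)
  have z2 : ∀ y : E3, lieDerivative F h.inner x (0 : E3) y = 0 := fun y =>
    (lieDerivative_apply _ _ _ _ _).trans (by simp [Coord.lieDeriv])
  have z3 : extDerivForm A x (F x) (0 : E3) = 0 :=
    (extDerivForm_apply _ _ _ _).trans (by simp [Coord.extDeriv₁]; rfl)
  have z4 : ∀ y : E3, h.inner x (0 : E3) y = 0 := fun y => by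
    rw [show h.inner x (0 : E3) = 0 from map_zero _]; rfl
  have z5 : h.inner x (F x) (0 : E3) = 0 := map_zero _
  have z6 : A x (0 : E3) = 0 := map_zero _
  obtain ⟨c, ν, hg⟩ := monopoleGerm_inChart (x := x) hvol hu hA hm (mem_extChartAt_target x)
  have hS : ∀ X Y : E3 × ℝ, _ = (0 : ℝ) := fun X Y =>
    (solitonTensor_ghMetric (t := t) (f := f) (F := F) (ghData_inChart h hu hpos hA x)
    (mem_extChartAt_target x) hg (hu.mdifferentiableAt (by simp)) (hf.mdifferentiableAt (by simp))
    (((hF x).contDiffAt (extChartAt_target_mem_nhds_self x)).differentiableAt (by simp)) a X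
    Y).symm.trans (hs (x, t) (mem_univ _) X Y)
  have hlin : ∀ (y : E3) (s : ℝ), dform I4 f (x, t) ((y, s) : E3 × ℝ) =
      dform I4 f (x, t) ((y, 0) : E3 × ℝ) + s * dform I4 f (x, t) ((0, 1) : E3 × ℝ) := by
    have key : ∀ (L : E3 × ℝ →L[ℝ] ℝ) (y : E3) (s : ℝ), L (y, s) = L (y, 0) + s * L (0, 1) := by
      intro L y s
      rw [← smul_eq_mul, ← map_smul, ← map_add]
      simp
    exact key _
  have h1 := hS (0, 1) (0, 1)
  simp only [z1, z2, z3, z4, z5, z6] at h1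
  have hVV : dform I4 f (x, t) ((0, 1) : E3 × ℝ) =
      -a + t / 2 * (dform (𝓡 3) u x (F x) / u x) := by
    field_simp at h1 ⊢
    linarith
  refine ⟨hVV, fun y => ?_, fun X Y => ?_⟩
  -- Pairing `∂/∂t` with the horizontal lift of `y` gives the mixed equation; two horizontal lifts
  -- give the last one.
  · have h2 := hS (0, 1) (y, -A x y)
    simp only [z1, z2, z3, z4, z5, z6, hlin y (-A x y), hVV] at h2
    field_simp at h2 ⊢
    linarith
  · have h2 := hS (X, -A x X) (Y, -A x Y)
    simp only [neg_add_cancel, mul_zero, zero_mul, add_zero] at h2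
    rw [← h2]
    ring

theorem eq_add_of_hasDerivAt {φ : ℝ → ℝ} {a c : ℝ} (hφ : ∀ t, HasDerivAt φ (-a + t / 2 * c) t)
    (t : ℝ) : φ t = φ 0 - a * t + 1 / 4 * c * t ^ 2 := by
  have h1 : ∀ t, HasDerivAt (fun s => φ s - (-a * s + 1 / 4 * c * s ^ 2)) 0 t := by
    intro t
    have h2 := (hφ t).sub (((hasDerivAt_id t).const_mul (-a)).add
      (((hasDerivAt_id t).pow 2).const_mul (1 / 4 * c)))
    refine h2.congr_deriv ?_
    simp
    ring
  have h3 := is_const_of_deriv_eq_zero (fun t => (h1 t).differentiableAt) (fun t => (h1 t).deriv) t 0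
  linarith

theorem exists_of_isSolitonFlowOn [ConnectedSpace N] (hvol : IsVolumeForm h.inner vol)
    (hu : ContMDiff (𝓡 3) 𝓘(ℝ, ℝ) ∞ u) (hpos : ∀ x, 0 < u x)
    (hnc : ¬ ∃ c : ℝ, ∀ x, u x = c) (hA : SmoothForm1 A)
    (hm : IsMonopole h.inner vol u A) (hf : ContMDiff I4 𝓘(ℝ, ℝ) ∞ f)
    (hF : ∀ x, ContDiffOn ℝ ∞ (F.inChart x) (extChartAt (𝓡 3) x).target) (hF0 : ∃ x, F x ≠ 0)
    (hs : IsSolitonFlowOn (ghMetric h.inner u A) a (flowField A f F) univ) :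
    ∃ (b : ℝ) (w f₀ : N → ℝ), b ≠ 0 ∧ ContMDiff (𝓡 3) 𝓘(ℝ, ℝ) ∞ w ∧
      SolvesSystem h.inner a b u A w ∧ ContMDiff (𝓡 3) 𝓘(ℝ, ℝ) ∞ f₀ ∧
      flowField A f F = ansatzField h.inner a b u A A w f₀ ∧
      RicciConditionOn h.inner a u A A w univ := by
  have hcomp := components_of_isSolitonFlowOn hvol hu hpos hA hm hf hF hs
  have hfd : ∀ p, MDifferentiableAt I4 𝓘(ℝ, ℝ) f p := fun p => hf.mdifferentiableAt (by simp)
  have hft : ∀ x t, f (x, t) = f (x, 0) - a * t +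
      1 / 4 * (dform (𝓡 3) u x (F x) / u x) * t ^ 2 := fun x t =>
    eq_add_of_hasDerivAt (φ := fun t => f (x, t))
      (fun t => (hasDerivAt_fiber (hfd (x, t))).congr_deriv (hcomp x t).1) t
  have hdf : ∀ x t (y : E3), HasMFDerivAt (𝓡 3) 𝓘(ℝ, ℝ) (fun y : N => f (y, t)) x
      (dform (𝓡 3) (fun y : N => f (y, t)) x) := fun x t _ =>
    ((contMDiff_slice hf t).mdifferentiableAt (by simp)).hasMFDerivAt
  -- The second difference `f(·, 1) + f(·, -1) - 2 f(·, 0)` equals `½ F(u)/u`. Its differential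
  -- vanishes, because the differential of `f` along slices is affine in `t`. So `F(u)/u` is
  -- constant on the connected `N`, namely twice the constant `c`.
  obtain ⟨b, hb⟩ : ∃ b, ∀ x, dform (𝓡 3) u x (F x) = b * u x := by
    obtain ⟨c, hc⟩ := exists_eq_const_of_dform_eq_zero isOpen_univ isPreconnected_univ
      (g := (fun y : N => f (y, 1)) + (fun y : N => f (y, -1)) - (2 : ℝ) • fun y : N => f (y, 0))
      (((contMDiff_slice hf 1).add (contMDiff_slice hf (-1))).sub
        ((contDiff_const_smul (n := ∞) (2 : ℝ)).contMDiff.comp (contMDiff_slice hf 0))).contMDiffOn (by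
        intro x _ (y : E3)
        have h1 := ((hdf x 1 y).add (hdf x (-1) y)).sub ((hdf x 0 y).const_smul (2 : ℝ))
        refine (congrArg (fun L : E3 →L[ℝ] ℝ => L y) h1.mfderiv).trans ?_
        change dform (𝓡 3) (fun y : N => f (y, 1)) x y + dform (𝓡 3) (fun y : N => f (y, -1)) x y
          - 2 * dform (𝓡 3) (fun y : N => f (y, 0)) x y = 0
        rw [dform_slice (hfd _), dform_slice (hfd _), dform_slice (hfd _), (hcomp x 1).2.1,
          (hcomp x (-1)).2.1, (hcomp x 0).2.1]
        ring)
    refine ⟨2 * c, fun x => ?_⟩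
    have h1 := hc x (mem_univ x)
    simp only [Pi.sub_apply, Pi.add_apply, Pi.smul_apply, smul_eq_mul] at h1
    rw [hft x 1, hft x (-1)] at h1
    have hux := (hpos x).ne'
    field_simp at h1
    linarith
  have hb' : ∀ x, dform (𝓡 3) u x (F x) / u x = b := fun x => by
    rw [hb, mul_div_cancel_right₀ _ (hpos x).ne']
  simp only [hb'] at hcomp hft
  -- The odd difference `f(·, 1) - f(·, -1)` is the constant `-2a`, so the coefficient `(b/2) A -
  -- i_F dA` of `t` in the slice differential vanishes.
  have hFA : ∀ (x : N) (y : E3), extDerivForm A x (F x) y = b / 2 * A x y := by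
    intro x y
    have h1 := (hdf x 1 y).sub (hdf x (-1) y)
    have h2 : ((fun y : N => f (y, 1)) - fun y : N => f (y, -1)) = fun _ => -2 * a := by
      funext z
      rw [Pi.sub_apply, hft z 1, hft z (-1)]
      ring
    rw [h2] at h1
    have h3 := congrArg (fun L : E3 →L[ℝ] ℝ => L y)
      (h1.mfderiv.symm.trans (hasMFDerivAt_const _ _).mfderiv)
    change dform (𝓡 3) (fun y : N => f (y, 1)) x y - dform (𝓡 3) (fun y : N => f (y, -1)) x y
      = 0 at h3
    rw [dform_slice (hfd _), dform_slice (hfd _), (hcomp x 1).2.1, (hcomp x (-1)).2.1] at h3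
    linarith
  -- The horizontal equation at `t = 1` minus the one at `t = 0`.
  have hFh : ∀ (x : N) (X Y : E3), lieDerivative F h.inner x X Y = -b * h.inner x X Y := by
    intro x X Y
    have h0 := (hcomp x 0).2.2 X Y
    have h1 := (hcomp x 1).2.2 X Y
    rw [hb] at h0 h1
    refine mul_left_cancel₀ (hpos x).ne' ?_
    linarith
  have hb0 : b ≠ 0 := by
    rintro rfl
    obtain ⟨y, hy⟩ := hF0
    exact hy (eq_zero_of_killing_of_extDerivForm_eq_zero hvol hu hnc hA hm hF
      (fun x => by rw [hb, zero_mul]) (fun x y => by rw [hFA, zero_div, zero_mul])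
      (fun x X Y => by rw [hFh, neg_zero, zero_mul]) y)
  -- At `t = 0` the mixed equation is `df₀ = -a A - u² F♭`, so `w = -f₀` satisfies `grad w - a A♯ =
  -- u² F`.
  have hw : ContMDiff (𝓡 3) 𝓘(ℝ, ℝ) ∞ (-fun y : N => f (y, 0)) := (contMDiff_slice hf 0).neg
  have hdw : ∀ x (y : E3), dform (𝓡 3) (-fun y : N => f (y, 0)) x y =
      a * A x y + u x ^ 2 * h.inner x (F x) y := by
    intro x y
    refine (congrArg (fun L : E3 →L[ℝ] ℝ => L y) (hdf x 0 y).neg.mfderiv).trans ?_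
    change -dform (𝓡 3) (fun y : N => f (y, 0)) x y = _
    rw [dform_slice (hfd _), (hcomp x 0).2.1]
    ring
  refine ⟨b, -fun y : N => f (y, 0), fun y => f (y, 0), hb0, hw,
    solvesSystem_of_dform_eq hvol hu hpos hA hm hw hF hb hFh hdw, contMDiff_slice hf 0, ?_, ?_⟩
  · rw [ansatzField, ← eq_basicField_of_dform_eq hpos hdw]
    congr 1
    funext ⟨x, t⟩
    exact hft x t
  · intro x _ (X : E3) (Y : E3)
    have h2 : symProd (A x) (dform (𝓡 3) (-fun y : N => f (y, 0)) x - a • A x) X Y =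
        1 / 2 * (A x X * (dform (𝓡 3) (-fun y : N => f (y, 0)) x Y - a * A x Y)
          + A x Y * (dform (𝓡 3) (-fun y : N => f (y, 0)) x X - a * A x X)) := rfl
    have hux := (hpos x).ne'
    rw [h2, hdw, hdw]
    refine Eq.trans ?_ ((hcomp x 0).2.2 X Y)
    field_simp
    ring

end

theorem theorem4p5 {N : Type*} [TopologicalSpace N] [T2Space N]
    [ChartedSpace E3 N] [IsManifold (𝓡 3) ω N]
    (h : ContMDiffRiemannianMetric (𝓡 3) ω E3 (fun x : N => TangentSpace (𝓡 3) x))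
    (vol : Form3 N) (hvol : IsVolumeForm h.inner vol) (a : ℝ) :
    (∀ (b : ℝ) (u : N → ℝ) (B : Form1 (𝓡 3) N) (w : N → ℝ), b ≠ 0 →
      ContMDiff (𝓡 3) 𝓘(ℝ, ℝ) ∞ u → (∀ x, 0 < u x) → IsHarmonic h.inner u →
      SmoothForm1 B → IsMonopole h.inner vol u B →
      ContMDiff (𝓡 3) 𝓘(ℝ, ℝ) ∞ w → SolvesSystem h.inner a b u B w →
      ∀ p : N, ∃ U : Set N, IsOpen U ∧ IsConnected U ∧ p ∈ U ∧ ∃ v f₀ : N → ℝ,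
        ContMDiffOn (𝓡 3) 𝓘(ℝ, ℝ) ∞ v U ∧ ContMDiffOn (𝓡 3) 𝓘(ℝ, ℝ) ∞ f₀ U ∧
        VerticalSolitonOn (ghMetric h.inner u (B + dform (𝓡 3) v)) a
          (ansatzField h.inner a b u B (B + dform (𝓡 3) v) w f₀) U ∧
        (∀ W ⊆ U, IsOpen W → IsPreconnected W → ∀ v' f₀' : N → ℝ,
          ContMDiffOn (𝓡 3) 𝓘(ℝ, ℝ) ∞ v' W → ContMDiffOn (𝓡 3) 𝓘(ℝ, ℝ) ∞ f₀' W →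
          VerticalSolitonOn (ghMetric h.inner u (B + dform (𝓡 3) v')) a
            (ansatzField h.inner a b u B (B + dform (𝓡 3) v') w f₀') W →
          (∃ c : ℝ, ∀ x ∈ W, v' x = v x + c) ∧ (∃ c : ℝ, ∀ x ∈ W, f₀' x = f₀ x + c)) ∧
        (∀ W ⊆ U, IsOpen W →
          (IsSolitonFlowOn (ghMetric h.inner u (B + dform (𝓡 3) v)) a
              (ansatzField h.inner a b u B (B + dform (𝓡 3) v) w f₀) (W ×ˢ univ) ↔
            RicciConditionOn h.inner a u B (B + dform (𝓡 3) v) w W))) ∧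
    (ConnectedSpace N → ∀ (u : N → ℝ) (A : Form1 (𝓡 3) N) (f : N × ℝ → ℝ) (F : VField (𝓡 3) N),
      ContMDiff (𝓡 3) 𝓘(ℝ, ℝ) ∞ u → (∀ x, 0 < u x) → (¬ ∃ c : ℝ, ∀ x, u x = c) →
      SmoothForm1 A → IsMonopole h.inner vol u A →
      ContMDiff I4 𝓘(ℝ, ℝ) ∞ f → SmoothVField F → (∃ x, F x ≠ 0) →
      IsSolitonFlowOn (ghMetric h.inner u A) a (flowField A f F) univ →
      ∃ (b : ℝ) (B : Form1 (𝓡 3) N) (w v f₀ : N → ℝ), b ≠ 0 ∧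
        IsHarmonic h.inner u ∧
        SmoothForm1 B ∧ IsMonopole h.inner vol u B ∧
        ContMDiff (𝓡 3) 𝓘(ℝ, ℝ) ∞ w ∧ SolvesSystem h.inner a b u B w ∧
        ContMDiff (𝓡 3) 𝓘(ℝ, ℝ) ∞ v ∧ ContMDiff (𝓡 3) 𝓘(ℝ, ℝ) ∞ f₀ ∧
        A = B + dform (𝓡 3) v ∧
        flowField A f F = ansatzField h.inner a b u B A w f₀ ∧
        RicciConditionOn h.inner a u B A w univ) := by
  have := IsManifold.of_le (I := 𝓡 3) (M := N) (m := ∞) (n := ω) le_top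
  let h' : ContMDiffRiemannianMetric (𝓡 3) ∞ E3 (fun x : N => TangentSpace (𝓡 3) x) :=
    { h with contMDiff := h.contMDiff.of_le le_top }
  refine ⟨fun b u B w hb hu hpos _ hB hm hw hS p =>
    exists_vertical_solution (h := h') hvol hb hu hpos hB hm hw hS p,
    fun _ u A f F hu hpos hnc hA hm hf hF hF0 hs => ?_⟩
  obtain ⟨b, w, f₀, hb, hw, hS, hf₀, hE, hR⟩ := exists_of_isSolitonFlowOn (h := h') hvol hu hpos hnc
    hA hm hf hF.contDiffOn_inChart hF0 hs
  -- The form `A` itself serves as `B`, with `v = 0`: on all of `N` it already satisfies `i_F dA =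
  -- (b/2) A`.
  refine ⟨b, A, w, fun _ => 0, f₀, hb, isHarmonic_of_isMonopole (h := h') hvol hu hpos hA hm,
    hA, hm, hw, hS, contMDiff_const, hf₀, ?_, hE, hR⟩
  funext x
  have h0 : dform (𝓡 3) (fun _ : N => (0 : ℝ)) x = 0 := (hasMFDerivAt_const _ _).mfderiv
  rw [Pi.add_apply, h0, add_zero]
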